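/- Let $k$ be an algebraically closed field of characteristic $0$, let $X$ be a smooth affine variety over $k$ with coordinate ring $\mathcal O=\mathcal O(X)$, and let $\mathcal D$ be the ring of $k$-linear differential operators on $\mathcal O$, i.e. $\mathcal D=\bigcup_{i\ge 0}F_i$ with $F_{-1}=0$ and $F_i=\{P\in\operatorname{End}_k(\mathcal O): [P,f]\in F_{i-1}\ \forall f\in\mathcal O\}$. Let $\mathtt{DGDM}$ be the category of non-negatively graded chain complexes of left $\mathcal D$-modules, with the symmetric monoidal structure given by the tensor product $\otimes$ of complexes over $\mathcal O$ (vector fields act by the Leibniz rule, the symmetry carries the Koszul sign, and the unit is $\mathcal O$ in degree $0$). Its weak equivalences are the quasi-isomorphisms and its fibrations are the chain maps that are surjective in all degrees $>0$. Let $\mathtt{DGDA}$ be the category of commutative monoids in $\mathtt{DGDM}$. Let $S^n$ ($n\ge 0$) be $\mathcal D$ placed in degree $n$, let $D^n$ ($n\ge 1$) be the complex $\mathcal D\xrightarrow{\ \mathrm{id}\ }\mathcal D$ in degrees $n,n-1$, and put $$I=\{0\to S^0\}\cup\{S^{n-1}\hookrightarrow D^n : n\ge 1\},\qquad J=\{0\to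 D^n: n\ge 1\}.$$ Let $\mathcal A\in\mathtt{DGDA}$, let $\mathtt{Mod}(\mathcal A)$ be the category of $\mathcal A$-modules in $\mathtt{DGDM}$, let $\Phi:\mathtt{Mod}(\mathcal A)\to\mathtt{DGDM}$ be the forgetful functor and let $\Sigma=\mathcal A\otimes-:\mathtt{DGDM}\to\mathtt{Mod}(\mathcal A)$ be its left adjoint, the free module functor. Call a morphism $\psi$ of $\mathtt{Mod}(\mathcal A)$ a weak equivalence (a fibration) if $\Phi(\psi)$ is a weak equivalence (a fibration) of $\mathtt{DGDM}$, and a cofibration if it has the left lifting property with respect to all morphisms that are both fibrations and weak equivalences. Then: 1. With these three classes, $\mathtt{Mod}(\mathcal A)$ is a model category; it has all small limits and colimits, and both factorizations (cofibration followed by trivial fibration, trivial cofibration followed by fibration) can be chosen functorially. 2. It is cofibrantly generated, with $\Sigma(I)$ as set of generating cofibrations and $\Sigma(J)$ as set of generating trivial cofibrations: the fibrations (trivial fibrations) are exactly the morphisms with the right lifting property with respect to $\Sigma(J)$ (to $\Sigma(I)$), and the domains of $\Sigma(I)$ (of $\Sigma(J)$) are small relative to the transfinite compositions of pushouts of morphisms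 of $\Sigma(I)$ (of $\Sigma(J)$). 3. $\mathtt{Mod}(\mathcal A)$ is closed symmetric monoidal for $\otimes_{\mathcal A}$, with unit $\mathcal A$; here $M\otimes_{\mathcal A}N$ is the coequalizer in $\mathtt{DGDM}$ of the two maps $M\otimes\mathcal A\otimes N\rightrightarrows M\otimes N$ given by the actions of $\mathcal A$ on $M$ (through the symmetry) and on $N$, with the induced action of $\mathcal A$ and the coherence isomorphisms induced from $\mathtt{DGDM}$. With this structure it is a symmetric monoidal model category: the pushout-product of two cofibrations is a cofibration, which is trivial if one of the two is trivial; and if $Q$ is cofibrant and $q:Q\to\mathcal A$ is a trivial fibration, then $q\otimes_{\mathcal A}C$ is a weak equivalence for every cofibrant $C$. 4. $\mathtt{Mod}(\mathcal A)$ satisfies the monoid axiom: every transfinite composition of pushouts of morphisms of the form $\varphi\otimes_{\mathcal A}\mathrm{id}_C$, with $\varphi$ a trivial cofibration and $C$ an object, is a weak equivalence. 5. Let $U=\Phi\Sigma$ be the monad on $\mathtt{DGDM}$ induced by the adjunction $\Sigma\dashv\Phi$. The comparison functor from $\mathtt{Mod}(\mathcal A)$ to the Eilenberg–Moore category $\mathtt{DGDM}^{U}$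 of $U$-algebras is an equivalence of categories. -/

import Mathlib

set_option linter.unusedSimpArgs false
set_option linter.unusedSectionVars false

universe u

open CategoryTheory CategoryTheory.Limits MonoidalCategory HomotopicalAlgebra

noncomputable section

namespace DMod

section DifferentialOperators

variable (k O : Type u) [Field k] [CommRing O] [Algebra k O]

/-- The `k`-linear differential operators on `O` of order `< n`: only `0` has order `< 0`, and `P`
has order `< n + 1` if its commutators with all functions have order `< n`. -/
def ordLT : ℕ → Submodule k (Module.End k O)
  | 0 => ⊥
  | n + 1 =>
    { carrier := {P | ∀ f : O, P * Algebra.lmul k O f - Algebra.lmul k O f * P ∈ ordLT n}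
      add_mem' := fun {P Q} hP hQ f => by
        have := add_mem (hP f) (hQ f)
        convert this using 1; noncomm_ring
      zero_mem' := fun f => by simp
      smul_mem' := fun c P hP f => by
        have := (ordLT n).smul_mem c (hP f)
        convert this using 1; simp [smul_sub] }

variable {k O}

theorem mem_ordLT_succ {n : ℕ} {P : Module.End k O} : P ∈ ordLT k O (n + 1) ↔
    ∀ f : O, P * Algebra.lmul k O f - Algebra.lmul k O f * P ∈ ordLT k O n := Iff.rfl

theorem ordLT_le_succ (n : ℕ) : ordLT k O n ≤ ordLT k O (n + 1) := by
  induction n with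
  | zero => exact bot_le
  | succ n ih => exact fun P hP f => ih (hP f)

theorem ordLT_mono {m n : ℕ} (h : m ≤ n) : ordLT k O m ≤ ordLT k O n :=
  monotone_nat_of_le_succ ordLT_le_succ h

theorem lmul_mem_ordLT (f : O) : Algebra.lmul k O f ∈ ordLT k O 1 := fun g => by
  have : Algebra.lmul k O f * Algebra.lmul k O g - Algebra.lmul k O g * Algebra.lmul k O f = 0 := by
    rw [← map_mul, ← map_mul, mul_comm, sub_self]
  rw [this]; exact zero_mem _

theorem mul_mem_ordLT : ∀ (s m n : ℕ), m + n = s → ∀ {P Q : Module.End k O},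
    P ∈ ordLT k O m → Q ∈ ordLT k O n → P * Q ∈ ordLT k O (m + n - 1) := by
  intro s
  induction s with
  | zero =>
    intro m n h P Q hP hQ
    obtain rfl : m = 0 := by omega
    have : P = 0 := hP
    simp [this]
  | succ s ih =>
    intro m n h P Q hP hQ
    rcases m with _ | m
    · have : P = 0 := hP
      simp [this]
    rcases n with _ | n
    · have : Q = 0 := hQ
      simp [this]
    have e : m + 1 + (n + 1) - 1 = (m + n) + 1 := by omega
    rw [e]
    intro f
    have h1 := ih m (n + 1) (by omega) (hP f) hQ
    have h2 := ih (m + 1) n (by omega) hP (hQ f)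
    have e1 : m + (n + 1) - 1 = m + n := by omega
    have e2 : m + 1 + n - 1 = m + n := by omega
    rw [e1] at h1
    rw [e2] at h2
    convert add_mem h2 h1 using 1
    (simp only [mul_sub, sub_mul, mul_add, add_mul, mul_assoc, one_mul]; abel)

variable (k O)

/-- The ring of `k`-linear differential operators on `O`. -/
def diffOp : Subalgebra k (Module.End k O) where
  carrier := {P | ∃ n, P ∈ ordLT k O n}
  mul_mem' := by
    rintro P Q ⟨m, hP⟩ ⟨n, hQ⟩
    exact ⟨_, mul_mem_ordLT _ m n rfl hP hQ⟩
  add_mem' := by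
    rintro P Q ⟨m, hP⟩ ⟨n, hQ⟩
    exact ⟨m + n, add_mem (ordLT_mono (by omega) hP) (ordLT_mono (by omega) hQ)⟩
  algebraMap_mem' c := ⟨1, by
    have := lmul_mem_ordLT (k := k) (algebraMap k O c)
    convert this using 1
    ext x
    simp [Algebra.smul_def]⟩

/-- Functions as differential operators of order zero. -/
def funOp : O →+* diffOp k O :=
  (Algebra.lmul k O).toRingHom.codRestrict (diffOp k O) (fun f => ⟨1, lmul_mem_ordLT f⟩)

theorem derivation_mem_ordLT (θ : Derivation k O O) : (θ : O →ₗ[k] O) ∈ ordLT k O 2 := fun f => by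
  convert lmul_mem_ordLT (k := k) (θ f) using 1
  ext x
  simp; ring

/-- Vector fields as differential operators of order at most one. -/
def derOp (θ : Derivation k O O) : diffOp k O := ⟨(θ : O →ₗ[k] O), 2, derivation_mem_ordLT k O θ⟩

/-- Functions and vector fields, as letters. -/
abbrev Letters := FreeAlgebra ℤ (O ⊕ Derivation k O O)

variable {k O} in
/-- The letter of a function. -/
abbrev lf (f : O) : Letters k O := FreeAlgebra.ι ℤ (Sum.inl f)

variable {k O} in
/-- The letter of a vector field. -/
abbrev ld (θ : Derivation k O O) : Letters k O := FreeAlgebra.ι ℤ (Sum.inr θ)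

/-- The fundamental relations between functions and vector fields. -/
inductive FundRel : Letters k O → Letters k O → Prop
  | one : FundRel (lf 1) 1
  | add (f g : O) : FundRel (lf (f + g)) (lf f + lf g)
  | mul (f g : O) : FundRel (lf (f * g)) (lf f * lf g)
  | dadd (θ η : Derivation k O O) : FundRel (ld (θ + η)) (ld θ + ld η)
  | smul (f : O) (θ : Derivation k O O) : FundRel (ld (f • θ)) (lf f * ld θ)
  | lie (θ η : Derivation k O O) : FundRel (ld ⁅θ, η⁆) (ld θ * ld η - ld η * ld θ)
  | leibniz (θ : Derivation k O O) (f : O) : FundRel (ld θ * lf f) (lf f * ld θ + lf (θ f))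

/-- The ring generated by functions and vector fields, with the fundamental relations. -/
def EnvRing : Type u := RingQuot (FundRel k O)

instance : Ring (EnvRing k O) := inferInstanceAs (Ring (RingQuot (FundRel k O)))

/-- The class of a word. -/
def envMk : Letters k O →+* EnvRing k O := RingQuot.mkRingHom (FundRel k O)

variable {k O}

theorem envMk_rel {x y : Letters k O} (h : FundRel k O x y) : envMk k O x = envMk k O y :=
  RingQuot.mkRingHom_rel h

/-- The class of a function. -/
def ef : O →+* EnvRing k O where
  toFun f := envMk k O (lf f)
  map_one' := by rw [envMk_rel FundRel.one, map_one]
  map_mul' f g := by rw [envMk_rel (FundRel.mul f g), map_mul]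
  map_zero' := by
    have := envMk_rel (FundRel.add (k := k) (0 : O) 0)
    rw [map_add] at this
    simpa using this
  map_add' f g := by rw [envMk_rel (FundRel.add f g), map_add]

/-- The class of a vector field. -/
def ed : Derivation k O O →+ EnvRing k O where
  toFun θ := envMk k O (ld θ)
  map_zero' := by
    have := envMk_rel (FundRel.dadd (0 : Derivation k O O) 0)
    rw [map_add] at this
    simpa using this
  map_add' f g := by rw [envMk_rel (FundRel.dadd f g), map_add]

theorem ed_smul (f : O) (θ : Derivation k O O) : ed (f • θ) = ef f * ed θ :=
  (envMk_rel (FundRel.smul f θ)).trans (map_mul _ _ _)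

theorem ed_lie (θ η : Derivation k O O) : ed ⁅θ, η⁆ = ed θ * ed η - ed η * ed θ :=
  (envMk_rel (FundRel.lie θ η)).trans (by simp [ed])

theorem ed_mul_ef (θ : Derivation k O O) (f : O) : ed θ * ef f = ef f * ed θ + ef (θ f) := by
  have := envMk_rel (FundRel.leibniz θ f)
  simpa [ed, ef] using this

/-- Induction on the number of letters. -/
theorem env_induction {p : EnvRing k O → Prop} (one : p 1) (add : ∀ u v, p u → p v → p (u + v))
    (neg : ∀ u, p u → p (-u))
    (hf : ∀ f u, p u → p (ef f * u)) (hd : ∀ θ u, p u → p (ed θ * u)) (u : EnvRing k O) : p u := by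
  have zero : p 0 := by simpa using hf 0 1 one
  suffices h : ∀ (w : Letters k O) (u : EnvRing k O), p u → p (envMk k O w * u) by
    obtain ⟨w, rfl⟩ : ∃ w, envMk k O w = u := RingQuot.mkRingHom_surjective (FundRel k O) u
    simpa using h w 1 one
  intro w
  induction w using FreeAlgebra.induction with
  | grade0 r =>
    intro u hu
    rw [eq_intCast, map_intCast]
    induction r using Int.induction_on with
    | zero => simpa using zero
    | succ n ih => push_cast; rw [add_mul, one_mul]; exact add _ _ (by simpa using ih) hu
    | pred n ih => push_cast; rw [sub_mul, one_mul, sub_eq_add_neg]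
                   exact add _ _ (by simpa using ih) (neg _ hu)
  | grade1 x =>
    intro u hu
    rcases x with f | θ
    · exact hf f u hu
    · exact hd θ u hu
  | mul a b ha hb => intro u hu; rw [map_mul, mul_assoc]; exact ha _ (hb _ hu)
  | add a b ha hb => intro u hu; rw [map_add, add_mul]; exact add _ _ (ha _ hu) (hb _ hu)

/-- The universal property of `EnvRing`. -/
def envLift {R : Type*} [Ring R] (a : O →+* R) (b : Derivation k O O →+ R)
    (hs : ∀ f θ, b (f • θ) = a f * b θ) (hl : ∀ θ η, b ⁅θ, η⁆ = b θ * b η - b η * b θ)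
    (hb : ∀ θ f, b θ * a f = a f * b θ + a (θ f)) : EnvRing k O →+* R :=
  RingQuot.lift ⟨(FreeAlgebra.lift ℤ (Sum.elim a b)).toRingHom, by
    intro x y h
    cases h <;> simp [hs, hl, hb]⟩

section

variable {R : Type*} [Ring R] (a : O →+* R) (b : Derivation k O O →+ R)
    (hs : ∀ f θ, b (f • θ) = a f * b θ) (hl : ∀ θ η, b ⁅θ, η⁆ = b θ * b η - b η * b θ)
    (hb : ∀ θ f, b θ * a f = a f * b θ + a (θ f))

theorem envLift_ef (f : O) : envLift a b hs hl hb (ef f) = a f :=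
  (RingQuot.lift_mkRingHom_apply ..).trans (by simp)

theorem envLift_ed (θ : Derivation k O O) : envLift a b hs hl hb (ed θ) = b θ :=
  (RingQuot.lift_mkRingHom_apply ..).trans (by simp)

end

variable (k O) in
/-- The canonical map to differential operators. -/
def envToOp : EnvRing k O →+* diffOp k O :=
  envLift (funOp k O) ⟨⟨derOp k O, rfl⟩, fun _ _ => rfl⟩
    (fun f θ => by ext x; rfl) (fun θ η => by ext x; rfl)
    (fun θ f => by ext x; exact (θ.leibniz f x).trans (by
      simp only [smul_eq_mul]; rw [mul_comm x]; rfl))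

theorem envToOp_ef (f : O) : envToOp k O (ef f) = funOp k O f := envLift_ef ..

theorem envToOp_ed (θ : Derivation k O O) : envToOp k O (ed θ) = derOp k O θ := envLift_ed ..

/-- A word in at most `n - 1` vector fields, with functional coefficients. -/
inductive Wd : ℕ → EnvRing k O → Prop
  | zero (n : ℕ) : Wd n 0
  | fn (n : ℕ) (f : O) : Wd (n + 1) (ef f)
  | add (n : ℕ) {u v : EnvRing k O} : Wd n u → Wd n v → Wd n (u + v)
  | up (n : ℕ) {u : EnvRing k O} : Wd n u → Wd (n + 1) u
  | der (n : ℕ) (θ : Derivation k O O) {u : EnvRing k O} : Wd n u → Wd (n + 1) (ed θ * u)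

theorem Wd.ef_mul {n : ℕ} {u : EnvRing k O} (h : Wd n u) (f : O) : Wd n (ef f * u) := by
  induction h with
  | zero n => simpa using Wd.zero n
  | fn n g => rw [← map_mul]; exact .fn _ _
  | add n _ _ h1 h2 => rw [mul_add]; exact h1.add _ h2
  | up n _ ih => exact ih.up
  | der n θ hu ih => rw [← mul_assoc, ← ed_smul]; exact hu.der _ _

theorem Wd.neg {n : ℕ} {u : EnvRing k O} (h : Wd n u) : Wd n (-u) := by
  simpa using h.ef_mul (-1)

theorem Wd.sub {n : ℕ} {u v : EnvRing k O} (h : Wd n u) (h' : Wd n v) : Wd n (u - v) := by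
  rw [sub_eq_add_neg]; exact h.add _ h'.neg

theorem Wd.sum {n : ℕ} {ι : Type*} (s : Finset ι) {u : ι → EnvRing k O}
    (h : ∀ i ∈ s, Wd n (u i)) : Wd n (∑ i ∈ s, u i) := by
  classical
  induction s using Finset.induction_on with
  | empty => simpa using Wd.zero n
  | insert i s hi ih =>
    rw [Finset.sum_insert hi]
    exact (h i (by simp)).add _ (ih fun j hj => h j (by simp [hj]))

theorem Wd.le {m n : ℕ} (hmn : m ≤ n) {u : EnvRing k O} (h : Wd m u) : Wd n u := by
  induction hmn with
  | refl => exact h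
  | step _ ih => exact ih.up

theorem Wd.eq_zero {u : EnvRing k O} (h : Wd 0 u) : u = 0 := by
  generalize hn : 0 = n at h
  induction h with
  | zero n => rfl
  | add n _ _ h1 h2 => simp [h1 hn, h2 hn]
  | fn | up | der => omega

theorem Wd.exists_fn {u : EnvRing k O} (h : Wd 1 u) : ∃ f, u = ef f := by
  generalize hn : 1 = n at h
  induction h with
  | zero n => exact ⟨0, by simp⟩
  | fn n f => exact ⟨f, rfl⟩
  | add n _ _ h1 h2 =>
    obtain ⟨f, rfl⟩ := h1 hn
    obtain ⟨g, rfl⟩ := h2 hn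
    exact ⟨f + g, by simp⟩
  | up n h => obtain rfl : n = 0 := by omega
              exact ⟨0, by simp [h.eq_zero]⟩
  | der n θ h => obtain rfl : n = 0 := by omega
                 exact ⟨0, by simp [h.eq_zero]⟩

theorem exists_wd (u : EnvRing k O) : ∃ n, Wd n u := by
  induction u using env_induction with
  | one => exact ⟨1, by simpa using Wd.fn 0 (1 : O)⟩
  | add u v hu hv =>
    obtain ⟨m, hm⟩ := hu
    obtain ⟨n, hn⟩ := hv
    exact ⟨m + n, (hm.le (by omega)).add _ (hn.le (by omega))⟩
  | neg u hu => exact ⟨_, hu.choose_spec.neg⟩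
  | hf f u hu => exact ⟨_, hu.choose_spec.ef_mul f⟩
  | hd θ u hu => exact ⟨_, hu.choose_spec.der _ θ⟩

/-- Commuting with a function lowers the order. -/
theorem Wd.comm_ef {n : ℕ} {u : EnvRing k O} (h : Wd (n + 1) u) (f : O) :
    Wd n (u * ef f - ef f * u) := by
  generalize hm : n + 1 = m at h
  induction h generalizing n with
  | zero => simpa using Wd.zero n
  | fn m g =>
    rw [← map_mul, ← map_mul, mul_comm, sub_self]; exact .zero _
  | add m _ _ h1 h2 =>
    convert (h1 hm).add _ (h2 hm) using 1; (simp only [mul_sub, sub_mul, mul_add, add_mul, mul_assoc, one_mul]; abel)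
  | up m h ih =>
    obtain rfl : n = m := by omega
    rcases n with _ | n
    · rw [h.eq_zero]; simpa using Wd.zero _
    · exact (ih rfl).up
  | @der m θ u h ih =>
    obtain rfl : n = m := by omega
    rcases n with _ | n
    · rw [h.eq_zero]; simpa using Wd.zero _
    · have e : ed θ * u * ef f - ef f * (ed θ * u) =
          ed θ * (u * ef f - ef f * u) + (ed θ * ef f - ef f * ed θ) * u := by (simp only [mul_sub, sub_mul, mul_add, add_mul, mul_assoc, one_mul]; abel)
      rw [e, ed_mul_ef, add_sub_cancel_left]
      exact ((ih rfl).der _ θ).add _ (h.ef_mul _)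

/-- Commuting with a vector field does not raise the order. -/
theorem Wd.comm_ed {n : ℕ} {u : EnvRing k O} (h : Wd n u) (θ : Derivation k O O) :
    Wd n (u * ed θ - ed θ * u) := by
  induction h with
  | zero n => simpa using Wd.zero n
  | fn n g =>
    rw [ed_mul_ef]
    have : ef g * ed θ - (ef g * ed θ + ef (θ g)) = ef (-(θ g)) := by simp
    rw [this]; exact .fn _ _
  | add n _ _ h1 h2 => convert h1.add _ h2 using 1; (simp only [mul_sub, sub_mul, mul_add, add_mul, mul_assoc, one_mul]; abel)
  | up n _ ih => exact ih.up
  | @der n η u h ih =>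
    have e : ed η * u * ed θ - ed θ * (ed η * u) =
        ed η * (u * ed θ - ed θ * u) + (ed η * ed θ - ed θ * ed η) * u := by (simp only [mul_sub, sub_mul, mul_add, add_mul, mul_assoc, one_mul]; abel)
    rw [e, ← ed_lie]
    exact (ih.der _ η).add _ (h.der _ _)

section Coordinates

variable (T : Finset O) (t : O → Derivation k O O)

/-- An Euler operator: up to lower order, it multiplies an operator by its order. -/
def euler {R : Type*} [Ring R] (a : O → R) (b : Derivation k O O → R) (u : R) : R :=
  ∑ x ∈ T, (u * a x - a x * u) * b (t x)

variable (k O) in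
/-- `t` and the differentials of the elements of `T` are dual generating systems of vector fields
and differential forms. -/
def IsDual : Prop := ∀ f : O,
  ∑ x ∈ T, (t x f) • KaehlerDifferential.D k O x = KaehlerDifferential.D k O f

variable {T t}

theorem IsDual.apply (h : IsDual k O T t) {M : Type*} [AddCommGroup M] [Module k M] [Module O M]
    [IsScalarTower k O M] (δ : Derivation k O M) (f : O) : ∑ x ∈ T, (t x f) • δ x = δ f := by
  simpa using congrArg δ.liftKaehlerDifferential (h f)

theorem IsDual.sum_smul (h : IsDual k O T t) (θ : Derivation k O O) :
    ∑ x ∈ T, (θ x) • t x = θ := by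
  ext f
  have := h.apply θ f
  rw [← this]
  have e : ∀ (s : Finset O), (∑ x ∈ s, (θ x) • t x) f = ∑ x ∈ s, (θ x) * t x f := fun s => by
    classical
    induction s using Finset.induction_on with
    | empty => simp
    | insert i s hi ih => simp [Finset.sum_insert hi, ih]
  rw [e]
  exact Finset.sum_congr rfl fun x _ => by simp [mul_comm]

theorem Wd.euler (h' : IsDual k O T t) {n : ℕ} {u : EnvRing k O} (hu : Wd (n + 1) u) :
    Wd n (DMod.euler T t ef ed u - (n : EnvRing k O) * u) := by
  generalize hm : n + 1 = m at hu
  induction hu generalizing n with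
  | zero => simpa [DMod.euler] using Wd.zero n
  | fn m f =>
    have e : DMod.euler T t ef ed (ef f : EnvRing k O) = 0 :=
      Finset.sum_eq_zero fun x _ => by rw [← map_mul, ← map_mul, mul_comm, sub_self, zero_mul]
    rw [e, zero_sub]
    rcases n with _ | n
    · simpa using Wd.zero 0
    · have := (Wd.fn n (((n + 1 : ℕ) : O) * f) : Wd (k := k) _ _).neg
      simpa using this
  | @add m u v _ _ h1 h2 =>
    convert (h1 hm).add _ (h2 hm) using 1
    have : DMod.euler T t ef ed (u + v) = DMod.euler T t ef ed u + DMod.euler T t ef ed v := by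
      simp only [DMod.euler, ← Finset.sum_add_distrib]
      exact Finset.sum_congr rfl fun x _ => by (simp only [mul_sub, sub_mul, mul_add, add_mul, mul_assoc, one_mul]; abel)
    rw [this]; (simp only [mul_sub, sub_mul, mul_add, add_mul, mul_assoc, one_mul]; abel)
  | @up m u h ih =>
    obtain rfl : n = m := by omega
    rcases n with _ | n
    · rw [h.eq_zero]; simpa [DMod.euler] using Wd.zero _
    · convert (ih rfl).up.sub h using 1
      push_cast; (simp only [mul_sub, sub_mul, mul_add, add_mul, mul_assoc, one_mul]; abel)
  | @der m θ u h ih =>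
    obtain rfl : n = m := by omega
    rcases n with _ | n
    · rw [h.eq_zero]; simpa [DMod.euler] using Wd.zero _
    · have e1 : DMod.euler T t ef ed (ed θ * u) =
          ed θ * DMod.euler T t ef ed u + ∑ x ∈ T, ef (θ x) * (u * ed (t x)) := by
        simp only [DMod.euler, Finset.mul_sum, ← Finset.sum_add_distrib]
        refine Finset.sum_congr rfl fun x _ => ?_
        have e : ed θ * u * ef x - ef x * (ed θ * u) =
          ed θ * (u * ef x - ef x * u) + (ed θ * ef x - ef x * ed θ) * u := by (simp only [mul_sub, sub_mul, mul_add, add_mul, mul_assoc, one_mul]; abel)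
        rw [e, ed_mul_ef, add_sub_cancel_left]; simp only [mul_sub, sub_mul, add_mul, mul_assoc]
      have e2 : ∑ x ∈ T, ef (θ x) * (u * ed (t x)) =
          (∑ x ∈ T, ef (θ x) * (u * ed (t x) - ed (t x) * u)) + ed θ * u := by
        have : ed θ = ∑ x ∈ T, ef (θ x) * ed (t x) := by
          conv_lhs => rw [← h'.sum_smul θ]
          rw [map_sum]
          exact Finset.sum_congr rfl fun x _ => ed_smul _ _
        conv_rhs => rw [this, Finset.sum_mul, ← Finset.sum_add_distrib]
        exact Finset.sum_congr rfl fun x _ => by (simp only [mul_sub, sub_mul, mul_add, add_mul, mul_assoc, one_mul]; abel)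
      have e3 : DMod.euler T t ef ed (ed θ * u) - ((n + 1 : ℕ) : EnvRing k O) * (ed θ * u) =
          ed θ * (DMod.euler T t ef ed u - (n : EnvRing k O) * u) +
          ∑ x ∈ T, ef (θ x) * (u * ed (t x) - ed (t x) * u) := by
        rw [e1, e2, mul_sub, ← mul_assoc (ed θ) (n : EnvRing k O), ← (Nat.cast_commute n (ed θ)).eq]
        push_cast; (simp only [mul_sub, sub_mul, mul_add, add_mul, mul_assoc, one_mul]; abel)
      rw [e3]
      exact ((ih rfl).der _ θ).add _ (Wd.sum _ fun x _ => (h.comm_ed _).ef_mul _)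

end Coordinates

theorem exists_isDual (k O : Type u) [Field k] [CommRing O] [Algebra k O] [Algebra.Smooth k O] :
    ∃ (T : Finset O) (t : O → Derivation k O O), IsDual k O T t := by
  classical
  have hsurj : (Finsupp.linearCombination O (KaehlerDifferential.D k O)).range = ⊤ := by
    rw [Finsupp.range_linearCombination, KaehlerDifferential.span_range_derivation]
  obtain ⟨s, hs⟩ := LinearMap.exists_rightInverse_of_surjective _ hsurj
  obtain ⟨S, hS⟩ := (inferInstance : Module.Finite O (Ω[O⁄k]))
  have key : ∀ ω : Ω[O⁄k], (s ω).support ⊆ S.biUnion (fun ω => (s ω).support) := by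
    intro ω
    have hω : ω ∈ Submodule.span O (S : Set (Ω[O⁄k])) := by rw [hS]; trivial
    induction hω using Submodule.span_induction with
    | mem x hx => exact Finset.subset_biUnion_of_mem (fun ω => (s ω).support) hx
    | zero => simp
    | add x y _ _ hx hy =>
      rw [map_add]; exact Finsupp.support_add.trans (Finset.union_subset hx hy)
    | smul a x _ hx => rw [map_smul]; exact Finsupp.support_smul.trans hx
  refine ⟨S.biUnion (fun ω => (s ω).support),
    fun x => ((Finsupp.lapply x ∘ₗ s).compDer (KaehlerDifferential.D k O)), fun f => ?_⟩
  have := LinearMap.congr_fun hs (KaehlerDifferential.D k O f)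
  rw [LinearMap.comp_apply, Finsupp.linearCombination_apply,
    Finsupp.sum_of_support_subset _ (key _) _ (by simp)] at this
  simpa using this

section

variable {T : Finset O} {t : O → Derivation k O O}

theorem exists_cast_inv (k : Type u) {O : Type u} [Field k] [CommRing O] [Algebra k O] [CharZero k]
    (n : ℕ) : ∃ c : O, c * ((n + 1 : ℕ) : O) = 1 := by
  refine ⟨algebraMap k O ((n + 1 : ℕ) : k)⁻¹, ?_⟩
  rw [← map_natCast (algebraMap k O), ← map_mul,
    inv_mul_cancel₀ (Nat.cast_ne_zero.2 (Nat.succ_ne_zero n)), map_one]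

theorem envToOp_injective [CharZero k] (h : IsDual k O T t) : Function.Injective (envToOp k O) := by
  suffices H : ∀ (n : ℕ) (u : EnvRing k O), Wd n u → envToOp k O u = 0 → u = 0 from
    (injective_iff_map_eq_zero _).2 fun u hu => (exists_wd u).elim fun n hn => H n u hn hu
  intro n
  induction n with
  | zero => exact fun u hu _ => hu.eq_zero
  | succ n ih =>
    intro u hu h0
    have hc : ∀ f, u * ef f - ef f * u = 0 := fun f =>
      ih _ (hu.comm_ef f) (by rw [map_sub, map_mul, map_mul, h0]; simp)
    have hE := hu.euler h
    have hE0 : euler T t ef ed u = 0 := Finset.sum_eq_zero fun x _ => by rw [hc, zero_mul]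
    rcases n with _ | n
    · obtain ⟨f, rfl⟩ := hu.exists_fn
      rw [envToOp_ef] at h0
      have : f = 0 := by
        have h1 := congrArg (fun P : diffOp k O => (P : Module.End k O) 1) h0
        simpa [funOp] using h1
      rw [this, map_zero]
    · rw [hE0, zero_sub] at hE
      obtain ⟨c, hc'⟩ := exists_cast_inv k (O := O) n
      have := (hE.neg).ef_mul c
      rw [neg_neg, ← map_natCast (ef (k := k) (O := O)), ← mul_assoc, ← map_mul, hc', map_one,
        one_mul] at this
      exact ih u this h0

theorem ordLT_lmul_mul {n : ℕ} {P : Module.End k O} (hP : P ∈ ordLT k O n) (f : O) :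
    Algebra.lmul k O f * P ∈ ordLT k O n := by
  have := mul_mem_ordLT _ 1 n rfl (lmul_mem_ordLT f) hP
  simpa using this

/-- Operators of order `< n`, as a left module over functions. -/
def ordLTO (k O : Type u) [Field k] [CommRing O] [Algebra k O] (n : ℕ) :
    Submodule O (Module.End k O) where
  carrier := {P | P ∈ ordLT k O n}
  add_mem' := (ordLT k O n).add_mem
  zero_mem' := (ordLT k O n).zero_mem
  smul_mem' f P hP := (ordLT_lmul_mul hP f : Algebra.lmul k O f * P ∈ ordLT k O n)

/-- The symbol of an operator, as a derivation. -/
def symb {n : ℕ} {P : Module.End k O} (hP : P ∈ ordLT k O (n + 2)) :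
    Derivation k O (Module.End k O ⧸ ordLTO k O n) :=
  Derivation.mk'
    { toFun := fun f => Submodule.Quotient.mk (P * Algebra.lmul k O f - Algebra.lmul k O f * P)
      map_add' := fun f g => by
        rw [← Submodule.Quotient.mk_add, map_add]; congr 1
        simp only [mul_add, add_mul]; abel
      map_smul' := fun c f => by
        rw [RingHom.id_apply, ← Submodule.Quotient.mk_smul, map_smul]; congr 1
        simp [smul_sub] }
    (fun f g => by
      change Submodule.Quotient.mk _ = f • Submodule.Quotient.mk _ + g • Submodule.Quotient.mk _
      rw [← Submodule.Quotient.mk_smul, ← Submodule.Quotient.mk_smul, ← Submodule.Quotient.mk_add,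
        Submodule.Quotient.eq]
      have hP' : (P * Algebra.lmul k O f - Algebra.lmul k O f * P) * Algebra.lmul k O g -
          Algebra.lmul k O g * (P * Algebra.lmul k O f - Algebra.lmul k O f * P) ∈
          ordLTO k O n := hP f g
      convert hP' using 1
      have e : ∀ (a : O) (Q : Module.End k O), a • Q = Algebra.lmul k O a * Q := fun _ _ => rfl
      rw [e, e, map_mul]
      simp only [mul_sub, sub_mul, mul_assoc]
      have e' : Algebra.lmul k O g * (Algebra.lmul k O f * P) =
          Algebra.lmul k O f * (Algebra.lmul k O g * P) := by
        rw [← mul_assoc, ← mul_assoc, ← map_mul, ← map_mul, mul_comm]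
      rw [e']
      abel)

theorem symb_mem (h : IsDual k O T t) {n : ℕ} {P : Module.End k O} (hP : P ∈ ordLT k O (n + 2))
    (f : O) : ∑ x ∈ T, Algebra.lmul k O (t x f) *
      (P * Algebra.lmul k O x - Algebra.lmul k O x * P) -
      (P * Algebra.lmul k O f - Algebra.lmul k O f * P) ∈ ordLT k O n := by
  have h1 := h.apply (symb hP) f
  change _ = Submodule.Quotient.mk _ at h1
  have e : ∑ x ∈ T, (t x f) • symb hP x = (Submodule.mkQ (ordLTO k O n))
      (∑ x ∈ T, Algebra.lmul k O (t x f) *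
      (P * Algebra.lmul k O x - Algebra.lmul k O x * P)) := by
    rw [map_sum]; rfl
  rw [e] at h1
  exact (Submodule.Quotient.eq (ordLTO k O n)).1 h1

theorem euler_mem (h : IsDual k O T t) : ∀ (n : ℕ) {P : Module.End k O}, P ∈ ordLT k O (n + 1) →
    euler T t (Algebra.lmul k O) (fun θ => (θ : O →ₗ[k] O)) P - (n : Module.End k O) * P ∈
      ordLT k O n := by
  intro n
  induction n with
  | zero =>
    intro P hP
    have : euler T t (Algebra.lmul k O) (fun θ => (θ : O →ₗ[k] O)) P = 0 :=
      Finset.sum_eq_zero fun x _ => by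
        have : P * Algebra.lmul k O x - Algebra.lmul k O x * P = 0 := hP x
        rw [this, zero_mul]
    rw [this]; simp
  | succ n ih =>
    intro P hP f
    set m := Algebra.lmul k O with hm
    have hd : ∀ (θ : Derivation k O O), (θ : O →ₗ[k] O) * m f =
        m f * (θ : O →ₗ[k] O) + m (θ f) := fun θ => by
      ext x
      exact (θ.leibniz f x).trans (by simp only [smul_eq_mul]; rw [mul_comm x]; rfl)
    have hmm : ∀ x y : O, m x * m y = m y * m x := fun x y => by
      rw [← map_mul, ← map_mul, mul_comm]
    have hc : (n + 1 : ℕ) * P * m f - m f * ((n + 1 : ℕ) * P) =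
        (n : Module.End k O) * (P * m f - m f * P) + (P * m f - m f * P) := by
      rw [← mul_assoc (m f), ← (Nat.cast_commute (n + 1) (m f)).eq]
      push_cast
      simp only [mul_sub, add_mul, mul_assoc, one_mul]; abel
    have e1 : euler T t m (fun θ => (θ : O →ₗ[k] O)) P * m f -
        m f * euler T t m (fun θ => (θ : O →ₗ[k] O)) P =
        euler T t m (fun θ => (θ : O →ₗ[k] O)) (P * m f - m f * P) +
          ∑ x ∈ T, (P * m x - m x * P) * m (t x f) := by
      simp only [euler, Finset.mul_sum, Finset.sum_mul, ← Finset.sum_sub_distrib,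
        ← Finset.sum_add_distrib]
      refine Finset.sum_congr rfl fun x _ => ?_
      rw [mul_assoc _ _ (m f), hd]
      have e' : (P * m f - m f * P) * m x - m x * (P * m f - m f * P) =
          (P * m x - m x * P) * m f - m f * (P * m x - m x * P) := by
        simp only [mul_sub, sub_mul, mul_assoc]
        rw [hmm f x, ← mul_assoc (m x) (m f), hmm x f, mul_assoc (m f)]; abel
      rw [e']
      simp only [mul_sub, sub_mul, mul_add, mul_assoc]; abel
    have e2 : ∑ x ∈ T, (P * m x - m x * P) * m (t x f) =
        ∑ x ∈ T, m (t x f) * (P * m x - m x * P) +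
        ∑ x ∈ T, ((P * m x - m x * P) * m (t x f) - m (t x f) * (P * m x - m x * P)) := by
      rw [← Finset.sum_add_distrib]
      exact Finset.sum_congr rfl fun x _ => by abel
    have e3 : (euler T t m (fun θ => (θ : O →ₗ[k] O)) P - (n + 1 : ℕ) * P) * m f -
        m f * (euler T t m (fun θ => (θ : O →ₗ[k] O)) P - (n + 1 : ℕ) * P) =
        (euler T t m (fun θ => (θ : O →ₗ[k] O)) (P * m f - m f * P) -
          (n : Module.End k O) * (P * m f - m f * P)) +
        ((∑ x ∈ T, m (t x f) * (P * m x - m x * P) - (P * m f - m f * P)) +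
        ∑ x ∈ T, ((P * m x - m x * P) * m (t x f) - m (t x f) * (P * m x - m x * P))) := by
      rw [sub_mul, mul_sub]
      have : ∀ a b c d : Module.End k O, a - b - (c - d) = (a - c) - (b - d) := fun _ _ _ _ => by
        abel
      rw [this, e1, e2, hc]; abel
    rw [e3]
    refine add_mem (ih (hP f)) (add_mem (symb_mem h hP f) (sum_mem fun x _ => hP x _))

theorem envToOp_surjective [CharZero k] (h : IsDual k O T t) : Function.Surjective (envToOp k O) := by
  suffices H : ∀ (n : ℕ) (P : Module.End k O), P ∈ ordLT k O n →
      ∃ u, (envToOp k O u : Module.End k O) = P by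
    rintro ⟨P, n, hP⟩
    obtain ⟨u, hu⟩ := H n P hP
    exact ⟨u, Subtype.ext hu⟩
  intro n
  induction n with
  | zero => exact fun P hP => ⟨0, by rw [map_zero]; exact (show P = 0 from hP).symm⟩
  | succ n ih =>
    intro P hP
    rcases n with _ | n
    · refine ⟨ef (P 1), ?_⟩
      rw [envToOp_ef]
      ext x
      have h1 : P * Algebra.lmul k O x - Algebra.lmul k O x * P = 0 := hP x
      have h2 := LinearMap.congr_fun h1 1
      have h3 : P (x * 1) - x * P 1 = 0 := h2
      rw [mul_one, sub_eq_zero] at h3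
      rw [h3, mul_comm]; rfl
    · obtain ⟨u, hu⟩ := ih _ (euler_mem h _ hP)
      choose v hv using fun x => ih _ (hP x)
      obtain ⟨c, hc⟩ := exists_cast_inv k (O := O) n
      refine ⟨ef c * (∑ x ∈ T, v x * ed (t x) - u), ?_⟩
      have e : ((envToOp k O (∑ x ∈ T, v x * ed (t x) - u) : diffOp k O) : Module.End k O) =
          ((n + 1 : ℕ) : Module.End k O) * P := by
        rw [map_sub, map_sum]
        push_cast
        rw [hu]
        simp only [map_mul, envToOp_ed]
        push_cast
        simp only [hv, euler, derOp]
        abel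
      rw [map_mul, envToOp_ef]
      rw [Subalgebra.coe_mul]
      have e2 : ((n + 1 : ℕ) : Module.End k O) = Algebra.lmul k O ((n + 1 : ℕ) : O) :=
        (map_natCast (Algebra.lmul k O) _).symm
      have e3 : ((funOp k O c : diffOp k O) : Module.End k O) = Algebra.lmul k O c := rfl
      rw [e, e2, e3, ← mul_assoc, ← map_mul, hc, map_one, one_mul]

end

variable (k O) in
/-- On a smooth affine variety in characteristic zero, differential operators are generated by
functions and vector fields, with the fundamental relations. -/
def envEquiv [CharZero k] [Algebra.Smooth k O] : EnvRing k O ≃+* diffOp k O :=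
  RingEquiv.ofBijective (envToOp k O)
    ⟨envToOp_injective (exists_isDual k O).choose_spec.choose_spec,
      envToOp_surjective (exists_isDual k O).choose_spec.choose_spec⟩

end DifferentialOperators

section TensorProduct

variable (k O : Type u) [Field k] [CommRing O] [Algebra k O]

/-- The ring `D` of differential operators on `O`. -/
def DRing : Type u := diffOp k O

instance : Ring (DRing k O) := inferInstanceAs (Ring (diffOp k O))

instance : Module (DRing k O) O := inferInstanceAs (Module (diffOp k O) O)

/-- Functions as differential operators. -/
def funD : O →+* DRing k O := funOp k O

/-- Vector fields as differential operators. -/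
def derD (θ : Derivation k O O) : DRing k O := derOp k O θ

/-- The canonical map to differential operators. -/
def envD : EnvRing k O →+* DRing k O := envToOp k O

theorem envD_ef (f : O) : envD k O (ef f) = funD k O f := envToOp_ef f

theorem envD_ed (θ : Derivation k O O) : envD k O (ed θ) = derD k O θ := envToOp_ed θ

/-- The presentation of the ring of differential operators. -/
def envEquivD [CharZero k] [Algebra.Smooth k O] : EnvRing k O ≃+* DRing k O := envEquiv k O

/-- Left modules over the ring of differential operators. -/
abbrev DCat := ModuleCat.{u} (DRing k O)

/-- The functor that only remembers the action of functions. -/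
abbrev resO : DCat k O ⥤ ModuleCat.{u} O := ModuleCat.restrictScalars (funD k O)

variable {k O}

/-- The underlying `O`-module of a `D`-module. -/
abbrev und (M : DCat k O) : ModuleCat.{u} O := (resO k O).obj M

instance (M : DCat k O) : Module (DRing k O) (und M) := inferInstanceAs (Module _ M)

theorem funD_smul (M : DCat k O) (f : O) (m : und M) : funD k O f • m = f • m := rfl

theorem derD_mul_funD (θ : Derivation k O O) (f : O) :
    derD k O θ * funD k O f = funD k O f * derD k O θ + funD k O (θ f) := by
  rw [← envD_ef, ← envD_ef, ← envD_ed, ← map_mul, ed_mul_ef, map_add, map_mul]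

theorem derD_smul (M : DCat k O) (θ : Derivation k O O) (f : O) (m : und M) :
    derD k O θ • f • m = f • derD k O θ • m + (θ f) • m := by
  rw [← funD_smul, ← funD_smul, ← funD_smul, ← mul_smul, derD_mul_funD, add_smul, mul_smul]

theorem lie_smul (M : DCat k O) (θ η : Derivation k O O) (m : und M) :
    derD k O ⁅θ, η⁆ • m = derD k O θ • derD k O η • m - derD k O η • derD k O θ • m := by
  have : derD k O ⁅θ, η⁆ = derD k O θ * derD k O η - derD k O η * derD k O θ := rfl
  rw [← mul_smul, ← mul_smul, this]
  exact sub_smul _ _ _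

variable [CharZero k] [Algebra.Smooth k O]

/-- The action of differential operators determined by the actions of functions and vector
fields. -/
def opLift {R : Type*} [Ring R] (a : O →+* R) (b : Derivation k O O →+ R)
    (hs : ∀ f θ, b (f • θ) = a f * b θ) (hl : ∀ θ η, b ⁅θ, η⁆ = b θ * b η - b η * b θ)
    (hb : ∀ θ f, b θ * a f = a f * b θ + a (θ f)) : DRing k O →+* R :=
  (envLift a b hs hl hb).comp (envEquivD k O).symm.toRingHom

section

variable {R : Type*} [Ring R] (a : O →+* R) (b : Derivation k O O →+ R)
    (hs : ∀ f θ, b (f • θ) = a f * b θ) (hl : ∀ θ η, b ⁅θ, η⁆ = b θ * b η - b η * b θ)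
    (hb : ∀ θ f, b θ * a f = a f * b θ + a (θ f))

theorem opLift_funD (f : O) : opLift a b hs hl hb (funD k O f) = a f := by
  have : (envEquivD k O).symm (funD k O f) = ef f :=
    (RingEquiv.symm_apply_eq _).2 (envD_ef k O f).symm
  exact (congrArg _ this).trans (envLift_ef a b hs hl hb f)

theorem opLift_derD (θ : Derivation k O O) : opLift a b hs hl hb (derD k O θ) = b θ := by
  have : (envEquivD k O).symm (derD k O θ) = ed θ :=
    (RingEquiv.symm_apply_eq _).2 (envD_ed k O θ).symm
  exact (congrArg _ this).trans (envLift_ed a b hs hl hb θ)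

end

/-- An additive map that respects the actions of functions and vector fields is `D`-linear. -/
theorem map_op_smul {M N : Type*} [AddCommGroup M] [AddCommGroup N] [Module (DRing k O) M]
    [Module (DRing k O) N] (φ : M →+ N) (hf : ∀ (f : O) m, φ (funD k O f • m) = funD k O f • φ m)
    (hd : ∀ (θ : Derivation k O O) m, φ (derD k O θ • m) = derD k O θ • φ m)
    (P : DRing k O) (m : M) : φ (P • m) = P • φ m := by
  obtain ⟨u, rfl⟩ := (envEquivD k O).surjective P
  change φ (envD k O u • m) = envD k O u • φ m
  induction u using env_induction generalizing m with
  | one => simp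
  | add u v hu hv => simp [add_smul, hu, hv]
  | neg u hu => simp [hu]
  | hf f u hu => rw [map_mul, mul_smul, mul_smul, envD_ef, hf, hu]
  | hd θ u hu => rw [map_mul, mul_smul, mul_smul, envD_ed, hd, hu]

open scoped TensorProduct

/-- The Leibniz action of a vector field on `M ⊗ N` (tensor product over functions). -/
def derTensor (M N : DCat k O) (θ : Derivation k O O) :
    (und M ⊗[O] und N) →+ (und M ⊗[O] und N) :=
  TensorProduct.liftAddHom
    { toFun := fun m =>
        { toFun := fun n => (derD k O θ • m) ⊗ₜ[O] n + m ⊗ₜ[O] (derD k O θ • n)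
          map_zero' := by simp
          map_add' := fun x y => by simp [TensorProduct.tmul_add]; abel }
      map_zero' := by ext; simp
      map_add' := fun x y => by ext; simp [TensorProduct.add_tmul]; abel }
    (fun f m n => by
      simp only [AddMonoidHom.coe_mk, ZeroHom.coe_mk, derD_smul, TensorProduct.add_tmul,
        TensorProduct.tmul_add, TensorProduct.smul_tmul]
      abel)

theorem derTensor_tmul (M N : DCat k O) (θ : Derivation k O O) (m : und M) (n : und N) :
    derTensor M N θ (m ⊗ₜ n) = (derD k O θ • m) ⊗ₜ[O] n + m ⊗ₜ[O] (derD k O θ • n) := rfl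

theorem addHom_ext_tmul {M N : ModuleCat.{u} O} {P : Type*} [AddCommGroup P]
    {φ ψ : (M ⊗[O] N) →+ P} (h : ∀ m n, φ (m ⊗ₜ n) = ψ (m ⊗ₜ n)) : φ = ψ := by
  ext x
  induction x using TensorProduct.induction_on with
  | zero => simp
  | tmul m n => exact h m n
  | add x y hx hy => rw [map_add, map_add, hx, hy]

/-- The action of differential operators on `M ⊗ N`: functions act on either factor, and vector
fields act by the Leibniz rule. -/
def tensorAct (M N : DCat k O) : DRing k O →+* AddMonoid.End (und M ⊗[O] und N) :=
  opLift (Module.toAddMonoidEnd O (und M ⊗[O] und N))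
    { toFun := derTensor M N
      map_zero' := addHom_ext_tmul fun m n => by
        have : derD k O 0 = 0 := rfl
        change derTensor M N 0 (m ⊗ₜ n) = 0
        simp [derTensor_tmul, this]
      map_add' := fun θ η => addHom_ext_tmul fun m n => by
        have : derD k O (θ + η) = derD k O θ + derD k O η := rfl
        change derTensor M N (θ + η) (m ⊗ₜ n) =
          derTensor M N θ (m ⊗ₜ n) + derTensor M N η (m ⊗ₜ n)
        simp only [derTensor_tmul, this, add_smul, TensorProduct.add_tmul,
          TensorProduct.tmul_add]
        abel }
    (fun f θ => addHom_ext_tmul fun m n => by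
      have : derD k O (f • θ) = funD k O f * derD k O θ := rfl
      change derTensor M N (f • θ) (m ⊗ₜ n) = f • derTensor M N θ (m ⊗ₜ n)
      simp only [derTensor_tmul, this, mul_smul, funD_smul, smul_add, TensorProduct.tmul_smul]
      rfl)
    (fun θ η => addHom_ext_tmul fun m n => by
      have hM : ∀ x : und M, derD k O ⁅θ, η⁆ • x =
          derD k O θ • derD k O η • x - derD k O η • derD k O θ • x := fun x => lie_smul M θ η x
      have hN : ∀ x : und N, derD k O ⁅θ, η⁆ • x =
          derD k O θ • derD k O η • x - derD k O η • derD k O θ • x := fun x => lie_smul N θ η x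
      change derTensor M N ⁅θ, η⁆ (m ⊗ₜ n) =
        derTensor M N θ (derTensor M N η (m ⊗ₜ n)) - derTensor M N η (derTensor M N θ (m ⊗ₜ n))
      simp only [derTensor_tmul, hM, hN, map_add, TensorProduct.sub_tmul,
        TensorProduct.tmul_sub]
      abel)
    (fun θ f => addHom_ext_tmul fun m n => by
      change derTensor M N θ ((f • m) ⊗ₜ n) =
        f • derTensor M N θ (m ⊗ₜ n) + (θ f • m) ⊗ₜ n
      simp only [derTensor_tmul, derD_smul, smul_add, TensorProduct.add_tmul,
        TensorProduct.smul_tmul', TensorProduct.tmul_smul]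
      abel)

/-- The tensor product over functions of two `D`-modules. -/
def tensorD (M N : DCat k O) : DCat k O :=
  letI : Module (DRing k O) (und M ⊗[O] und N) := Module.compHom _ (tensorAct M N)
  ModuleCat.of (DRing k O) (und M ⊗[O] und N)

/-- The identification of the underlying additive group. -/
def tensorDEquiv (M N : DCat k O) : (und M ⊗[O] und N) ≃+ und (tensorD M N) :=
  AddEquiv.refl _

theorem funD_tensorDEquiv (M N : DCat k O) (f : O) (x : und M ⊗[O] und N) :
    funD k O f • tensorDEquiv M N x = tensorDEquiv M N (f • x) :=
  DFunLike.congr_fun (opLift_funD ..) x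

theorem derD_tensorDEquiv (M N : DCat k O) (θ : Derivation k O O) (x : und M ⊗[O] und N) :
    derD k O θ • tensorDEquiv M N x = tensorDEquiv M N (derTensor M N θ x) :=
  DFunLike.congr_fun (opLift_derD ..) x

/-- The underlying `O`-module of the tensor product. -/
def tensorDIso (M N : DCat k O) : und M ⊗ und N ≅ und (tensorD M N) :=
  ((tensorDEquiv M N).toLinearEquiv fun f x => (funD_tensorDEquiv M N f x).symm).toModuleIso

/-- Structure morphisms of `O`-modules that respect vector fields are `D`-linear. -/
def homOfRes {M N : DCat k O} (φ : und M ⟶ und N)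
    (hd : ∀ (θ : Derivation k O O) (m : und M), φ.hom (derD k O θ • m) = derD k O θ • φ.hom m) :
    M ⟶ N :=
  ModuleCat.ofHom
    { toFun := fun m => φ.hom m
      map_add' := fun x y => map_add φ.hom x y
      map_smul' := fun P m => map_op_smul (M := und M) (N := und N) φ.hom.toAddMonoidHom
        (fun f m => φ.hom.map_smul f m) hd P m }

theorem resO_homOfRes {M N : DCat k O} (φ : und M ⟶ und N)
    (hd : ∀ (θ : Derivation k O O) (m : und M), φ.hom (derD k O θ • m) = derD k O θ • φ.hom m) :
    (resO k O).map (homOfRes φ hd) = φ := rfl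

/-- Isomorphisms of `O`-modules that respect vector fields are `D`-linear. -/
def isoOfRes {M N : DCat k O} (φ : und M ≅ und N)
    (hd : ∀ (θ : Derivation k O O) (m : und M),
      φ.hom.hom (derD k O θ • m) = derD k O θ • φ.hom.hom m) : M ≅ N where
  hom := homOfRes φ.hom hd
  inv := homOfRes φ.inv (fun θ n => by
    obtain ⟨m, rfl⟩ : ∃ m, φ.hom.hom m = n := ⟨φ.inv.hom n, by simp⟩
    rw [← hd]; simp)
  hom_inv_id := (resO k O).map_injective (by
    rw [Functor.map_comp, resO_homOfRes, resO_homOfRes, φ.hom_inv_id, CategoryTheory.Functor.map_id])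
  inv_hom_id := (resO k O).map_injective (by
    rw [Functor.map_comp, resO_homOfRes, resO_homOfRes, φ.inv_hom_id, CategoryTheory.Functor.map_id])

/-- The `D`-module of functions. -/
def unitD (k O : Type u) [Field k] [CommRing O] [Algebra k O] : DCat k O :=
  ModuleCat.of (DRing k O) O

/-- The underlying `O`-module of the `D`-module of functions. -/
def unitDIso (k O : Type u) [Field k] [CommRing O] [Algebra k O] :
    𝟙_ (ModuleCat.{u} O) ≅ und (unitD k O) :=
  ((AddEquiv.refl O : O ≃+ und (unitD k O)).toLinearEquiv fun _ _ => rfl).toModuleIso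

theorem derD_unitDIso (θ : Derivation k O O) (f : O) :
    derD k O θ • (unitDIso k O).hom.hom f = (unitDIso k O).hom.hom (θ f) := rfl

theorem derD_tensorDIso (M N : DCat k O) (θ : Derivation k O O) (m : und M) (n : und N) :
    derD k O θ • (tensorDIso M N).hom.hom (m ⊗ₜ n) = (tensorDIso M N).hom.hom
      ((derD k O θ • m) ⊗ₜ[O] n) + (tensorDIso M N).hom.hom (m ⊗ₜ[O] (derD k O θ • n)) :=
  (derD_tensorDEquiv M N θ _).trans (map_add (tensorDEquiv M N)
    ((derD k O θ • m) ⊗ₜ[O] n) (m ⊗ₜ[O] (derD k O θ • n)))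

theorem tensorDIso_inv_hom (M N : DCat k O) (x : (und M ⊗[O] und N)) :
    (tensorDIso M N).inv.hom ((tensorDIso M N).hom.hom x) = x := rfl

/-- Compatibility with vector fields can be tested on pure tensors. -/
theorem derD_tensor_desc {M N P : DCat k O} (ψ : und M ⊗ und N ⟶ und P)
    (θ : Derivation k O O) (h : ∀ (m : und M) (n : und N),
      ψ.hom ((derD k O θ • m) ⊗ₜ[O] n) + ψ.hom (m ⊗ₜ[O] (derD k O θ • n)) =
        derD k O θ • ψ.hom (m ⊗ₜ[O] n)) (x : und (tensorD M N)) :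
    ((tensorDIso M N).inv ≫ ψ).hom (derD k O θ • x) =
      derD k O θ • ((tensorDIso M N).inv ≫ ψ).hom x := by
  obtain ⟨y, rfl⟩ : ∃ y : (und M ⊗[O] und N), (tensorDIso M N).hom.hom y = x := ⟨x, rfl⟩
  induction y using TensorProduct.induction_on with
  | zero => simp
  | tmul m n =>
    rw [derD_tensorDIso, map_add]
    exact h m n
  | add x y hx hy => rw [map_add, smul_add, map_add, hx, hy, map_add, smul_add]

theorem res_derD {M N : DCat k O} (f : M ⟶ N) (θ : Derivation k O O) (m : und M) :
    ((resO k O).map f).hom (derD k O θ • m) = derD k O θ • ((resO k O).map f).hom m :=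
  f.hom.map_smul _ _

/-- The tensor product of morphisms. -/
def tensorDHom {M M' N N' : DCat k O} (f : M ⟶ M') (g : N ⟶ N') : tensorD M N ⟶ tensorD M' N' :=
  homOfRes ((tensorDIso M N).inv ≫ ((resO k O).map f ⊗ₘ (resO k O).map g) ≫
      (tensorDIso M' N').hom)
    (fun θ => derD_tensor_desc _ θ fun m n => by
      have := derD_tensorDIso M' N' θ (((resO k O).map f).hom m) (((resO k O).map g).hom n)
      rw [← res_derD, ← res_derD] at this
      exact this.symm)

/-- The left unit isomorphism. -/
def leftUnitorD (M : DCat k O) : tensorD (unitD k O) M ≅ M :=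
  isoOfRes ((tensorDIso (unitD k O) M).symm ≪≫ whiskerRightIso (unitDIso k O).symm (und M) ≪≫
      λ_ (und M))
    (fun θ => derD_tensor_desc _ θ fun f m => by
      obtain ⟨f, rfl⟩ : ∃ g : O, (unitDIso k O).hom.hom g = f := ⟨f, rfl⟩
      change (θ f) • m + f • derD k O θ • m = derD k O θ • (f • m)
      rw [derD_smul, add_comm])

/-- The right unit isomorphism. -/
def rightUnitorD (M : DCat k O) : tensorD M (unitD k O) ≅ M :=
  isoOfRes ((tensorDIso M (unitD k O)).symm ≪≫ whiskerLeftIso (und M) (unitDIso k O).symm ≪≫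
      ρ_ (und M))
    (fun θ => derD_tensor_desc _ θ fun m f => by
      obtain ⟨f, rfl⟩ : ∃ g : O, (unitDIso k O).hom.hom g = f := ⟨f, rfl⟩
      change f • derD k O θ • m + (θ f) • m = derD k O θ • (f • m)
      rw [derD_smul])

/-- The symmetry isomorphism. -/
def braidingD (M N : DCat k O) : tensorD M N ≅ tensorD N M :=
  isoOfRes ((tensorDIso M N).symm ≪≫ β_ (und M) (und N) ≪≫ tensorDIso N M)
    (fun θ => derD_tensor_desc _ θ fun m n => by
      rw [add_comm]
      exact (derD_tensorDIso N M θ n m).symm)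

/-- The associativity isomorphism. -/
def associatorD (M N P : DCat k O) : tensorD (tensorD M N) P ≅ tensorD M (tensorD N P) :=
  isoOfRes ((tensorDIso (tensorD M N) P).symm ≪≫ whiskerRightIso (tensorDIso M N).symm (und P) ≪≫
      α_ (und M) (und N) (und P) ≪≫ whiskerLeftIso (und M) (tensorDIso N P) ≪≫
      tensorDIso M (tensorD N P))
    (fun θ => derD_tensor_desc _ θ fun x p => by
      obtain ⟨y, rfl⟩ : ∃ y : (und M ⊗[O] und N), (tensorDIso M N).hom.hom y = x := ⟨x, rfl⟩
      generalize hφ : (whiskerRightIso (tensorDIso M N).symm (und P) ≪≫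
        α_ (und M) (und N) (und P) ≪≫ whiskerLeftIso (und M) (tensorDIso N P) ≪≫
        tensorDIso M (tensorD N P)).hom = φ
      induction y using TensorProduct.induction_on with
      | zero => simp
      | tmul m n =>
        rw [derD_tensorDIso, TensorProduct.add_tmul, map_add]
        have h1 := derD_tensorDIso M (tensorD N P) θ m ((tensorDIso N P).hom.hom (n ⊗ₜ[O] p))
        have h2 := congrArg (fun z => (tensorDIso M (tensorD N P)).hom.hom (m ⊗ₜ[O] z))
          (derD_tensorDIso N P θ n p)
        have h3 := map_add (tensorDIso M (tensorD N P)).hom.hom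
          (m ⊗ₜ[O] (tensorDIso N P).hom.hom ((derD k O θ • n) ⊗ₜ[O] p))
          (m ⊗ₜ[O] (tensorDIso N P).hom.hom (n ⊗ₜ[O] (derD k O θ • p)))
        subst hφ
        refine Eq.trans ?_ h1.symm
        refine (add_assoc _ _ _).trans (congrArg (_ + ·) ?_)
        refine Eq.trans ?_ h2.symm
        refine Eq.trans h3.symm (congrArg _ ?_)
        exact (TensorProduct.tmul_add _ _ _).symm
      | add x y hx hy =>
        simp only [map_add, smul_add, TensorProduct.add_tmul, ← hx, ← hy]
        abel)

instance : MonoidalCategoryStruct (DCat k O) where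
  tensorObj := tensorD
  whiskerLeft M _ _ g := tensorDHom (𝟙 M) g
  whiskerRight f N := tensorDHom f (𝟙 N)
  tensorHom f g := tensorDHom f g
  tensorUnit := unitD k O
  associator := associatorD
  leftUnitor := leftUnitorD
  rightUnitor := rightUnitorD

variable (k O) in
/-- The forgetful functor to `O`-modules is compatible with the tensor products. -/
def inducingD : Monoidal.InducingFunctorData (resO k O) where
  μIso := tensorDIso
  whiskerLeft_eq M _ _ g := by
    rw [← id_tensorHom, ← CategoryTheory.Functor.map_id]; rfl
  whiskerRight_eq f N := by
    rw [← tensorHom_id, ← CategoryTheory.Functor.map_id]; rfl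
  tensorHom_eq f g := rfl
  εIso := unitDIso k O
  associator_eq M N P := by
    change ((tensorDIso (tensorD M N) P).symm ≪≫ whiskerRightIso (tensorDIso M N).symm (und P) ≪≫
      α_ (und M) (und N) (und P) ≪≫ whiskerLeftIso (und M) (tensorDIso N P) ≪≫
      tensorDIso M (tensorD N P)).hom = _
    simp
    rfl
  leftUnitor_eq M := by
    change ((tensorDIso (unitD k O) M).symm ≪≫ whiskerRightIso (unitDIso k O).symm (und M) ≪≫
      λ_ (und M)).hom = _
    simp
    rfl
  rightUnitor_eq M := by
    change ((tensorDIso M (unitD k O)).symm ≪≫ whiskerLeftIso (und M) (unitDIso k O).symm ≪≫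
      ρ_ (und M)).hom = _
    simp
    rfl

instance : MonoidalCategory (DCat k O) := Monoidal.induced _ (inducingD k O)

instance : (resO k O).Monoidal := (Monoidal.fromInducedCoreMonoidal _ (inducingD k O)).toMonoidal

instance : BraidedCategory (DCat k O) :=
  .ofFaithful (resO k O) braidingD (fun M N => by
    change (tensorDIso M N).hom ≫ ((tensorDIso M N).symm ≪≫ β_ (und M) (und N) ≪≫
      tensorDIso N M).hom = (β_ (und M) (und N)).hom ≫ (tensorDIso N M).hom
    simp)

instance : (resO k O).Braided where
  braided M N := by
    change (tensorDIso M N).hom ≫ ((tensorDIso M N).symm ≪≫ β_ (und M) (und N) ≪≫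
      tensorDIso N M).hom = (β_ (und M) (und N)).hom ≫ (tensorDIso N M).hom
    simp

instance : SymmetricCategory (DCat k O) := .ofFaithful (resO k O)

theorem res_add {M N : DCat k O} (f g : M ⟶ N) :
    (resO k O).map (f + g) = (resO k O).map f + (resO k O).map g := rfl

instance : MonoidalPreadditive (DCat k O) where
  whiskerLeft_zero {M N P} := (resO k O).map_injective (by
    rw [(inducingD k O).whiskerLeft_eq]; 
    change _ ≫ (_ ◁ 0) ≫ _ = 0
    simp)
  zero_whiskerRight := (resO k O).map_injective (by
    rw [(inducingD k O).whiskerRight_eq]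
    change _ ≫ (0 ▷ _) ≫ _ = 0
    simp)
  whiskerLeft_add _ _ := (resO k O).map_injective (by
    rw [res_add]
    simp only [(inducingD k O).whiskerLeft_eq, res_add]
    simp)
  add_whiskerRight _ _ := (resO k O).map_injective (by
    rw [res_add]
    simp only [(inducingD k O).whiskerRight_eq, res_add]
    simp)

end TensorProduct

section Braiding

open GradedObject Category

universe v w

variable {C : Type w} [Category.{v} C] [Preadditive C] [MonoidalCategory C] [MonoidalPreadditive C]
  [HasFiniteCoproducts C] [HasZeroObject C] [SymmetricCategory C]

theorem zsmul_whiskerRight {X Y : C} (n : ℤ) (f : X ⟶ Y) (Z : C) : (n • f) ▷ Z = n • (f ▷ Z) :=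
  (tensorRight Z).map_zsmul

theorem whiskerLeft_zsmul {X Y : C} (n : ℤ) (f : X ⟶ Y) (Z : C) : Z ◁ (n • f) = n • (Z ◁ f) :=
  (tensorLeft Z).map_zsmul

/-- The Koszul sign. -/
def ksign (i j : ℕ) : ℤ := (-1) ^ (i * j)

theorem ksign_add (i j l : ℕ) : ksign i (j + l) = ksign i j * ksign i l := by
  simp [ksign, mul_add, pow_add]

theorem add_ksign (i j l : ℕ) : ksign (i + j) l = ksign i l * ksign j l := by
  simp [ksign, add_mul, pow_add]

theorem ksign_comm (i j : ℕ) : ksign i j = ksign j i := by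
  simp [ksign, mul_comm]

theorem ksign_sq (i j : ℕ) : ksign i j * ksign i j = 1 := by
  rw [ksign, ← mul_pow]; simp

/-- The morphism `X ⊗ Y ⟶ Y ⊗ X` of graded objects, with the Koszul sign. -/
def gbraid (X Y : GradedObject ℕ C) :
    GradedObject.Monoidal.tensorObj X Y ⟶ GradedObject.Monoidal.tensorObj Y X :=
  fun k => Monoidal.tensorObjDesc (fun i j hij => ksign i j • ((β_ (X i) (Y j)).hom ≫
    Monoidal.ιTensorObj Y X j i k (by rw [add_comm]; exact hij)))

theorem ι_gbraid (X Y : GradedObject ℕ C) (i j k : ℕ) (h : i + j = k) :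
    Monoidal.ιTensorObj X Y i j k h ≫ gbraid X Y k = ksign i j • ((β_ (X i) (Y j)).hom ≫
      Monoidal.ιTensorObj Y X j i k (by rw [add_comm]; exact h)) :=
  Monoidal.ι_tensorObjDesc _ _ _ _

theorem gbraid_gbraid (X Y : GradedObject ℕ C) : gbraid X Y ≫ gbraid Y X = 𝟙 _ := by
  funext k
  apply Monoidal.tensorObj_ext
  intro i j h
  change _ ≫ gbraid X Y k ≫ gbraid Y X k = _ ≫ 𝟙 _
  rw [← assoc, ι_gbraid, Preadditive.zsmul_comp, assoc, ι_gbraid, Preadditive.comp_zsmul,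
    SymmetricCategory.symmetry_assoc, smul_smul, ksign_comm j i, ksign_sq, one_smul, comp_id]

theorem gbraid_natural {X X' Y Y' : GradedObject ℕ C} (f : X ⟶ X') (g : Y ⟶ Y') :
    Monoidal.tensorHom f g ≫ gbraid X' Y' = gbraid X Y ≫ Monoidal.tensorHom g f := by
  funext k
  apply Monoidal.tensorObj_ext
  intro i j h
  change _ ≫ Monoidal.tensorHom f g k ≫ gbraid X' Y' k =
    _ ≫ gbraid X Y k ≫ Monoidal.tensorHom g f k
  rw [← assoc, ← assoc, ι_gbraid, Monoidal.ι_tensorHom, assoc, ι_gbraid, Preadditive.comp_zsmul,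
    Preadditive.zsmul_comp, assoc, Monoidal.ι_tensorHom,
    BraidedCategory.braiding_naturality_assoc]

theorem gbraid_hexagon (X Y Z : GradedObject ℕ C) :
    (Monoidal.associator X Y Z).hom ≫ gbraid X (Monoidal.tensorObj Y Z) ≫
      (Monoidal.associator Y Z X).hom =
    Monoidal.tensorHom (gbraid X Y) (𝟙 Z) ≫ (Monoidal.associator Y X Z).hom ≫
      Monoidal.tensorHom (𝟙 Y) (gbraid X Z) := by
  funext k
  apply Monoidal.tensorObj₃'_ext
  intro i₁ i₂ i₃ h
  change _ ≫ (Monoidal.associator X Y Z).hom k ≫ gbraid X (Monoidal.tensorObj Y Z) k ≫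
      (Monoidal.associator Y Z X).hom k =
    _ ≫ Monoidal.tensorHom (gbraid X Y) (𝟙 Z) k ≫ (Monoidal.associator Y X Z).hom k ≫
      Monoidal.tensorHom (𝟙 Y) (gbraid X Z) k
  have hl : Monoidal.ιTensorObj₃' X Y Z i₁ i₂ i₃ k h ≫ (Monoidal.associator X Y Z).hom k ≫
      gbraid X (Monoidal.tensorObj Y Z) k ≫ (Monoidal.associator Y Z X).hom k =
      ksign i₁ (i₂ + i₃) • ((α_ _ _ _).hom ≫ (β_ (X i₁) (Y i₂ ⊗ Z i₃)).hom ≫ (α_ _ _ _).hom ≫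
        Monoidal.ιTensorObj₃ Y Z X i₂ i₃ i₁ k (by omega)) := by
    rw [Monoidal.ιTensorObj₃'_associator_hom_assoc, Monoidal.ιTensorObj₃_eq X Y Z i₁ i₂ i₃ k h _ rfl,
      assoc, ← assoc (Monoidal.ιTensorObj X _ _ _ _ _), ι_gbraid, Preadditive.zsmul_comp, assoc,
      Preadditive.comp_zsmul, Preadditive.comp_zsmul,
      BraidedCategory.braiding_naturality_right_assoc,
      ← Monoidal.ιTensorObj₃'_eq_assoc Y Z X i₂ i₃ i₁ k (by omega) _ rfl,
      Monoidal.ιTensorObj₃'_associator_hom]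
  have hr : Monoidal.ιTensorObj₃' X Y Z i₁ i₂ i₃ k h ≫ Monoidal.tensorHom (gbraid X Y) (𝟙 Z) k ≫
      (Monoidal.associator Y X Z).hom k ≫ Monoidal.tensorHom (𝟙 Y) (gbraid X Z) k =
      (ksign i₁ i₂ * ksign i₁ i₃) • (((β_ (X i₁) (Y i₂)).hom ▷ Z i₃) ≫ (α_ _ _ _).hom ≫
        (Y i₂ ◁ (β_ (X i₁) (Z i₃)).hom) ≫
        Monoidal.ιTensorObj₃ Y Z X i₂ i₃ i₁ k (by omega)) := by
    have e1 : Monoidal.ιTensorObj₃' X Y Z i₁ i₂ i₃ k h ≫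
        Monoidal.tensorHom (gbraid X Y) (𝟙 Z) k = ksign i₁ i₂ • (((β_ (X i₁) (Y i₂)).hom ▷ Z i₃) ≫
          Monoidal.ιTensorObj₃' Y X Z i₂ i₁ i₃ k (by omega)) := by
      rw [Monoidal.ιTensorObj₃'_eq X Y Z i₁ i₂ i₃ k h _ rfl, assoc, Monoidal.ι_tensorHom,
        Monoidal.ιTensorObj₃'_eq Y X Z i₂ i₁ i₃ k (by omega) (i₁ + i₂) (add_comm i₂ i₁)]
      change _ ≫ (gbraid X Y (i₁ + i₂) ⊗ₘ 𝟙 (Z i₃)) ≫ _ = _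
      rw [MonoidalCategory.tensorHom_id, ← comp_whiskerRight_assoc, ι_gbraid, zsmul_whiskerRight,
        Preadditive.zsmul_comp, comp_whiskerRight, assoc]
    have e2 : Monoidal.ιTensorObj₃ Y X Z i₂ i₁ i₃ k (by omega) ≫
        Monoidal.tensorHom (𝟙 Y) (gbraid X Z) k = ksign i₁ i₃ • ((Y i₂ ◁ (β_ (X i₁) (Z i₃)).hom) ≫
          Monoidal.ιTensorObj₃ Y Z X i₂ i₃ i₁ k (by omega)) := by
      rw [Monoidal.ιTensorObj₃_eq Y X Z i₂ i₁ i₃ k (by omega) _ rfl, assoc, Monoidal.ι_tensorHom,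
        Monoidal.ιTensorObj₃_eq Y Z X i₂ i₃ i₁ k (by omega) (i₁ + i₃) (add_comm i₃ i₁)]
      change _ ≫ (𝟙 (Y i₂) ⊗ₘ gbraid X Z (i₁ + i₃)) ≫ _ = _
      rw [MonoidalCategory.id_tensorHom, ← whiskerLeft_comp_assoc, ι_gbraid, whiskerLeft_zsmul,
        Preadditive.zsmul_comp, whiskerLeft_comp, assoc]
    rw [reassoc_of% e1, Preadditive.zsmul_comp, assoc, Monoidal.ιTensorObj₃'_associator_hom_assoc,
      e2, Preadditive.comp_zsmul, Preadditive.comp_zsmul, smul_smul]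
  rw [hl, hr, ksign_add, BraidedCategory.braiding_tensor_right_hom]
  simp

end Braiding

section ComplexBraiding

open Category HomologicalComplex

universe v w

variable {C : Type w} [Category.{v} C] [Preadditive C] [MonoidalCategory C] [MonoidalPreadditive C]
  [HasFiniteCoproducts C] [HasZeroObject C] [SymmetricCategory C]

/-- The inclusion of a summand of the tensor product of chain complexes. -/
def cι (K L : ChainComplex C ℕ) (p q i : ℕ) (h : p + q = i) :
    K.X p ⊗ L.X q ⟶ (K ⊗ L : ChainComplex C ℕ).X i :=
  HomologicalComplex.ιTensorObj K L p q i h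

theorem cι_ext {K L : ChainComplex C ℕ} {i : ℕ} {Y : C}
    {f g : (K ⊗ L : ChainComplex C ℕ).X i ⟶ Y}
    (H : ∀ p q h, cι K L p q i h ≫ f = cι K L p q i h ≫ g) : f = g :=
  HomologicalComplex.mapBifunctor.hom_ext (K₁ := K) (K₂ := L) (F := curriedTensor C) H

/-- The component of the differential of a tensor product that comes from the first factor. -/
def cd₁ (K L : ChainComplex C ℕ) (p q j : ℕ) :
    K.X p ⊗ L.X q ⟶ (K ⊗ L : ChainComplex C ℕ).X j :=
  mapBifunctor.d₁ K L (curriedTensor C) (ComplexShape.down ℕ) p q j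

/-- The component of the differential of a tensor product that comes from the second factor. -/
def cd₂ (K L : ChainComplex C ℕ) (p q j : ℕ) :
    K.X p ⊗ L.X q ⟶ (K ⊗ L : ChainComplex C ℕ).X j :=
  mapBifunctor.d₂ K L (curriedTensor C) (ComplexShape.down ℕ) p q j

theorem cι_d (K L : ChainComplex C ℕ) (p q i j : ℕ) (h : p + q = i) :
    cι K L p q i h ≫ (K ⊗ L : ChainComplex C ℕ).d i j = cd₁ K L p q j + cd₂ K L p q j := by
  change ιMapBifunctor K L (curriedTensor C) (ComplexShape.down ℕ) p q i h ≫
    (mapBifunctor K L (curriedTensor C) (ComplexShape.down ℕ)).d i j = _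
  rw [mapBifunctor.d_eq, Preadditive.comp_add, mapBifunctor.ι_D₁, mapBifunctor.ι_D₂]
  rfl

theorem cd₁_zero (K L : ChainComplex C ℕ) (q j : ℕ) : cd₁ K L 0 q j = 0 :=
  mapBifunctor.d₁_eq_zero _ _ _ _ _ _ _ (by simp)

theorem cd₂_zero (K L : ChainComplex C ℕ) (p j : ℕ) : cd₂ K L p 0 j = 0 :=
  mapBifunctor.d₂_eq_zero _ _ _ _ _ _ _ (by simp)

theorem cd₁_succ (K L : ChainComplex C ℕ) (p q j : ℕ) (h : p + q = j) :
    cd₁ K L (p + 1) q j = (K.d (p + 1) p ▷ L.X q) ≫ cι K L p q j h := by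
  refine (mapBifunctor.d₁_eq K L (curriedTensor C) (ComplexShape.down ℕ)
    (i₁ := p + 1) (i₁' := p) rfl q j h).trans ?_
  exact one_smul _ _

theorem cd₂_succ (K L : ChainComplex C ℕ) (p q j : ℕ) (h : p + q = j) :
    cd₂ K L p (q + 1) j = (-1 : ℤ) ^ p • ((K.X p ◁ L.d (q + 1) q) ≫ cι K L p q j h) := by
  refine (mapBifunctor.d₂_eq K L (curriedTensor C) (ComplexShape.down ℕ) p
    (i₂ := q + 1) (i₂' := q) rfl j h).trans ?_
  change ((-1 : ℤˣ) ^ p) • _ = _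
  rw [Units.smul_def]
  simp
  rfl

/-- The components of the braiding of chain complexes. -/
def cbraidX (K L : ChainComplex C ℕ) (i : ℕ) :
    (K ⊗ L : ChainComplex C ℕ).X i ⟶ (L ⊗ K : ChainComplex C ℕ).X i :=
  gbraid K.X L.X i

theorem cι_braidX (K L : ChainComplex C ℕ) (p q i : ℕ) (h : p + q = i) :
    cι K L p q i h ≫ cbraidX K L i =
      ksign p q • ((β_ (K.X p) (L.X q)).hom ≫ cι L K q p i (by omega)) :=
  ι_gbraid K.X L.X p q i h

theorem cd₁_braidX (K L : ChainComplex C ℕ) (p q j : ℕ) (h : p + q = j + 1) :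
    cd₁ K L p q j ≫ cbraidX K L j = ksign p q • ((β_ (K.X p) (L.X q)).hom ≫ cd₂ L K q p j) := by
  obtain _ | p := p
  · rw [cd₁_zero, cd₂_zero, zero_comp, comp_zero, smul_zero]
  · rw [cd₁_succ K L p q j (by omega), cd₂_succ L K q p j (by omega), assoc, cι_braidX,
      Preadditive.comp_zsmul, Preadditive.comp_zsmul, smul_smul,
      BraidedCategory.braiding_naturality_left_assoc]
    congr 1
    rw [add_ksign, ksign_comm 1 q, mul_assoc]
    simp [ksign, ← mul_pow]

theorem cd₂_braidX (K L : ChainComplex C ℕ) (p q j : ℕ) (h : p + q = j + 1) :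
    cd₂ K L p q j ≫ cbraidX K L j = ksign p q • ((β_ (K.X p) (L.X q)).hom ≫ cd₁ L K q p j) := by
  obtain _ | q := q
  · rw [cd₁_zero, cd₂_zero, zero_comp, comp_zero, smul_zero]
  · rw [cd₂_succ K L p q j (by omega), cd₁_succ L K q p j (by omega), Preadditive.zsmul_comp,
      assoc, cι_braidX, Preadditive.comp_zsmul, smul_smul,
      BraidedCategory.braiding_naturality_right_assoc]
    congr 1
    rw [ksign_add, mul_comm]
    simp [ksign]

theorem cbraidX_comm (K L : ChainComplex C ℕ) (i j : ℕ) (hij : j + 1 = i) :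
    cbraidX K L i ≫ (L ⊗ K : ChainComplex C ℕ).d i j =
      (K ⊗ L : ChainComplex C ℕ).d i j ≫ cbraidX K L j := by
  apply cι_ext
  intro p q h
  rw [← assoc, ← assoc, cι_braidX, cι_d, Preadditive.zsmul_comp, assoc, cι_d,
    Preadditive.add_comp, cd₁_braidX K L p q j (by omega), cd₂_braidX K L p q j (by omega),
    Preadditive.comp_add, smul_add, add_comm]

/-- The morphism `K ⊗ L ⟶ L ⊗ K` given by `x ⊗ y ↦ (-1) ^ (|x||y|) y ⊗ x`. -/
def cbraid (K L : ChainComplex C ℕ) : K ⊗ L ⟶ L ⊗ K where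
  f i := cbraidX K L i
  comm' i j hij := cbraidX_comm K L i j hij

theorem cbraid_cbraid (K L : ChainComplex C ℕ) : cbraid K L ≫ cbraid L K = 𝟙 _ :=
  (HomologicalComplex.forget C (ComplexShape.down ℕ)).map_injective (gbraid_gbraid K.X L.X)

/-- The symmetry of the tensor product of chain complexes. -/
def cbraidIso (K L : ChainComplex C ℕ) : K ⊗ L ≅ L ⊗ K where
  hom := cbraid K L
  inv := cbraid L K
  hom_inv_id := cbraid_cbraid K L
  inv_hom_id := cbraid_cbraid L K

theorem cbraid_natural {K K' L L' : ChainComplex C ℕ} (f : K ⟶ K') (g : L ⟶ L') :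
    (f ⊗ₘ g) ≫ cbraid K' L' = cbraid K L ≫ (g ⊗ₘ f) :=
  (HomologicalComplex.forget C (ComplexShape.down ℕ)).map_injective
    (gbraid_natural (X := K.X) (X' := K'.X) (Y := L.X) (Y' := L'.X) f.f g.f)

theorem cbraid_hexagon (K L M : ChainComplex C ℕ) :
    (α_ K L M).hom ≫ cbraid K (L ⊗ M) ≫ (α_ L M K).hom =
      (cbraid K L ▷ M) ≫ (α_ L K M).hom ≫ (L ◁ cbraid K M) :=
  (HomologicalComplex.forget C (ComplexShape.down ℕ)).map_injective
    (gbraid_hexagon K.X L.X M.X)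

instance chainBraided : BraidedCategory (ChainComplex C ℕ) where
  braiding K L := cbraidIso K L
  braiding_naturality_right K L L' g := by
    rw [← id_tensorHom, ← tensorHom_id]; exact cbraid_natural (𝟙 K) g
  braiding_naturality_left f L := by
    rw [← id_tensorHom, ← tensorHom_id]; exact cbraid_natural f (𝟙 L)
  hexagon_forward K L M := cbraid_hexagon K L M
  hexagon_reverse K L M := by
    change (α_ K L M).inv ≫ cbraid (K ⊗ L) M ≫ (α_ M K L).inv =
      (K ◁ cbraid L M) ≫ (α_ K M L).inv ≫ (cbraid K M ▷ L)
    have h := cbraid_hexagon M K L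
    have e : (cbraid (K ⊗ L) M ≫ (α_ M K L).inv) ≫
        ((α_ M K L).hom ≫ cbraid M (K ⊗ L) ≫ (α_ K L M).hom) = (α_ K L M).hom := by
      rw [assoc, Iso.inv_hom_id_assoc, ← assoc, cbraid_cbraid, id_comp]
    have e' : ((K ◁ cbraid L M) ≫ (α_ K M L).inv ≫ (cbraid K M ▷ L)) ≫
        ((cbraid M K ▷ L) ≫ (α_ K M L).hom ≫ (K ◁ cbraid M L)) = 𝟙 _ := by
      simp only [assoc]
      rw [← comp_whiskerRight_assoc, cbraid_cbraid, id_whiskerRight, id_comp,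
        Iso.inv_hom_id_assoc, ← whiskerLeft_comp, cbraid_cbraid, whiskerLeft_id]
    rw [h] at e
    have e2 : IsIso ((cbraid M K ▷ L) ≫ (α_ K M L).hom ≫ (K ◁ cbraid M L)) := by
      have a (X Y : ChainComplex C ℕ) : IsIso (cbraid X Y) := (cbraidIso X Y).isIso_hom
      infer_instance
    rw [← cancel_mono ((cbraid M K ▷ L) ≫ (α_ K M L).hom ≫ (K ◁ cbraid M L)), e', assoc, e,
      Iso.inv_hom_id]

instance chainSymmetric : SymmetricCategory (ChainComplex C ℕ) where
  symmetry K L := cbraid_cbraid K L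

end ComplexBraiding

section FreeModule

open Category MonObj

universe v w

variable {C : Type w} [Category.{v} C] [MonoidalCategory C] (A : C) [MonObj A]

variable {A} in
/-- The action map of a module. -/
def act (M : Mod C A) : A ⊗ M.X ⟶ M.X := γ[A, M.X]

variable {A} in
theorem act_one (M : Mod C A) : (η[A] ▷ M.X) ≫ act M = (λ_ M.X).hom :=
  ModObj.one_smul (M := A) M.X

variable {A} in
theorem act_mul (M : Mod C A) :
    (μ[A] ▷ M.X) ≫ act M = (α_ A A M.X).hom ≫ (A ◁ act M) ≫ act M :=
  ModObj.mul_smul (M := A) M.X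

/-- The action of `A` on `A ⊗ X` through the left factor. -/
abbrev freeModObj (X : C) : ModObj A (A ⊗ X : C) where
  smul := (α_ A A X).inv ≫ (μ[A] ▷ X)
  one_smul := by
    change (η[A] ▷ (A ⊗ X)) ≫ (α_ A A X).inv ≫ (μ[A] ▷ X) = (λ_ (A ⊗ X)).hom
    rw [associator_inv_naturality_left_assoc, ← comp_whiskerRight, MonObj.one_mul]
    simp
  mul_smul := by
    change (μ[A] ▷ (A ⊗ X)) ≫ (α_ A A X).inv ≫ (μ[A] ▷ X) =
      (α_ A A (A ⊗ X)).hom ≫ (A ◁ ((α_ A A X).inv ≫ (μ[A] ▷ X))) ≫ (α_ A A X).inv ≫ (μ[A] ▷ X)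
    rw [associator_inv_naturality_left_assoc, ← comp_whiskerRight, MonObj.mul_assoc]
    simp

/-- The free `A`-module `A ⊗ X`. -/
abbrev freeMod (X : C) : Mod C A :=
  letI := freeModObj A X
  ⟨A ⊗ X⟩

/-- The free `A`-module functor `A ⊗ -`. -/
def freeFunctor : C ⥤ Mod C A where
  obj X := freeMod A X
  map {X Y} f := Mod.Hom.mk' (M := freeMod A X) (N := freeMod A Y) (A ◁ f) (by
    change ((α_ A A X).inv ≫ (μ[A] ▷ X)) ≫ (A ◁ f) = (A ◁ (A ◁ f)) ≫ (α_ A A Y).inv ≫ (μ[A] ▷ Y)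
    rw [assoc, ← whisker_exchange]
    simp)
  map_id X := by
    apply Mod.hom_ext
    exact whiskerLeft_id A X
  map_comp f g := by
    apply Mod.hom_ext
    exact whiskerLeft_comp A f g

theorem freeHom_aux (X : C) (M : Mod C A) (g : X ⟶ M.X) :
    ((α_ A A X).inv ≫ (μ[A] ▷ X)) ≫ (A ◁ g) ≫ act M = (A ◁ ((A ◁ g) ≫ act M)) ≫ act M := by
  rw [assoc, ← whisker_exchange_assoc, act_mul]
  simp

theorem freeHom_left (X : C) (M : Mod C A) (f : A ⊗ X ⟶ M.X)
    (h : ((α_ A A X).inv ≫ (μ[A] ▷ X)) ≫ f = (A ◁ f) ≫ act M) :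
    (A ◁ ((λ_ X).inv ≫ (η[A] ▷ X) ≫ f)) ≫ act M = f := by
  rw [whiskerLeft_comp, whiskerLeft_comp, assoc, assoc, ← h, assoc,
    associator_inv_naturality_middle_assoc, ← comp_whiskerRight_assoc, MonObj.mul_one]
  simp

theorem freeHom_right (X : C) (M : Mod C A) (g : X ⟶ M.X) :
    (λ_ X).inv ≫ (η[A] ▷ X) ≫ (A ◁ g) ≫ act M = g := by
  rw [← whisker_exchange_assoc, act_one]
  simp

theorem freeHom_comp {X' X : C} (M : Mod C A) (f : X' ⟶ X) (g : X ⟶ M.X) :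
    (A ◁ (f ≫ g)) ≫ act M = (A ◁ f) ≫ (A ◁ g) ≫ act M := by
  rw [whiskerLeft_comp, assoc]

theorem freeHom_assoc (X : C) {M N : C} (f : A ⊗ X ⟶ M) (g : M ⟶ N) :
    (λ_ X).inv ≫ (η[A] ▷ X) ≫ f ≫ g = ((λ_ X).inv ≫ (η[A] ▷ X) ≫ f) ≫ g := by
  rw [assoc, assoc]

/-- The free `A`-module functor is left adjoint to the forgetful functor: a morphism
`g : X ⟶ M` corresponds to `a ⊗ x ↦ a g(x)`. -/
def freeAdj : freeFunctor A ⊣ Mod.forget (D := C) A :=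
  Adjunction.mkOfHomEquiv
    { homEquiv := fun X M =>
        { toFun := fun f => (λ_ X).inv ≫ (η[A] ▷ X) ≫ f.hom
          invFun := fun g => Mod.Hom.mk' (M := freeMod A X) (N := M)
            (MonoidalCategoryStruct.whiskerLeft A (Y₂ := M.X) g ≫ act M) (freeHom_aux A X M g)
          left_inv := fun f => Mod.hom_ext _ _
            (freeHom_left A X M f.hom (Mod.Hom.isModHom f).smul_hom)
          right_inv := fun g => freeHom_right A X M g }
      homEquiv_naturality_left_symm := fun {_ _ M} f g => Mod.hom_ext _ _ (freeHom_comp A M f g)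
      homEquiv_naturality_right := fun {X _ _} f g =>
        freeHom_assoc A X f.hom g.hom }

end FreeModule

section RelativeTensor

open Category MonObj

universe v w

variable {C : Type w} [Category.{v} C] [MonoidalCategory C] [BraidedCategory C] {A : C} [MonObj A]

/-- `(m ⊗ a) ⊗ n ↦ (± a m) ⊗ n`. -/
def actLeft (M N : Mod C A) : (M.X ⊗ A) ⊗ N.X ⟶ M.X ⊗ N.X :=
  ((β_ M.X A).hom ≫ act M) ▷ N.X

/-- `(m ⊗ a) ⊗ n ↦ m ⊗ (a n)`. -/
def actRight (M N : Mod C A) : (M.X ⊗ A) ⊗ N.X ⟶ M.X ⊗ N.X :=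
  (α_ M.X A N.X).hom ≫ (M.X ◁ act N)

variable (A)

/-- A symmetric monoidal structure on `Mod C A`, together with a lax symmetric monoidal structure
on the forgetful functor, is the tensor product over `A` when `M ⊗ N ⟶ M ⊗_A N` is the coequalizer
of the two actions of `A`, the action of `A` on `M ⊗_A N` is induced by that on `M`, and the unit
is `A` with its unit map. (The associator, the unitors and the braiding are then those induced
from `C`, by the coherence of the lax symmetric monoidal structure.) -/
structure IsRelativeTensor [MonoidalCategory (Mod C A)] [SymmetricCategory (Mod C A)]
    [(Mod.forget (D := C) A).LaxBraided] : Prop where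
  condition (M N : Mod C A) :
    actLeft M N ≫ Functor.LaxMonoidal.μ (Mod.forget (D := C) A) M N =
      actRight M N ≫ Functor.LaxMonoidal.μ (Mod.forget (D := C) A) M N
  isCoequalizer (M N : Mod C A) : Nonempty (IsColimit (Cofork.ofπ _ (condition M N)))
  smul_tensor (M N : Mod C A) :
    (A ◁ Functor.LaxMonoidal.μ (Mod.forget (D := C) A) M N) ≫ act (M ⊗ N) =
      (α_ A M.X N.X).inv ≫ (act M ▷ N.X) ≫
        Functor.LaxMonoidal.μ (Mod.forget (D := C) A) M N
  unit : ∃ e : Mod.regular A ≅ 𝟙_ (Mod C A),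
    Functor.LaxMonoidal.ε (Mod.forget (D := C) A) = η[A] ≫ e.hom.hom

end RelativeTensor

section ModelCategories

open Opposite

universe v w

variable (C : Type w) [Category.{v} C]

variable {C} in
/-- Relative `W`-cell complexes: transfinite compositions of pushouts of morphisms in `W`. -/
def cell (W : MorphismProperty C) : MorphismProperty C :=
  MorphismProperty.transfiniteCompositions.{v} W.pushouts

variable {C} in
/-- `X` is small relative to `W`: for some regular cardinal `κ`, the functor `Hom(X, -)` commutes
with the colimits of all `κ`-filtered well-ordered continuous sequences whose successor maps
belong to `W`. -/
def IsSmallRel (W : MorphismProperty C) (X : C) : Prop :=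
  ∃ (κ : Cardinal.{v}) (_ : Fact κ.IsRegular),
    ∀ (J : Type v) [LinearOrder J] [SuccOrder J] [OrderBot J] [WellFoundedLT J] [NoMaxOrder J]
      [IsCardinalFiltered J κ] (F : J ⥤ C) [F.IsWellOrderContinuous],
      (∀ j : J, W (F.map (homOfLE (Order.le_succ j)))) →
        PreservesColimit F (coyoneda.obj (op X))

variable {C} in
/-- The domains of the morphisms in `I` are small relative to the relative `I`-cell complexes. -/
def PermitsSmallObjectArgument (I : MorphismProperty C) : Prop :=
  ∀ ⦃X Y : C⦄ (i : X ⟶ Y), I i → IsSmallRel (cell I) X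

/-- The category has all small limits and colimits, and both factorizations can be chosen
functorially. -/
structure IsCompleteFunctorialModel [ModelCategory C] : Prop where
  hasLimits : HasLimits C
  hasColimits : HasColimits C
  cof_trivFib :
    MorphismProperty.HasFunctorialFactorization (cofibrations C) (trivialFibrations C)
  trivCof_fib :
    MorphismProperty.HasFunctorialFactorization (trivialCofibrations C) (fibrations C)

/-- `C` is cofibrantly generated with generating cofibrations `I` and generating trivial
cofibrations `J`. -/
structure IsCofibrantlyGeneratedBy [ModelCategory C] (I J : MorphismProperty C) : Prop where
  small_cof : PermitsSmallObjectArgument I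
  small_trivCof : PermitsSmallObjectArgument J
  fibrations_eq : fibrations C = J.rlp
  trivialFibrations_eq : trivialFibrations C = I.rlp

/-- The compatibility of a model structure with a symmetric monoidal structure: the pushout-product
axiom and the unit axiom. -/
structure IsMonoidalModel [ModelCategory C] [MonoidalCategory C] : Prop where
  pushoutProduct {X Y X' Y' : C} (f : X ⟶ Y) (g : X' ⟶ Y') [Cofibration f] [Cofibration g]
    (sq : (curriedTensor C).PushoutObjObj f g) : Cofibration sq.ι
  pushoutProduct_trivial {X Y X' Y' : C} (f : X ⟶ Y) (g : X' ⟶ Y') [Cofibration f]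
    [Cofibration g] (sq : (curriedTensor C).PushoutObjObj f g) :
    WeakEquivalence f ∨ WeakEquivalence g → WeakEquivalence sq.ι
  unit {Q : C} (q : Q ⟶ 𝟙_ C) [IsCofibrant Q] [Fibration q] [WeakEquivalence q] (Z : C)
    [IsCofibrant Z] : WeakEquivalence (q ▷ Z)

/-- The monoid axiom: all relative cell complexes on the morphisms `φ ⊗ Z`, with `φ` a trivial
cofibration and `Z` an object, are weak equivalences. -/
def MonoidAxiom [ModelCategory C] [MonoidalCategory C] : Prop :=
  cell (⨆ Z : C, (trivialCofibrations C).map (tensorRight Z)) ≤ weakEquivalences C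

end ModelCategories

section DGDM

open ZeroObject

variable (k O : Type u) [Field k] [CommRing O] [Algebra k O]

/-- Non-negatively graded chain complexes of left modules over the ring of differential
operators. -/
abbrev DGDM := ChainComplex (DCat k O) ℕ

variable {k O} in
/-- Quasi-isomorphisms. -/
def weqD : MorphismProperty (DGDM k O) :=
  HomologicalComplex.quasiIso (DCat k O) (ComplexShape.down ℕ)

variable {k O} in
/-- Chain maps that are surjective in all positive degrees. -/
def fibD : MorphismProperty (DGDM k O) :=
  fun _ _ f => ∀ n : ℕ, 0 < n → Function.Surjective (f.f n)

/-- The ring of differential operators as a left module over itself. -/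
abbrev regD : DCat k O := ModuleCat.of (DRing k O) (DRing k O)

/-- The `n`-sphere: the ring of differential operators in degree `n`. -/
def sphere (n : ℕ) : DGDM k O := (HomologicalComplex.single _ _ n).obj (regD k O)

/-- The `(n + 1)`-disc: the identity of the ring of differential operators, in degrees `n + 1`
and `n`. -/
def disc (n : ℕ) : DGDM k O :=
  HomologicalComplex.double (𝟙 (regD k O))
    (show (ComplexShape.down ℕ).Rel (n + 1) n from rfl)

/-- The inclusion of the `n`-sphere in the `(n + 1)`-disc. -/
def sphereToDisc (n : ℕ) : sphere k O n ⟶ disc k O n :=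
  HomologicalComplex.mkHomFromSingle
    (HomologicalComplex.doubleXIso₁ (𝟙 (regD k O))
      (show (ComplexShape.down ℕ).Rel (n + 1) n from rfl) (by simp)).inv (by
    intro j _
    exact (congrArg (_ ≫ ·) (HomologicalComplex.double_d_eq_zero₀ _ _ _ _ (by simp))).trans
      comp_zero)

/-- The generating cofibrations: `0 ⟶ S⁰`, and `Sⁿ ⟶ Dⁿ⁺¹` for `n ≥ 0`. -/
inductive genCof : MorphismProperty (DGDM k O)
  | zero : genCof (0 : (0 : DGDM k O) ⟶ sphere k O 0)
  | succ (n : ℕ) : genCof (sphereToDisc k O n)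

/-- The generating trivial cofibrations: `0 ⟶ Dⁿ` for `n ≥ 1`. -/
inductive genTrivCof : MorphismProperty (DGDM k O)
  | mk (n : ℕ) : genTrivCof (0 : (0 : DGDM k O) ⟶ disc k O n)

variable [CharZero k] [Algebra.Smooth k O]

instance : MonoidalCategory (DGDM k O) :=
  HomologicalComplex.monoidalCategory (DCat k O) (ComplexShape.down ℕ)

instance : SymmetricCategory (DGDM k O) := chainSymmetric (C := DCat k O)

/-- Differential graded algebras over the ring of differential operators: commutative monoids in
`DGDM k O`. -/
abbrev DGDA := CommMon (DGDM k O)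

variable {k O}

/-- The category of modules over `A` in `DGDM k O`. -/
abbrev ModA (A : DGDA k O) := Mod (DGDM k O) A.X

end DGDM

end DMod

end

open DMod

/-! The model structure is transferred along `freeAdj`. Limits and colimits of modules are created
in `DGDM`, the latter because `A ⊗ -` preserves colimits. Free modules on zero and on spheres are
finitely presentable, so the small object argument applies to `Σ(I)` and `Σ(J)`. The point to prove
is that maps generated by `Σ(J)` are weak equivalences. Injective quasi-isomorphisms of complexes
(`acyclicMono`) are closed under retracts, pushouts, coproducts and transfinite compositions, and
contain `0 ⟶ A ⊗ Dⁿ` because discs are contractible; `llp_rlp_le_inverseImage` propagates this to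
everything generated. Since `Σ(X) ⊗_A Z` is `X ⊗ Z` (`isIso_freeTensor`), the same argument for the
colimit preserving functor `- ⊗_A Z` yields the monoid axiom and the trivial half of the
pushout-product axiom.

The tensor product over `A` is a coequalizer whose projection stays epi after tensoring, so each
coherence law is checked before passing to the quotient. Internal homs come from the special adjoint
functor theorem. An algebra over the free module monad is literally an `A`-module.

For the pushout-product of cofibrations, the two-variable adjunction reduces to generators, and
freeness reduces to `DGDM`. There, two generators attach single cells `D` in degrees `a` and `b`,
and their pushout-product attaches the single cell `D ⊗_O D` in degree `a + b`. Such a map lifts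
against trivial fibrations once its cell is projective (`hasLiftingProperty_of_cell`). Now `D ⊗_O M`
is induced from `M`: its `D`-linear maps to `N` are the `O`-linear maps `M ⟶ N`. So it suffices that
`D` is projective over `O`. This follows from Euler's formula: for `P` of order at most `n`, `∑ [P,
x] t_x` equals `n P` up to lower order, and `n` is invertible when positive, so `O`-linear lifts
extend order by order (`exists_lift_extension`).

For the unit axiom, map `Q` by a cofibration `j` to an acyclic `C` and push out along `q : Q ⟶ A`;
the pushout `P` is acyclic because `j` is injective. Tensoring with a cofibrant `Z` keeps `C` and
`P` acyclic, by flatness of `D` over `O`, and keeps `j` injective. The tensored pushout square then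
forces `q ⊗ Z` to be a quasi-isomorphism. -/

noncomputable section

namespace DMod.ModuleModel

/-! ### Operations of an object on the factors of a tensor product -/

section Linear

open Category MonObj

universe v w

variable {C : Type w} [Category.{v} C] [MonoidalCategory C] [SymmetricCategory C] {A : C}

/-- `f` commutes with the operations `a` and `b` of `A`. -/
def Lin {X Y : C} (a : A ⊗ X ⟶ X) (b : A ⊗ Y ⟶ Y) (f : X ⟶ Y) : Prop := a ≫ f = (A ◁ f) ≫ b

theorem Lin.id {X : C} (a : A ⊗ X ⟶ X) : Lin a a (𝟙 X) := by simp [Lin]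

theorem Lin.comp {X Y Z : C} {a : A ⊗ X ⟶ X} {b : A ⊗ Y ⟶ Y} {c : A ⊗ Z ⟶ Z} {f : X ⟶ Y}
    {g : Y ⟶ Z} (hf : Lin a b f) (hg : Lin b c g) : Lin a c (f ≫ g) := by
  unfold Lin at *
  rw [reassoc_of% hf, hg, whiskerLeft_comp, assoc]

/-- Linearity descends along a quotient map that stays epi after tensoring with `A`. No module axiom
is involved, so this applies to bare operations, in particular to those on tensor products before
any quotient is taken. -/
theorem Lin.of_epi {X Y Z : C} {a : A ⊗ X ⟶ X} {b : A ⊗ Y ⟶ Y} {c : A ⊗ Z ⟶ Z} {f : X ⟶ Y}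
    [Epi (A ◁ f)] {g : Y ⟶ Z} (hf : Lin a b f) (hg : Lin a c (f ≫ g)) : Lin b c g := by
  unfold Lin at *
  rw [← cancel_epi (A ◁ f), ← reassoc_of% hf, hg, whiskerLeft_comp, assoc]

theorem Lin.of_iso {X Y Z : C} {a : A ⊗ X ⟶ X} {b : A ⊗ Y ⟶ Y} {c : A ⊗ Z ⟶ Z} (e : X ≅ Y)
    {g : Y ⟶ Z} (he : Lin a b e.hom) (hg : Lin a c (e.hom ≫ g)) : Lin b c g :=
  he.of_epi hg

theorem Lin.inv {X Y : C} {a : A ⊗ X ⟶ X} {b : A ⊗ Y ⟶ Y} (e : X ≅ Y) (he : Lin a b e.hom) :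
    Lin b a e.inv :=
  he.of_iso e (by rw [e.hom_inv_id]; exact Lin.id a)

/-- The operation of `A` on the left factor of a tensor product. -/
def lft {X : C} (a : A ⊗ X ⟶ X) (Y : C) : A ⊗ (X ⊗ Y) ⟶ X ⊗ Y := (α_ A X Y).inv ≫ (a ▷ Y)

/-- The operation of `A` on the right factor of a tensor product. -/
def rgt (X : C) {Y : C} (b : A ⊗ Y ⟶ Y) : A ⊗ (X ⊗ Y) ⟶ X ⊗ Y :=
  (α_ A X Y).inv ≫ ((β_ A X).hom ▷ Y) ≫ (α_ X A Y).hom ≫ (X ◁ b)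

theorem Lin.lft_whiskerRight {X X' : C} {a : A ⊗ X ⟶ X} {a' : A ⊗ X' ⟶ X'} {f : X ⟶ X'}
    (hf : Lin a a' f) (Y : C) : Lin (lft a Y) (lft a' Y) (f ▷ Y) := by
  unfold Lin lft at *
  rw [assoc, ← comp_whiskerRight, hf]
  simp

theorem lft_whiskerLeft {X Y Y' : C} (a : A ⊗ X ⟶ X) (f : Y ⟶ Y') :
    Lin (lft a Y) (lft a Y') (X ◁ f) := by
  unfold Lin lft
  rw [assoc, ← whisker_exchange]
  simp

theorem Lin.rgt_whiskerLeft {Y Y' : C} {b : A ⊗ Y ⟶ Y} {b' : A ⊗ Y' ⟶ Y'} {f : Y ⟶ Y'}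
    (hf : Lin b b' f) (X : C) : Lin (rgt X b) (rgt X b') (X ◁ f) := by
  unfold Lin rgt at *
  simp only [assoc]
  rw [← whiskerLeft_comp, hf, associator_inv_naturality_right_assoc, whisker_exchange_assoc]
  simp

theorem rgt_whiskerRight {X X' Y : C} (b : A ⊗ Y ⟶ Y) (f : X ⟶ X') :
    Lin (rgt X b) (rgt X' b) (f ▷ Y) := by
  unfold Lin rgt
  simp only [assoc]
  rw [whisker_exchange, associator_inv_naturality_middle_assoc, ← comp_whiskerRight_assoc,
    BraidedCategory.braiding_naturality_right]
  simp

/-- `A` can operate on any of the three factors of a triple tensor product. This lemma and the two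
that follow treat the three cases; together they allow the associator of `C` to descend to the
tensor product over `A`. -/
theorem lft_lft_assoc {X : C} (a : A ⊗ X ⟶ X) (Y Z : C) :
    Lin (lft (lft a Y) Z) (lft a (Y ⊗ Z)) (α_ X Y Z).hom := by
  unfold Lin lft
  simp

theorem lft_rgt_assoc (X : C) {Y : C} (b : A ⊗ Y ⟶ Y) (Z : C) :
    Lin (lft (rgt X b) Z) (rgt X (lft b Z)) (α_ X Y Z).hom := by
  unfold Lin lft rgt
  simp

theorem rgt_rgt_assoc (X Y : C) {Z : C} (c : A ⊗ Z ⟶ Z) :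
    Lin (rgt (X ⊗ Y) c) (rgt X (rgt Y c)) (α_ X Y Z).hom := by
  unfold Lin rgt
  rw [BraidedCategory.braiding_tensor_right_hom]
  simp

theorem lft_braiding {X : C} (a : A ⊗ X ⟶ X) (Y : C) :
    Lin (lft a Y) (rgt Y a) (β_ X Y).hom := by
  unfold Lin lft rgt
  rw [assoc, BraidedCategory.braiding_naturality_left, BraidedCategory.braiding_tensor_left_hom]
  simp only [assoc, Iso.inv_hom_id_assoc, ← BraidedCategory.braiding_tensor_left_hom_assoc]
  rw [← cancel_epi (α_ A X Y).hom]
  simp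

theorem rgt_braiding (X : C) {Y : C} (b : A ⊗ Y ⟶ Y) :
    Lin (rgt X b) (lft b X) (β_ X Y).hom := by
  have h := (lft_braiding b X).inv (β_ Y X)
  -- The symmetry is its own inverse, so the case of the right factor is the inverse of the case of
  -- the left factor.
  rwa [show (β_ Y X).inv = (β_ X Y).hom by
    rw [← cancel_mono (β_ Y X).hom]; simp] at h

end Linear

/-! ### The tensor product over a commutative monoid and its universal property -/

section RelTensor

open Category MonObj

universe v w

variable {C : Type w} [Category.{v} C] [MonoidalCategory C] [SymmetricCategory C] {A : C} [MonObj A]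

theorem lin_hom {M N : Mod C A} (f : M ⟶ N) : Lin (act M) (act N) f.hom :=
  f.isModHom.smul_hom

/-- Morphisms of modules from linear morphisms. -/
def homOfLin {M N : Mod C A} (f : M.X ⟶ N.X) (h : Lin (act M) (act N) f) : M ⟶ N :=
  Mod.Hom.mk' f h

/-- Isomorphisms of modules from linear isomorphisms. -/
def isoOfLin {M N : Mod C A} (e : M.X ≅ N.X) (h : Lin (act M) (act N) e.hom) : M ≅ N where
  hom := homOfLin e.hom h
  inv := homOfLin e.inv (h.inv e)
  hom_inv_id := Mod.hom_ext _ _ e.hom_inv_id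
  inv_hom_id := Mod.hom_ext _ _ e.inv_hom_id

variable [HasFiniteColimits C] [∀ X : C, PreservesFiniteColimits (tensorLeft X)]

instance preservesFiniteColimits_tensorRight (X : C) : PreservesFiniteColimits (tensorRight X) :=
  preservesFiniteColimits_of_natIso (BraidedCategory.tensorLeftIsoTensorRight X)

instance epi_whiskerLeft (X : C) {Y Z : C} (f : Y ⟶ Z) [Epi f] : Epi (X ◁ f) :=
  inferInstanceAs (Epi ((tensorLeft X).map f))

instance epi_whiskerRight (X : C) {Y Z : C} (f : Y ⟶ Z) [Epi f] : Epi (f ▷ X) :=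
  inferInstanceAs (Epi ((tensorRight X).map f))

/-- The object underlying the tensor product over `A`. -/
def relX (M N : Mod C A) : C := coequalizer (lft (act M) N.X) (rgt M.X (act N))

/-- The projection to the tensor product over `A`. -/
def relπ (M N : Mod C A) : M.X ⊗ N.X ⟶ relX M N := coequalizer.π _ _

instance epi_relπ (M N : Mod C A) : Epi (relπ M N) :=
  inferInstanceAs (Epi (coequalizer.π _ _))

theorem relπ_condition (M N : Mod C A) :
    lft (act M) N.X ≫ relπ M N = rgt M.X (act N) ≫ relπ M N :=
  coequalizer.condition _ _

/-- Morphisms out of the tensor product over `A`. -/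
def relDesc {M N : Mod C A} {Z : C} (f : M.X ⊗ N.X ⟶ Z)
    (h : lft (act M) N.X ≫ f = rgt M.X (act N) ≫ f) : relX M N ⟶ Z := coequalizer.desc f h

@[simp]
theorem relπ_desc {M N : Mod C A} {Z : C} (f : M.X ⊗ N.X ⟶ Z)
    (h : lft (act M) N.X ≫ f = rgt M.X (act N) ≫ f) : relπ M N ≫ relDesc f h = f :=
  coequalizer.π_desc _ _

/-- The image of the coequalizer defining the tensor product under a functor preserving it. -/
def mapRelIsColimit {D : Type*} [Category D] (F : C ⥤ D) [PreservesFiniteColimits F]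
    (M N : Mod C A) : IsColimit (Cofork.ofπ (F.map (relπ M N))
      (show F.map (lft (act M) N.X) ≫ F.map (relπ M N) = F.map (rgt M.X (act N)) ≫ _ by
        rw [← F.map_comp, relπ_condition, F.map_comp])) :=
  isColimitCoforkMapOfIsColimit F _ (coequalizerIsCoequalizer _ _)

/-- Used for the functors that tensor with an object on either side: they preserve the coequalizer,
so maps out of `A ⊗ (M ⊗_A N)` or `(M ⊗_A N) ⊗ P` can be defined before the quotient. -/
theorem exists_mapRel_desc {D : Type*} [Category D] (F : C ⥤ D) [PreservesFiniteColimits F]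
    {M N : Mod C A} {Z : D} (f : F.obj (M.X ⊗ N.X) ⟶ Z)
    (h : F.map (lft (act M) N.X) ≫ f = F.map (rgt M.X (act N)) ≫ f) :
    ∃ g, F.map (relπ M N) ≫ g = f :=
  ⟨_, Cofork.IsColimit.π_desc' (mapRelIsColimit F M N) f h⟩

theorem mul_lin_lft (M : Mod C A) : Lin (lft μ[A] M.X) (act M) (act M) := by
  unfold Lin lft
  rw [assoc, act_mul]
  simp

/-- In elements, `b (a m) = a (b m)` up to the symmetry: here commutativity of `A` enters. -/
theorem lin_act [IsCommMonObj A] (M : Mod C A) : Lin (rgt A (act M)) (act M) (act M) := by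
  unfold Lin rgt
  have h := act_mul M
  rw [← Iso.inv_comp_eq] at h
  have h' : (β_ A A).hom ≫ μ[A] = μ[A] := IsCommMonObj.mul_comm A
  rw [← h, assoc, assoc, assoc, ← act_mul, ← comp_whiskerRight_assoc, h']

/-- Together with the next lemma: both maps of the coequalizer pair commute with the operation of
`A` on `M`, so this operation passes to the quotient. For the first map this needs commutativity of
`A`; for the second, the two operations take place on different factors. -/
theorem whiskerLeft_lft_comp_lft [IsCommMonObj A] (M N : Mod C A) :
    Lin (rgt A (lft (act M) N.X)) (lft (act M) N.X) (lft (act M) N.X) := by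
  have h := ((lin_act M).lft_whiskerRight N.X)
  have h2 := (lft_rgt_assoc A (act M) N.X)
  exact (h2.inv (α_ _ _ _)).comp h

theorem whiskerLeft_rgt_comp_lft [IsCommMonObj A] (M N : Mod C A) :
    Lin (rgt A (lft (act M) N.X)) (lft (act M) N.X) (rgt M.X (act N)) := by
  have h1 := (lft_rgt_assoc A (act M) N.X).inv (α_ _ _ _)
  have h2 := (rgt_braiding A (act M)).lft_whiskerRight N.X
  have h3 := lft_lft_assoc (act M) A N.X
  have h4 := lft_whiskerLeft (act M) (act N)
  exact h1.comp (h2.comp (h3.comp h4))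

variable [IsCommMonObj A]

theorem exists_relAct (M N : Mod C A) : ∃ s : A ⊗ relX M N ⟶ relX M N,
    Lin (lft (act M) N.X) s (relπ M N) := by
  obtain ⟨s, hs⟩ := exists_mapRel_desc (tensorLeft A) (M := M) (N := N)
    (lft (act M) N.X ≫ relπ M N) (by
      have h1 := whiskerLeft_lft_comp_lft M N
      have h2 := whiskerLeft_rgt_comp_lft M N
      unfold Lin at h1 h2
      change (A ◁ _) ≫ _ = (A ◁ _) ≫ _
      rw [← reassoc_of% h1, ← reassoc_of% h2, relπ_condition])
  exact ⟨s, hs.symm⟩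

/-- The action of `A` on the tensor product over `A`. -/
def relAct (M N : Mod C A) : A ⊗ relX M N ⟶ relX M N := (exists_relAct M N).choose

theorem lin_relπ_lft (M N : Mod C A) : Lin (lft (act M) N.X) (relAct M N) (relπ M N) :=
  (exists_relAct M N).choose_spec

theorem lin_relπ_rgt (M N : Mod C A) : Lin (rgt M.X (act N)) (relAct M N) (relπ M N) :=
  (relπ_condition M N).symm.trans (lin_relπ_lft M N)

/-- The module structure on the tensor product over `A`. -/
abbrev relModObj (M N : Mod C A) : ModObj A (relX M N) where
  smul := relAct M N
  one_smul := by
    change (η[A] ▷ relX M N) ≫ relAct M N = (λ_ _).hom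
    have h := lin_relπ_lft M N
    unfold Lin lft at h
    -- The module laws are tested before the quotient, where they are those of `M`.
    rw [← cancel_epi (𝟙_ C ◁ relπ M N), whisker_exchange_assoc, ← h, assoc,
      associator_inv_naturality_left_assoc, ← comp_whiskerRight_assoc, act_one]
    simp
  mul_smul := by
    change (μ[A] ▷ relX M N) ≫ relAct M N =
      (α_ _ _ _).hom ≫ (A ◁ relAct M N) ≫ relAct M N
    have h := lin_relπ_lft M N
    unfold Lin lft at h
    rw [← cancel_epi ((A ⊗ A) ◁ relπ M N), whisker_exchange_assoc, ← h, assoc,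
      associator_inv_naturality_left_assoc, ← comp_whiskerRight_assoc, act_mul,
      associator_naturality_right_assoc, ← whiskerLeft_comp_assoc, ← h, whiskerLeft_comp,
      assoc, ← h]
    simp

/-- The tensor product over `A`. -/
def relTensor (M N : Mod C A) : Mod C A :=
  letI := relModObj M N
  ⟨relX M N⟩

/-- The universal bilinear map. -/
def rel (M N : Mod C A) : M.X ⊗ N.X ⟶ (relTensor M N).X := relπ M N

instance epi_rel (M N : Mod C A) : Epi (rel M N) := epi_relπ M N

theorem rel_lft (M N : Mod C A) : Lin (lft (act M) N.X) (act (relTensor M N)) (rel M N) :=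
  lin_relπ_lft M N

theorem rel_rgt (M N : Mod C A) : Lin (rgt M.X (act N)) (act (relTensor M N)) (rel M N) :=
  lin_relπ_rgt M N

theorem exists_map_rel_desc {D : Type*} [Category D] (F : C ⥤ D) [PreservesFiniteColimits F]
    {M N : Mod C A} {Z : D} (f : F.obj (M.X ⊗ N.X) ⟶ Z)
    (h : F.map (lft (act M) N.X) ≫ f = F.map (rgt M.X (act N)) ≫ f) :
    ∃ g, F.map (rel M N) ≫ g = f := exists_mapRel_desc F f h

/-- The universal property of the tensor product over `A`. -/
theorem exists_rel_lift {M N P : Mod C A} (f : M.X ⊗ N.X ⟶ P.X)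
    (h₁ : Lin (lft (act M) N.X) (act P) f) (h₂ : Lin (rgt M.X (act N)) (act P) f) :
    ∃ g : relTensor M N ⟶ P, rel M N ≫ g.hom = f := by
  have e : rel M N ≫ relDesc f (h₁.trans h₂.symm) = f := relπ_desc f _
  exact ⟨homOfLin (relDesc f (h₁.trans h₂.symm)) ((rel_lft M N).of_epi (by rwa [e])), e⟩

/-- The morphism induced by a bilinear map. -/
def relLift {M N P : Mod C A} (f : M.X ⊗ N.X ⟶ P.X)
    (h₁ : Lin (lft (act M) N.X) (act P) f) (h₂ : Lin (rgt M.X (act N)) (act P) f) :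
    relTensor M N ⟶ P := (exists_rel_lift f h₁ h₂).choose

@[simp]
theorem rel_relLift {M N P : Mod C A} (f : M.X ⊗ N.X ⟶ P.X)
    (h₁ : Lin (lft (act M) N.X) (act P) f) (h₂ : Lin (rgt M.X (act N)) (act P) f) :
    rel M N ≫ (relLift f h₁ h₂).hom = f := (exists_rel_lift f h₁ h₂).choose_spec

theorem rel_ext {M N P : Mod C A} {f g : relTensor M N ⟶ P}
    (h : rel M N ≫ f.hom = rel M N ≫ g.hom) : f = g :=
  Mod.hom_ext _ _ ((cancel_epi _).1 h)

/-- Two descents: `h₁` and `h₂` make `t` balanced over `M` and `N`, hence defined on `(M ⊗_A N) ⊗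
P`; then `h₁` and `h₃` make the resulting map bilinear. -/
theorem exists_rel_lift_left {M N P Q : Mod C A} (t : (M.X ⊗ N.X) ⊗ P.X ⟶ Q.X)
    (h₁ : Lin (lft (lft (act M) N.X) P.X) (act Q) t)
    (h₂ : Lin (lft (rgt M.X (act N)) P.X) (act Q) t)
    (h₃ : Lin (rgt (M.X ⊗ N.X) (act P)) (act Q) t) :
    ∃ g : relTensor (relTensor M N) P ⟶ Q, (rel M N ▷ P.X) ≫ rel _ _ ≫ g.hom = t := by
  obtain ⟨g, hg⟩ := exists_map_rel_desc (tensorRight P.X) (M := M) (N := N) t (by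
    have h := h₁.trans h₂.symm
    simp only [lft, assoc, cancel_epi] at h
    exact h)
  change (rel M N ▷ P.X) ≫ g = t at hg
  obtain ⟨g', hg'⟩ := exists_rel_lift g
    (((rel_lft M N).lft_whiskerRight P.X).of_epi (by rwa [hg]))
    ((rgt_whiskerRight (act P) (rel M N)).of_epi (by rwa [hg]))
  exact ⟨g', by rw [hg', hg]⟩

theorem exists_rel_lift_right {M N P Q : Mod C A} (t : M.X ⊗ (N.X ⊗ P.X) ⟶ Q.X)
    (h₁ : Lin (lft (act M) _) (act Q) t)
    (h₂ : Lin (rgt M.X (lft (act N) P.X)) (act Q) t)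
    (h₃ : Lin (rgt M.X (rgt N.X (act P))) (act Q) t) :
    ∃ g : relTensor M (relTensor N P) ⟶ Q, (M.X ◁ rel N P) ≫ rel _ _ ≫ g.hom = t := by
  obtain ⟨g, hg⟩ := exists_map_rel_desc (tensorLeft M.X) (M := N) (N := P) t (by
    have h := h₂.trans h₃.symm
    simp only [rgt, assoc, cancel_epi, Iso.cancel_iso_hom_left, Iso.cancel_iso_inv_left] at h
    exact h)
  change (M.X ◁ rel N P) ≫ g = t at hg
  obtain ⟨g', hg'⟩ := exists_rel_lift g
    ((lft_whiskerLeft (act M) (rel N P)).of_epi (by rwa [hg]))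
    (((rel_lft N P).rgt_whiskerLeft M.X).of_epi (by rwa [hg]))
  exact ⟨g', by rw [hg', hg]⟩

end RelTensor

/-! ### The monoidal structure on modules -/

section RelMonoidal

open Category MonObj

universe v w

variable {C : Type w} [Category.{v} C] [MonoidalCategory C] [SymmetricCategory C] {A : C} [MonObj A]
  [HasFiniteColimits C] [∀ X : C, PreservesFiniteColimits (tensorLeft X)] [IsCommMonObj A]

/-- The tensor product over `A` of morphisms. -/
def relHom {M M' N N' : Mod C A} (f : M ⟶ M') (g : N ⟶ N') : relTensor M N ⟶ relTensor M' N' :=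
  relLift ((f.hom ▷ N.X) ≫ (M'.X ◁ g.hom) ≫ rel M' N')
    (((lin_hom f).lft_whiskerRight _).comp ((lft_whiskerLeft _ _).comp (rel_lft _ _)))
    ((rgt_whiskerRight _ _).comp (((lin_hom g).rgt_whiskerLeft _).comp (rel_rgt _ _)))

@[simp]
theorem rel_relHom {M M' N N' : Mod C A} (f : M ⟶ M') (g : N ⟶ N') :
    rel M N ≫ (relHom f g).hom = (f.hom ▷ N.X) ≫ (M'.X ◁ g.hom) ≫ rel M' N' :=
  rel_relLift ..

theorem exists_relAssoc (M N P : Mod C A) :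
    ∃ g : relTensor (relTensor M N) P ⟶ relTensor M (relTensor N P),
      (rel M N ▷ P.X) ≫ rel _ _ ≫ g.hom =
        (α_ M.X N.X P.X).hom ≫ (M.X ◁ rel N P) ≫ rel _ _ :=
  exists_rel_lift_left _
    ((lft_lft_assoc _ _ _).comp ((lft_whiskerLeft _ _).comp (rel_lft _ _)))
    ((lft_rgt_assoc _ _ _).comp (((rel_lft _ _).rgt_whiskerLeft _).comp (rel_rgt _ _)))
    ((rgt_rgt_assoc _ _ _).comp (((rel_rgt _ _).rgt_whiskerLeft _).comp (rel_rgt _ _)))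

theorem exists_relAssocInv (M N P : Mod C A) :
    ∃ g : relTensor M (relTensor N P) ⟶ relTensor (relTensor M N) P,
      (M.X ◁ rel N P) ≫ rel _ _ ≫ g.hom =
        (α_ M.X N.X P.X).inv ≫ (rel M N ▷ P.X) ≫ rel _ _ :=
  exists_rel_lift_right _
    (((lft_lft_assoc _ _ _).inv (α_ _ _ _)).comp
      (((rel_lft _ _).lft_whiskerRight _).comp (rel_lft _ _)))
    (((lft_rgt_assoc _ _ _).inv (α_ _ _ _)).comp
      (((rel_rgt _ _).lft_whiskerRight _).comp (rel_lft _ _)))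
    (((rgt_rgt_assoc _ _ _).inv (α_ _ _ _)).comp
      ((rgt_whiskerRight _ _).comp (rel_rgt _ _)))

theorem rel_ext_left {M N P Q : Mod C A} {f g : relTensor (relTensor M N) P ⟶ Q}
    (h : (rel M N ▷ P.X) ≫ rel _ _ ≫ f.hom = (rel M N ▷ P.X) ≫ rel _ _ ≫ g.hom) : f = g :=
  rel_ext ((cancel_epi _).1 h)

theorem rel_ext_right {M N P Q : Mod C A} {f g : relTensor M (relTensor N P) ⟶ Q}
    (h : (M.X ◁ rel N P) ≫ rel _ _ ≫ f.hom = (M.X ◁ rel N P) ≫ rel _ _ ≫ g.hom) : f = g :=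
  rel_ext ((cancel_epi _).1 h)

/-- The associativity isomorphism of the tensor product over `A`. -/
def relAssoc (M N P : Mod C A) :
    relTensor (relTensor M N) P ≅ relTensor M (relTensor N P) where
  hom := (exists_relAssoc M N P).choose
  inv := (exists_relAssocInv M N P).choose
  hom_inv_id := by
    apply rel_ext_left
    rw [Mod.comp_hom', reassoc_of% (exists_relAssoc M N P).choose_spec,
      (exists_relAssocInv M N P).choose_spec]
    simp
  inv_hom_id := by
    apply rel_ext_right
    rw [Mod.comp_hom', reassoc_of% (exists_relAssocInv M N P).choose_spec,
      (exists_relAssoc M N P).choose_spec]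
    simp

theorem rel_relAssoc (M N P : Mod C A) : (rel M N ▷ P.X) ≫ rel _ _ ≫ (relAssoc M N P).hom.hom =
    (α_ M.X N.X P.X).hom ≫ (M.X ◁ rel N P) ≫ rel _ _ :=
  (exists_relAssoc M N P).choose_spec

/-- The symmetry of the tensor product over `A`. -/
def relBraidHom (M N : Mod C A) : relTensor M N ⟶ relTensor N M :=
  relLift ((β_ M.X N.X).hom ≫ rel N M) ((lft_braiding _ _).comp (rel_rgt _ _))
    ((rgt_braiding _ _).comp (rel_lft _ _))

@[simp]
theorem rel_relBraidHom (M N : Mod C A) :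
    rel M N ≫ (relBraidHom M N).hom = (β_ M.X N.X).hom ≫ rel N M := rel_relLift ..

theorem relBraidHom_relBraidHom (M N : Mod C A) : relBraidHom M N ≫ relBraidHom N M = 𝟙 _ := by
  apply rel_ext
  simp [reassoc_of% rel_relBraidHom M N]

/-- The symmetry isomorphism of the tensor product over `A`. -/
def relBraid (M N : Mod C A) : relTensor M N ≅ relTensor N M where
  hom := relBraidHom M N
  inv := relBraidHom N M
  hom_inv_id := relBraidHom_relBraidHom M N
  inv_hom_id := relBraidHom_relBraidHom N M

theorem lin_unit (M : Mod C A) :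
    Lin (act M) (rgt A (act M)) ((λ_ M.X).inv ≫ (η[A] ▷ M.X)) := by
  refine Lin.comp (b := rgt (𝟙_ C) (act M)) ?_ (rgt_whiskerRight _ _)
  unfold Lin rgt
  rw [← cancel_mono (λ_ M.X).hom]
  simp

theorem unit_lft (M : Mod C A) :
    (A ◁ ((λ_ M.X).inv ≫ (η[A] ▷ M.X))) ≫ lft μ[A] M.X = 𝟙 _ := by
  unfold lft
  rw [whiskerLeft_comp, assoc, associator_inv_naturality_middle_assoc, ← comp_whiskerRight,
    MonObj.mul_one]
  simp

/-- The universal bilinear map on `A` and a module. -/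
def relA (M : Mod C A) : A ⊗ M.X ⟶ (relTensor (Mod.regular A) M).X := rel (Mod.regular A) M

theorem relA_lft (M : Mod C A) : Lin (lft μ[A] M.X) (act (relTensor (Mod.regular A) M)) (relA M) :=
  rel_lft (Mod.regular A) M

theorem relA_rgt (M : Mod C A) :
    Lin (rgt A (act M)) (act (relTensor (Mod.regular A) M)) (relA M) :=
  rel_rgt (Mod.regular A) M

theorem lin_unit_relA (M : Mod C A) :
    Lin (act M) (act (relTensor (Mod.regular A) M)) (((λ_ M.X).inv ≫ (η[A] ▷ M.X)) ≫ relA M) :=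
  (lin_unit M).comp (relA_rgt M)

/-- In `A ⊗_A M` one has `1 ⊗ a m = a (1 ⊗ m) = a ⊗ m`. Hence `m ↦ 1 ⊗ m` is inverse to the action.
-/
theorem act_unit_relA (M : Mod C A) :
    act M ≫ ((λ_ M.X).inv ≫ (η[A] ▷ M.X)) ≫ relA M = relA M := by
  have h1 := lin_unit_relA M
  have h2 := relA_lft M
  unfold Lin at h1 h2
  rw [h1, whiskerLeft_comp, assoc, ← h2, ← assoc, unit_lft, id_comp]

/-- The action, as a morphism from the tensor product over `A`. -/
def relLeftUnitorHom (M : Mod C A) : relTensor (Mod.regular A) M ⟶ M :=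
  relLift (act M) (mul_lin_lft M) (lin_act M)

theorem relA_leftUnitorHom (M : Mod C A) : relA M ≫ (relLeftUnitorHom M).hom = act M :=
  rel_relLift (M := Mod.regular A) (act M) (mul_lin_lft M) (lin_act M)

/-- The left unit isomorphism of the tensor product over `A`. -/
def relLeftUnitor (M : Mod C A) : relTensor (Mod.regular A) M ≅ M where
  hom := relLeftUnitorHom M
  inv := homOfLin _ (lin_unit_relA M)
  hom_inv_id := by
    apply rel_ext
    change relA M ≫ (relLeftUnitorHom M).hom ≫ ((λ_ M.X).inv ≫ (η[A] ▷ M.X)) ≫ relA M =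
      relA M ≫ 𝟙 _
    rw [reassoc_of% relA_leftUnitorHom M, act_unit_relA, comp_id]
  inv_hom_id := by
    apply Mod.hom_ext
    change (((λ_ M.X).inv ≫ (η[A] ▷ M.X)) ≫ relA M) ≫ (relLeftUnitorHom M).hom = 𝟙 _
    rw [assoc, relA_leftUnitorHom, assoc, act_one, Iso.inv_hom_id]

@[simp]
theorem rel_leftUnitor (M : Mod C A) : rel (Mod.regular A) M ≫ (relLeftUnitor M).hom.hom = act M :=
  relA_leftUnitorHom M

/-- The right unit isomorphism of the tensor product over `A`. -/
def relRightUnitor (M : Mod C A) : relTensor M (Mod.regular A) ≅ M :=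
  relBraid M (Mod.regular A) ≪≫ relLeftUnitor M

@[simp]
theorem rel_rightUnitor (M : Mod C A) :
    rel M (Mod.regular A) ≫ (relRightUnitor M).hom.hom = (β_ M.X A).hom ≫ act M := by
  change rel M (Mod.regular A) ≫ (relBraidHom _ _).hom ≫ (relLeftUnitor M).hom.hom = _
  rw [reassoc_of% rel_relBraidHom, rel_leftUnitor]
  rfl

/-- The bilinearity of the universal bilinear map. -/
theorem actLeft_rel (M N : Mod C A) : actLeft M N ≫ rel M N = actRight M N ≫ rel M N := by
  have h : lft (act M) N.X ≫ rel M N = rgt M.X (act N) ≫ rel M N := relπ_condition M N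
  unfold lft rgt at h
  unfold actLeft actRight
  rw [assoc, Iso.inv_comp_eq] at h
  rw [comp_whiskerRight, assoc, h]
  simp only [assoc, Iso.hom_inv_id_assoc]
  rw [← comp_whiskerRight_assoc, SymmetricCategory.symmetry]
  simp

scoped instance relStruct : MonoidalCategoryStruct (Mod C A) where
  tensorObj := relTensor
  whiskerLeft M _ _ g := relHom (𝟙 M) g
  whiskerRight f N := relHom f (𝟙 N)
  tensorHom f g := relHom f g
  tensorUnit := Mod.regular A
  associator := relAssoc
  leftUnitor := relLeftUnitor
  rightUnitor := relRightUnitor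

/-- The universal bilinear map. -/
def tm (M N : Mod C A) : M.X ⊗ N.X ⟶ (M ⊗ N : Mod C A).X := rel M N

instance (M N : Mod C A) : Epi (tm M N) := epi_rel M N

theorem tm_tensorHom {M M' N N' : Mod C A} (f : M ⟶ M') (g : N ⟶ N') :
    tm M N ≫ (f ⊗ₘ g).hom = (f.hom ▷ N.X) ≫ (M'.X ◁ g.hom) ≫ tm M' N' := rel_relHom f g

theorem tm_tensorHom_assoc {M M' N N' : Mod C A} (f : M ⟶ M') (g : N ⟶ N')
    {Z : C} (h : (M' ⊗ N' : Mod C A).X ⟶ Z) :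
    tm M N ≫ (f ⊗ₘ g).hom ≫ h = (f.hom ▷ N.X) ≫ (M'.X ◁ g.hom) ≫ tm M' N' ≫ h := by
  simpa only [assoc] using tm_tensorHom f g =≫ h

theorem tm_whiskerLeft {M N N' : Mod C A} (g : N ⟶ N') :
    tm M N ≫ (M ◁ g).hom = (M.X ◁ g.hom) ≫ tm M N' := by
  refine (rel_relHom (𝟙 M) g).trans ?_
  simp [tm]

theorem tm_whiskerLeft_assoc {M N N' : Mod C A} (g : N ⟶ N')
    {Z : C} (h : (M ⊗ N' : Mod C A).X ⟶ Z) :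
    tm M N ≫ (M ◁ g).hom ≫ h = (M.X ◁ g.hom) ≫ tm M N' ≫ h := by
  simpa only [assoc] using tm_whiskerLeft g =≫ h

theorem tm_whiskerRight {M M' N : Mod C A} (f : M ⟶ M') :
    tm M N ≫ (f ▷ N).hom = (f.hom ▷ N.X) ≫ tm M' N := by
  refine (rel_relHom f (𝟙 N)).trans ?_
  simp [tm]

theorem tm_whiskerRight_assoc {M M' N : Mod C A} (f : M ⟶ M')
    {Z : C} (h : (M' ⊗ N : Mod C A).X ⟶ Z) :
    tm M N ≫ (f ▷ N).hom ≫ h = (f.hom ▷ N.X) ≫ tm M' N ≫ h := by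
  simpa only [assoc] using tm_whiskerRight f =≫ h

theorem tm_assoc (M N P : Mod C A) : (tm M N ▷ P.X) ≫ tm _ _ ≫ (α_ M N P).hom.hom =
    (α_ M.X N.X P.X).hom ≫ (M.X ◁ tm N P) ≫ tm _ _ := rel_relAssoc M N P

theorem tm_assoc_assoc (M N P : Mod C A) {Z : C} (h : (M ⊗ N ⊗ P : Mod C A).X ⟶ Z) :
    (tm M N ▷ P.X) ≫ tm _ _ ≫ (α_ M N P).hom.hom ≫ h =
      (α_ M.X N.X P.X).hom ≫ (M.X ◁ tm N P) ≫ tm _ _ ≫ h := by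
  simpa only [assoc] using tm_assoc M N P =≫ h

theorem tm_leftUnitor (M : Mod C A) : tm (𝟙_ (Mod C A)) M ≫ (λ_ M).hom.hom = act M :=
  rel_leftUnitor M

theorem tm_rightUnitor (M : Mod C A) :
    tm M (𝟙_ (Mod C A)) ≫ (ρ_ M).hom.hom = (β_ M.X A).hom ≫ act M := rel_rightUnitor M

theorem tm_ext {M N P : Mod C A} {f g : M ⊗ N ⟶ P}
    (h : tm M N ≫ f.hom = tm M N ≫ g.hom) : f = g := rel_ext h

theorem tm_condition (M N : Mod C A) : actLeft M N ≫ tm M N = actRight M N ≫ tm M N :=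
  actLeft_rel M N

-- The structure maps are characterized by their composites with the universal bilinear maps, which
-- are epi and remain so after tensoring. Each axiom becomes the corresponding axiom of `C` once
-- precomposed with enough of them.
scoped instance relMonoidal : MonoidalCategory (Mod C A) :=
  MonoidalCategory.ofTensorHom
    (id_tensorHom_id := fun M N => tm_ext (by simp [tm_tensorHom]))
    (id_tensorHom := fun _ _ _ _ => rfl)
    (tensorHom_id := fun _ _ => rfl)
    (tensorHom_comp_tensorHom := fun f g f' g' => tm_ext (by
      simp only [Mod.comp_hom', tm_tensorHom_assoc, tm_tensorHom, comp_whiskerRight,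
        whiskerLeft_comp, assoc]
      rw [whisker_exchange_assoc]))
    (associator_naturality := fun {M N P M' N' P'} f g h => rel_ext_left (by
      change (tm M N ▷ P.X) ≫ tm _ _ ≫ _ = (tm M N ▷ P.X) ≫ tm _ _ ≫ _
      simp only [Mod.comp_hom', tm_tensorHom_assoc, tm_tensorHom, tm_assoc_assoc]
      rw [← comp_whiskerRight_assoc, tm_tensorHom]
      simp only [comp_whiskerRight, assoc]
      rw [← whisker_exchange_assoc, tm_assoc, whisker_exchange_assoc, ← whiskerLeft_comp_assoc,
        tm_tensorHom]
      simp))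
    (leftUnitor_naturality := fun {M N} f => tm_ext (by
      rw [Mod.comp_hom', Mod.comp_hom', tm_tensorHom_assoc, tm_leftUnitor,
        reassoc_of% tm_leftUnitor]
      refine Eq.trans ?_ (lin_hom f).symm
      change ((𝟙 A) ▷ M.X) ≫ (A ◁ f.hom) ≫ act N = _
      simp))
    (rightUnitor_naturality := fun {M N} f => tm_ext (by
      rw [Mod.comp_hom', Mod.comp_hom', tm_tensorHom_assoc, tm_rightUnitor,
        reassoc_of% tm_rightUnitor]
      have h : act M ≫ f.hom = _ := lin_hom f
      refine Eq.trans ?_ ((congrArg ((β_ M.X A).hom ≫ ·) h).symm.trans (assoc _ _ _).symm)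
      change (f.hom ▷ A) ≫ (N.X ◁ (𝟙 A)) ≫ (β_ N.X A).hom ≫ act N = _
      simp))
    (pentagon := fun M N P Q => by
      -- Four factors require three successive projections, two of them tensored with the remaining
      -- factors.
      have e : Epi ((tm M N ▷ P.X) ▷ Q.X) := inferInstance
      have e2 : Epi (tm (M ⊗ N) P ▷ Q.X) := inferInstance
      apply tm_ext
      rw [← cancel_epi (tm (M ⊗ N) P ▷ Q.X), ← cancel_epi ((tm M N ▷ P.X) ▷ Q.X)]
      simp only [Mod.comp_hom', tm_tensorHom_assoc, tm_tensorHom, tm_assoc_assoc, tm_assoc,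
        Mod.id_hom', whiskerLeft_id, id_whiskerRight, id_comp]
      rw [← comp_whiskerRight_assoc, ← comp_whiskerRight_assoc, assoc, tm_assoc]
      simp only [comp_whiskerRight, assoc]
      rw [tm_assoc_assoc, associator_naturality_left_assoc, ← whisker_exchange_assoc, tm_assoc,
        associator_naturality_middle_assoc, tm_tensorHom, Mod.id_hom', id_whiskerRight, id_comp,
        ← whiskerLeft_comp_assoc, ← whiskerLeft_comp_assoc, assoc, tm_assoc]
      simp)
    (triangle := fun M N => by
      apply tm_ext
      rw [← cancel_epi (tm M (𝟙_ _) ▷ N.X)]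
      simp only [Mod.comp_hom', tm_tensorHom_assoc, tm_tensorHom, tm_assoc_assoc, tm_assoc,
        Mod.id_hom', whiskerLeft_id, id_whiskerRight, id_comp]
      rw [← whiskerLeft_comp_assoc, ← comp_whiskerRight_assoc, tm_leftUnitor, tm_rightUnitor]
      -- The triangle is the balancing relation `m a ⊗ n = m ⊗ a n` itself.
      have := tm_condition M N
      unfold actLeft actRight at this
      rw [assoc] at this
      exact this.symm)

end RelMonoidal

/-! ### The symmetry -/

section RelSymmetric

open Category MonObj

universe v w

variable {C : Type w} [Category.{v} C] [MonoidalCategory C] [SymmetricCategory C] {A : C} [MonObj A]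
  [HasFiniteColimits C] [∀ X : C, PreservesFiniteColimits (tensorLeft X)] [IsCommMonObj A]

theorem tm_relBraid (M N : Mod C A) :
    tm M N ≫ (relBraid M N).hom.hom = (β_ M.X N.X).hom ≫ tm N M := rel_relBraidHom M N

theorem tm_relBraid_assoc (M N : Mod C A) {Z : C} (h : (N ⊗ M : Mod C A).X ⟶ Z) :
    tm M N ≫ (relBraid M N).hom.hom ≫ h = (β_ M.X N.X).hom ≫ tm N M ≫ h := by
  simpa only [assoc] using tm_relBraid M N =≫ h

theorem tm_assoc_inv (M N P : Mod C A) : (M.X ◁ tm N P) ≫ tm _ _ ≫ (α_ M N P).inv.hom =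
    (α_ M.X N.X P.X).inv ≫ (tm M N ▷ P.X) ≫ tm _ _ := by
  rw [← cancel_epi (α_ M.X N.X P.X).hom, Iso.hom_inv_id_assoc, ← tm_assoc_assoc,
    ← Mod.comp_hom', Iso.hom_inv_id]
  simp

theorem tm_assoc_inv_assoc (M N P : Mod C A) {Z : C} (h : ((M ⊗ N) ⊗ P : Mod C A).X ⟶ Z) :
    (M.X ◁ tm N P) ≫ tm _ _ ≫ (α_ M N P).inv.hom ≫ h =
      (α_ M.X N.X P.X).inv ≫ (tm M N ▷ P.X) ≫ tm _ _ ≫ h := by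
  simpa only [assoc] using tm_assoc_inv M N P =≫ h

theorem tm_ext_left {M N P Q : Mod C A} {f g : (M ⊗ N) ⊗ P ⟶ Q}
    (h : (tm M N ▷ P.X) ≫ tm _ _ ≫ f.hom = (tm M N ▷ P.X) ≫ tm _ _ ≫ g.hom) : f = g :=
  rel_ext_left h

theorem tm_ext_right {M N P Q : Mod C A} {f g : M ⊗ (N ⊗ P) ⟶ Q}
    (h : (M.X ◁ tm N P) ≫ tm _ _ ≫ f.hom = (M.X ◁ tm N P) ≫ tm _ _ ≫ g.hom) : f = g :=
  rel_ext_right h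

scoped instance relBraided : BraidedCategory (Mod C A) where
  braiding M N := relBraid M N
  braiding_naturality_right M N P f := tm_ext (by
    simp only [Mod.comp_hom', tm_whiskerLeft_assoc, tm_relBraid, tm_relBraid_assoc,
      tm_whiskerRight, BraidedCategory.braiding_naturality_right_assoc])
  braiding_naturality_left f N := tm_ext (by
    simp only [Mod.comp_hom', tm_whiskerLeft, tm_relBraid, tm_relBraid_assoc,
      tm_whiskerRight_assoc, BraidedCategory.braiding_naturality_left_assoc])
  hexagon_forward M N P := tm_ext_left (by
    simp only [Mod.comp_hom', tm_assoc_assoc, tm_relBraid_assoc, tm_whiskerRight_assoc]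
    rw [← comp_whiskerRight_assoc, tm_relBraid, comp_whiskerRight, assoc, tm_assoc_assoc,
      tm_whiskerLeft, ← whiskerLeft_comp_assoc, tm_relBraid,
      BraidedCategory.braiding_naturality_right_assoc, tm_assoc]
    simp)
  hexagon_reverse M N P := tm_ext_right (by
    simp only [Mod.comp_hom', tm_assoc_inv_assoc, tm_relBraid_assoc, tm_whiskerLeft_assoc]
    rw [← whiskerLeft_comp_assoc, tm_relBraid, whiskerLeft_comp, assoc, tm_assoc_inv_assoc,
      tm_whiskerRight, ← comp_whiskerRight_assoc, tm_relBraid,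
      BraidedCategory.braiding_naturality_left_assoc, tm_assoc_inv]
    simp)

theorem tm_braiding (M N : Mod C A) :
    tm M N ≫ (β_ M N).hom.hom = (β_ M.X N.X).hom ≫ tm N M := rel_relBraidHom M N

scoped instance relSymmetric : SymmetricCategory (Mod C A) where
  symmetry M N := relBraidHom_relBraidHom M N

end RelSymmetric

/-! ### The lax monoidal structure of the forgetful functor -/

section ForgetLax

open Category

universe v w

variable {C : Type w} [Category.{v} C] [MonoidalCategory C] [SymmetricCategory C] {A : C} [MonObj A]
  [HasFiniteColimits C] [∀ X : C, PreservesFiniteColimits (tensorLeft X)] [IsCommMonObj A]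

theorem one_act_right (M : Mod C A) :
    (M.X ◁ MonObj.one) ≫ (β_ M.X A).hom ≫ act M = (ρ_ M.X).hom := by
  rw [BraidedCategory.braiding_naturality_right_assoc, act_one]
  simp

-- The axioms are the defining equations of the associator and the unitors over `A`, combined with
-- the unit law of the modules.
scoped instance forgetLaxMonoidal : (Mod.forget (D := C) A).LaxMonoidal where
  ε := MonObj.one (X := A)
  μ M N := tm M N
  μ_natural_left f _ := (tm_whiskerRight f).symm
  μ_natural_right _ f := (tm_whiskerLeft f).symm
  associativity M N P := tm_assoc M N P
  left_unitality M := ((congrArg (fun t => (MonObj.one (X := A) ▷ M.X) ≫ t)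
    (tm_leftUnitor M)).trans (act_one M)).symm
  right_unitality M := ((congrArg (fun t => (M.X ◁ MonObj.one (X := A)) ≫ t)
    (tm_rightUnitor M)).trans (one_act_right M)).symm

end ForgetLax

/-! ### Comparison with the coequalizer of `M ⊗ A ⊗ N` -/

section RelativeTensorProof

open Category MonObj

universe v w

variable {C : Type w} [Category.{v} C] [MonoidalCategory C] [SymmetricCategory C] {A : C} [MonObj A]
  [HasFiniteColimits C] [∀ X : C, PreservesFiniteColimits (tensorLeft X)] [IsCommMonObj A]

scoped instance forgetLaxBraided : (Mod.forget (D := C) A).LaxBraided where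
  braided M N := tm_braiding M N

variable (A) in
/-- The isomorphism between the sources of the two forms of the coequalizer. -/
def middleIso (M N : Mod C A) : A ⊗ (M.X ⊗ N.X) ≅ (M.X ⊗ A) ⊗ N.X :=
  (α_ A M.X N.X).symm ≪≫ whiskerRightIso (β_ A M.X) N.X

theorem middleIso_actLeft (M N : Mod C A) :
    (middleIso A M N).hom ≫ actLeft M N = lft (act M) N.X := by
  unfold middleIso actLeft lft
  simp only [Iso.trans_hom, Iso.symm_hom, whiskerRightIso_hom, assoc]
  rw [← comp_whiskerRight, SymmetricCategory.symmetry_assoc]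

theorem middleIso_actRight (M N : Mod C A) :
    (middleIso A M N).hom ≫ actRight M N = rgt M.X (act N) := by
  unfold middleIso actRight rgt
  simp

theorem isRelativeTensor : IsRelativeTensor A where
  condition M N := tm_condition M N
  isCoequalizer M N := by
    refine ⟨Cofork.IsColimit.mk' _ fun s => ?_⟩
    -- The pair used in the construction starts at `A ⊗ (M ⊗ N)`; the symmetry of `A` and `M`
    -- identifies it with the pair starting at `(M ⊗ A) ⊗ N`.
    have h : lft (act M) N.X ≫ s.π = rgt M.X (act N) ≫ s.π := by
      rw [← middleIso_actLeft, ← middleIso_actRight, assoc, assoc, s.condition]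
    exact ⟨relDesc s.π h, relπ_desc _ _, fun {m} hm =>
      (cancel_epi (tm M N)).1 (hm.trans (relπ_desc _ _).symm)⟩
  smul_tensor M N := by
    refine (rel_lft M N).symm.trans ?_
    unfold lft
    rw [assoc]
    rfl
  unit := ⟨Iso.refl _, by
    change η[A] = η[A] ≫ 𝟙 _
    rw [comp_id]⟩

end RelativeTensorProof

/-! ### Modules as algebras over the free module monad -/

section Monadic

open Category MonObj

universe v w

variable {C : Type w} [Category.{v} C] [MonoidalCategory C] (A : C) [MonObj A]

theorem freeAdj_counit (M : Mod C A) : ((freeAdj A).counit.app M).hom = act M := by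
  rw [← Adjunction.homEquiv_symm_id]
  unfold freeAdj
  simp only [Adjunction.mkOfHomEquiv_homEquiv]
  change (A ◁ 𝟙 M.X) ≫ act M = _
  simp

theorem freeAdj_unit (X : C) : (freeAdj A).unit.app X = (λ_ X).inv ≫ (η[A] ▷ X) := by
  rw [← Adjunction.homEquiv_id]
  unfold freeAdj
  simp only [Adjunction.mkOfHomEquiv_homEquiv]
  change (λ_ X).inv ≫ (η[A] ▷ X) ≫ 𝟙 (A ⊗ X) = _
  simp

/-- A module from its action. -/
abbrev modMk (X : C) (a : A ⊗ X ⟶ X) (h₁ : ((λ_ X).inv ≫ (η[A] ▷ X)) ≫ a = 𝟙 X)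
    (h₂ : ((α_ A A X).inv ≫ (μ[A] ▷ X)) ≫ a = (A ◁ a) ≫ a) : Mod C A :=
  letI : ModObj A X :=
    { smul := a
      one_smul := by
        rw [assoc, Iso.inv_comp_eq, comp_id] at h₁
        exact h₁
      mul_smul := by
        rw [assoc, Iso.inv_comp_eq] at h₂
        exact h₂ }
  ⟨X⟩

/-- The module underlying an algebra over the free module monad. -/
def modOfAlgebra (X : (freeAdj A).toMonad.Algebra) : Mod C A :=
  modMk A X.A X.a
    ((congrArg (· ≫ X.a) (freeAdj_unit A X.A)).symm.trans X.unit)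
    ((congrArg (· ≫ X.a) (freeAdj_counit A (freeMod A X.A))).symm.trans X.assoc)

/-- The unit of the adjunction is `x ↦ 1 ⊗ x`, and its counit at a module is the action. The laws of
an algebra are therefore those of a module, with the same underlying object, and the same holds for
morphisms. -/
instance comparison_isEquivalence : (Monad.comparison (freeAdj A)).IsEquivalence where
  faithful := ⟨fun {M N f g} h => Mod.hom_ext _ _ (congrArg Monad.Algebra.Hom.f h)⟩
  full := ⟨fun {M N} f => by
    have h := f.h
    change (A ◁ f.f) ≫ ((freeAdj A).counit.app N).hom =
      ((freeAdj A).counit.app M).hom ≫ f.f at h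
    rw [freeAdj_counit, freeAdj_counit] at h
    exact ⟨Mod.Hom.mk' f.f h.symm, rfl⟩⟩
  essSurj := ⟨fun X => ⟨modOfAlgebra A X, ⟨Monad.Algebra.isoMk (Iso.refl _) (by
    have h : ((freeAdj A).counit.app (modOfAlgebra A X)).hom = X.a := freeAdj_counit A _
    exact ((freeAdj A).toMonad.map_id X.A =≫ X.a).trans ((id_comp _).trans
      (h.symm.trans (comp_id _).symm)))⟩⟩⟩

instance forget_monadic : MonadicRightAdjoint (Mod.forget (D := C) A) where
  L := freeFunctor A
  adj := freeAdj A
  eqv := comparison_isEquivalence A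

end Monadic

/-! ### Limits and colimits of modules -/

section ModColimits

open Category Opposite

universe v w

variable {C : Type w} [Category.{v} C] [MonoidalCategory C] (A : C) [MonObj A]

instance forget_createsLimits : CreatesLimits (Mod.forget (D := C) A) :=
  monadicCreatesLimits _

instance mod_hasLimits [HasLimits C] : HasLimits (Mod C A) :=
  hasLimits_of_hasLimits_createsLimits (Mod.forget (D := C) A)

section

variable [PreservesColimits (tensorLeft A)]

instance preservesColimits_free_forget :
    PreservesColimits (freeFunctor A ⋙ Mod.forget (D := C) A) :=
  preservesColimits_of_natIso (F := tensorLeft A) (NatIso.ofComponents (fun _ => Iso.refl _)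
    (fun _ => (comp_id _).trans (id_comp _).symm))

/-- A monadic functor creates the colimits that its monad preserves, and here the monad is `A ⊗ -`.
-/
instance forget_createsColimits : CreatesColimits (Mod.forget (D := C) A) where
  CreatesColimitsOfShape :=
    { CreatesColimit := fun {K} => by
        have : PreservesColimits (monadicLeftAdjoint (Mod.forget (D := C) A) ⋙ Mod.forget A) :=
          preservesColimits_free_forget A
        exact monadicCreatesColimitOfPreservesColimit _ _ }

variable [HasColimits C]

instance mod_hasColimits : HasColimits (Mod C A) :=
  hasColimits_of_hasColimits_createsColimits (Mod.forget (D := C) A)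

instance forget_preservesColimits : PreservesColimits (Mod.forget (D := C) A) where
  preservesColimitsOfShape := { preservesColimit := inferInstance }

end

end ModColimits

/-! ### Internal homs by the special adjoint functor theorem -/

section ModClosed

open Category Opposite

universe v w

variable {C : Type w} [Category.{v} C] [MonoidalCategory C] [SymmetricCategory C] (A : C) [MonObj A]
  [HasColimits C] [∀ X : C, PreservesColimits (tensorLeft X)]

instance hom_epi {M N : Mod C A} (f : M ⟶ N) [Epi f] : Epi f.hom :=
  inferInstanceAs (Epi ((Mod.forget (D := C) A).map f))

/-- An epimorphism of modules determines the module structure on its target. -/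
theorem lin_of_epi_comp {M N P : Mod C A} (f : M ⟶ N) [Epi f] (g : M ⟶ P) (h : N.X ⟶ P.X)
    (e : f.hom ≫ h = g.hom) : Lin (act N) (act P) h := by
  have hg := lin_hom g
  rw [← e] at hg
  exact (lin_hom f).of_epi hg

/-- A quotient module is determined by its underlying quotient object: an epimorphism of modules
stays epi in `C`, and it forces the module structure of its target. -/
instance mod_wellCopowered [WellPowered.{v} Cᵒᵖ] : WellPowered.{v} (Mod C A)ᵒᵖ where
  subobject_small X := by
    let a (s : Subobject X) : op (unop (s : (Mod C A)ᵒᵖ)).X ⟶ op X.unop.X := s.arrow.unop.hom.op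
    have (s : Subobject X) : Epi s.arrow.unop.hom := hom_epi A s.arrow.unop
    have (s : Subobject X) : Mono (a s) := op_mono_of_epi _
    let φ : Subobject X → Subobject (op X.unop.X) := fun s => Subobject.mk (a s)
    refine small_of_injective (f := φ) fun s t h => ?_
    let e := Subobject.isoOfMkEqMk (a s) (a t) h
    have he : e.hom ≫ a t = a s := Subobject.ofMkLEMk_comp h.le
    have he' : t.arrow.unop.hom ≫ e.unop.hom = s.arrow.unop.hom := congrArg Quiver.Hom.unop he
    have hl := lin_of_epi_comp A t.arrow.unop s.arrow.unop e.unop.hom he'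
    let i := isoOfLin e.unop hl
    refine Subobject.eq_of_comm i.op (Quiver.Hom.unop_inj ?_)
    exact Mod.hom_ext _ _ he'

/-- Morphisms from the free module on `G` to `M` are morphisms from `G` to the object underlying
`M`. -/
theorem mod_isSeparating {G : C} (hG : IsSeparator G) :
    IsSeparator ((freeFunctor A).obj G) := by
  rw [isSeparator_def] at hG ⊢
  intro M N f g h
  refine Mod.hom_ext _ _ (hG _ _ fun x => ?_)
  obtain ⟨y, rfl⟩ := ((freeAdj A).homEquiv G M).surjective x
  have := congrArg (((freeAdj A).homEquiv _ _)) (h y)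
  rwa [Adjunction.homEquiv_naturality_right, Adjunction.homEquiv_naturality_right] at this

variable {A} in
-- `A ⊗ -` preserves the colimit, so the equation can be tested on the legs of the cocone.
theorem lin_of_isColimit {J : Type v} [SmallCategory J] {K : J ⥤ C} {c : Cocone K}
    (hc : IsColimit c) {Y : C} {a : ∀ j, A ⊗ K.obj j ⟶ K.obj j} {b : A ⊗ c.pt ⟶ c.pt}
    {d : A ⊗ Y ⟶ Y} {f : c.pt ⟶ Y} (h : ∀ j, Lin (a j) b (c.ι.app j))
    (h' : ∀ j, Lin (a j) d (c.ι.app j ≫ f)) : Lin b d f := by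
  refine (isColimitOfPreserves (tensorLeft A) hc).hom_ext fun j => ?_
  have e := h' j
  have e' := h j
  unfold Lin at e e'
  change (A ◁ c.ι.app j) ≫ _ = (A ◁ c.ι.app j) ≫ _
  rw [← reassoc_of% e', e, whiskerLeft_comp, assoc]

variable [IsCommMonObj A]

variable {A} in
theorem tm_lft (M N : Mod C A) : Lin (lft (act M) N.X) (act (M ⊗ N)) (tm M N) := rel_lft M N

variable {A} in
theorem tm_rgt (M N : Mod C A) : Lin (rgt M.X (act N)) (act (M ⊗ N)) (tm M N) := rel_rgt M N

variable {A} in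
/-- Morphisms induced by bilinear maps. -/
theorem exists_tm_lift {M N P : Mod C A} (f : M.X ⊗ N.X ⟶ P.X)
    (h₁ : Lin (lft (act M) N.X) (act P) f) (h₂ : Lin (rgt M.X (act N)) (act P) f) :
    ∃ g : M ⊗ N ⟶ P, tm M N ≫ g.hom = f := exists_rel_lift f h₁ h₂

variable {A} in
/-- The universal property of the colimit of tensor products. -/
theorem exists_tensor_desc (M : Mod C A) {J : Type v} [SmallCategory J] {K : J ⥤ Mod C A}
    {c : Cocone K} (hc : IsColimit c) (s : Cocone (K ⋙ tensorLeft M)) :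
    ∃ f : M ⊗ c.pt ⟶ s.pt, ∀ j, (M ◁ c.ι.app j) ≫ f = s.ι.app j := by
  -- The map is first built on `M ⊗ c.pt` in `C`, where tensoring preserves the underlying colimit,
  -- and then descends by bilinearity.
  let hc' := isColimitOfPreserves (Mod.forget (D := C) A ⋙ tensorLeft M.X) hc
  let s' : Cocone (K ⋙ Mod.forget (D := C) A ⋙ tensorLeft M.X) :=
    { pt := s.pt.X
      ι := { app := fun j => tm M (K.obj j) ≫ (s.ι.app j).hom
             naturality := fun i j f => by
              have e := congrArg (tm M (K.obj i) ≫ Mod.Hom.hom ·) (s.w f)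
              change tm M (K.obj i) ≫ (M ◁ K.map f).hom ≫ (s.ι.app j).hom = _ at e
              rw [tm_whiskerLeft_assoc] at e
              exact e.trans (comp_id _).symm } }
  have hf : ∀ j, (M.X ◁ (c.ι.app j).hom) ≫ hc'.desc s' = tm M (K.obj j) ≫ (s.ι.app j).hom :=
    fun j => hc'.fac s' j
  obtain ⟨g, hg⟩ := exists_tm_lift (hc'.desc s')
    (lin_of_isColimit hc' (a := fun j => lft (act M) (K.obj j).X)
      (fun j => lft_whiskerLeft _ _) fun j => by
        rw [hc'.fac s' j]
        exact (tm_lft _ _).comp (lin_hom _))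
    (lin_of_isColimit hc' (a := fun j => rgt M.X (act (K.obj j)))
      (fun j => (lin_hom (c.ι.app j)).rgt_whiskerLeft M.X) fun j => by
        rw [hc'.fac s' j]
        exact (tm_rgt _ _).comp (lin_hom _))
  exact ⟨g, fun j => tm_ext (by
    rw [Mod.comp_hom', tm_whiskerLeft_assoc]
    exact (congrArg (_ ≫ ·) hg).trans (hf j))⟩

instance mod_tensorLeft_preservesColimits (M : Mod C A) : PreservesColimits (tensorLeft M) where
  preservesColimitsOfShape {J _} :=
    { preservesColimit := fun {K} =>
      { preserves := fun {c} hc => ⟨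
        { desc := fun s => (exists_tensor_desc M hc s).choose
          fac := fun s j => (exists_tensor_desc M hc s).choose_spec j
          uniq := fun s m hm => by
            apply tm_ext
            refine (isColimitOfPreserves (Mod.forget (D := C) A ⋙ tensorLeft M.X) hc).hom_ext
              fun j => ?_
            have key (m' : M ⊗ c.pt ⟶ s.pt) : (M.X ◁ (c.ι.app j).hom) ≫ tm M c.pt ≫ m'.hom =
                tm M (K.obj j) ≫ ((M ◁ c.ι.app j) ≫ m').hom :=
              (tm_whiskerLeft_assoc (M := M) (c.ι.app j) m'.hom).symm
            refine (key m).trans (Eq.trans ?_ (key _).symm)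
            rw [(exists_tensor_desc M hc s).choose_spec j]
            exact congrArg (tm M _ ≫ Mod.Hom.hom ·) (hm j) }⟩ } }

instance mod_tensorRight_preservesColimits (M : Mod C A) : PreservesColimits (tensorRight M) :=
  preservesColimits_of_natIso (BraidedCategory.tensorLeftIsoTensorRight M)

/-- The special adjoint functor theorem: modules are cocomplete and well-copowered and have a
separator, the free module on a separator of `C`. -/
instance mod_tensorLeft_isLeftAdjoint [WellPowered.{v} Cᵒᵖ] [HasSeparator C] (M : Mod C A) :
    (tensorLeft M).IsLeftAdjoint :=
  isLeftAdjoint_of_preservesColimits_of_isSeparating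
    (mod_isSeparating A (isSeparator_separator C)) _

scoped instance mod_closed [WellPowered.{v} Cᵒᵖ] [HasSeparator C] : MonoidalClosed (Mod C A) where
  closed M := ⟨_, Adjunction.ofIsLeftAdjoint (tensorLeft M)⟩

end ModClosed

/-! ### Tensor products over `A` of free modules -/

section FreeTensor

open Category MonObj

universe v w

variable {C : Type w} [Category.{v} C] [MonoidalCategory C] [SymmetricCategory C] (A : C) [MonObj A]
  [HasFiniteColimits C] [∀ X : C, PreservesFiniteColimits (tensorLeft X)] [IsCommMonObj A]

/-- The unit of the free module adjunction, `x ↦ 1 ⊗ x`. -/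
def freeUnit (X : C) : X ⟶ A ⊗ X := (λ_ X).inv ≫ (η[A] ▷ X)

theorem freeUnit_naturality {X Y : C} (f : X ⟶ Y) :
    f ≫ freeUnit A Y = freeUnit A X ≫ (A ◁ f) := by
  unfold freeUnit
  rw [assoc, ← whisker_exchange]
  simp

theorem whiskerLeft_freeUnit_lft (X : C) : (A ◁ freeUnit A X) ≫ lft μ[A] X = 𝟙 _ := by
  unfold lft freeUnit
  rw [whiskerLeft_comp, assoc, associator_inv_naturality_middle_assoc, ← comp_whiskerRight,
    MonObj.mul_one]
  simp

variable {A} in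
theorem freeUnit_act (M : Mod C A) : freeUnit A M.X ≫ act M = 𝟙 _ := by
  unfold freeUnit
  rw [assoc, act_one, Iso.inv_hom_id]

/-- The canonical map from `X ⊗ N` to the tensor product over `A` of the free module on `X`
and `N`. -/
def freeTensor (X : C) (N : Mod C A) : X ⊗ N.X ⟶ (freeMod A X ⊗ N : Mod C A).X :=
  (freeUnit A X ▷ N.X) ≫ tm (freeMod A X) N

theorem lin_freeTensor (X : C) (N : Mod C A) :
    Lin (rgt X (act N)) (act (freeMod A X ⊗ N)) (freeTensor A X N) :=
  (rgt_whiskerRight _ _).comp (rel_rgt (freeMod A X) N)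

/-- Moving the coefficient: `(a ⊗ x) ⊗ n ↦ x ⊗ a n`. -/
theorem exists_freeTensor_inv (X : C) (N : Mod C A) :
    ∃ g : (freeMod A X ⊗ N : Mod C A).X ⟶ X ⊗ N.X,
      tm (freeMod A X) N ≫ g = (α_ A X N.X).hom ≫ rgt X (act N) := by
  have e : (α_ A X N.X).hom ≫ rgt X (act N) =
      ((β_ A X).hom ▷ N.X) ≫ (α_ X A N.X).hom ≫ (X ◁ act N) := by
    unfold rgt
    simp
  rw [e]
  have h₁ : Lin (lft (lft μ[A] X) N.X) (rgt X (act N))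
      (((β_ A X).hom ▷ N.X) ≫ (α_ X A N.X).hom ≫ (X ◁ act N)) :=
    ((lft_braiding _ _).lft_whiskerRight _).comp ((lft_rgt_assoc _ _ _).comp
      ((mul_lin_lft N).rgt_whiskerLeft X))
  have h₂ : Lin (rgt (A ⊗ X) (act N)) (rgt X (act N))
      (((β_ A X).hom ▷ N.X) ≫ (α_ X A N.X).hom ≫ (X ◁ act N)) :=
    (rgt_whiskerRight _ _).comp ((rgt_rgt_assoc _ _ _).comp ((lin_act N).rgt_whiskerLeft X))
  exact ⟨relDesc (M := freeMod A X) (N := N) _ (h₁.trans h₂.symm), relπ_desc _ _⟩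

/-- Up to the symmetry, `(1 ⊗ x) ⊗ a n = a (1 ⊗ x) ⊗ n = (a ⊗ x) ⊗ n`. This is one half of the
invertibility of `freeTensor`. -/
theorem assoc_rgt_freeTensor (X : C) (N : Mod C A) :
    (α_ A X N.X).hom ≫ rgt X (act N) ≫ freeTensor A X N = tm (freeMod A X) N := by
  have h := lin_freeTensor A X N
  have h' : Lin (lft (lft μ[A] X) N.X) (act (freeMod A X ⊗ N)) (tm (freeMod A X) N) :=
    rel_lft (freeMod A X) N
  unfold Lin at h h'
  rw [h]
  unfold freeTensor
  rw [whiskerLeft_comp, assoc]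
  refine (congrArg (fun t => (α_ A X N.X).hom ≫ (A ◁ freeUnit A X ▷ N.X) ≫ t) h').symm.trans ?_
  have e : (α_ A X N.X).hom ≫ (A ◁ freeUnit A X ▷ N.X) ≫ lft (lft μ[A] X) N.X = 𝟙 _ := by
    unfold lft
    rw [associator_inv_naturality_middle_assoc, Iso.hom_inv_id_assoc, ← comp_whiskerRight]
    have := whiskerLeft_freeUnit_lft A X
    unfold lft at this
    rw [this, id_whiskerRight]
  exact (by simp only [assoc] : _ = ((α_ A X N.X).hom ≫ (A ◁ freeUnit A X ▷ N.X) ≫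
    lft (lft μ[A] X) N.X) ≫ tm (freeMod A X) N).trans (by rw [e, id_comp])

/-- Base change: `(A ⊗ X) ⊗_A N` is `X ⊗ N`. This reduces questions about generators of the category
of modules to tensor products in the base category. -/
instance isIso_freeTensor (X : C) (N : Mod C A) : IsIso (freeTensor A X N) := by
  obtain ⟨g, hg⟩ := exists_freeTensor_inv A X N
  refine ⟨g, ?_, ?_⟩
  · unfold freeTensor
    refine (assoc _ _ _).trans ((congrArg (_ ≫ ·) hg).trans ?_)
    unfold rgt freeUnit
    rw [Iso.hom_inv_id_assoc, ← comp_whiskerRight_assoc, assoc,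
      BraidedCategory.braiding_naturality_left, comp_whiskerRight, assoc, comp_whiskerRight, assoc,
      associator_naturality_middle_assoc, ← whiskerLeft_comp, act_one]
    simp
  · rw [← cancel_epi (tm (freeMod A X) N), reassoc_of% hg, assoc_rgt_freeTensor, comp_id]

theorem freeTensor_whiskerRight {X Y : C} (f : X ⟶ Y) (N : Mod C A) :
    freeTensor A X N ≫ ((freeFunctor A).map f ▷ N).hom = (f ▷ N.X) ≫ freeTensor A Y N := by
  unfold freeTensor
  refine (assoc _ _ _).trans ((congrArg (_ ≫ ·)
    (tm_whiskerRight (N := N) ((freeFunctor A).map f))).trans ?_)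
  change (freeUnit A X ▷ N.X) ≫ ((A ◁ f) ▷ N.X) ≫ tm (freeMod A Y) N = _
  rw [← comp_whiskerRight_assoc, ← freeUnit_naturality, comp_whiskerRight, assoc]

theorem freeTensor_whiskerLeft (X : C) {N N' : Mod C A} (f : N ⟶ N') :
    freeTensor A X N ≫ ((freeFunctor A).obj X ◁ f).hom = (X ◁ f.hom) ≫ freeTensor A X N' := by
  unfold freeTensor
  refine (assoc _ _ _).trans ((congrArg (_ ≫ ·)
    (tm_whiskerLeft (M := freeMod A X) f)).trans ?_)
  change (freeUnit A X ▷ N.X) ≫ ((A ⊗ X) ◁ f.hom) ≫ _ = _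
  rw [whisker_exchange_assoc]

/-- The universal bilinear map on two objects with values in the tensor product over `A` of the
free modules. -/
def freeTm (X Y : C) : X ⊗ Y ⟶ (freeMod A X ⊗ freeMod A Y : Mod C A).X :=
  (X ◁ freeUnit A Y) ≫ freeTensor A X (freeMod A Y)

theorem freeTm_whiskerRight {X X' : C} (f : X ⟶ X') (Y : C) :
    freeTm A X Y ≫ ((freeFunctor A).map f ▷ (freeFunctor A).obj Y).hom =
      (f ▷ Y) ≫ freeTm A X' Y := by
  unfold freeTm
  refine (assoc _ _ _).trans ((congrArg ((X ◁ freeUnit A Y) ≫ ·)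
    (freeTensor_whiskerRight A f (freeMod A Y))).trans ?_)
  change (X ◁ freeUnit A Y) ≫ (f ▷ (A ⊗ Y)) ≫ freeTensor A X' (freeMod A Y) = _
  rw [whisker_exchange_assoc]

theorem freeTm_whiskerLeft (X : C) {Y Y' : C} (f : Y ⟶ Y') :
    freeTm A X Y ≫ ((freeFunctor A).obj X ◁ (freeFunctor A).map f).hom =
      (X ◁ f) ≫ freeTm A X Y' := by
  unfold freeTm
  refine (assoc _ _ _).trans ((congrArg (_ ≫ ·)
    (freeTensor_whiskerLeft A X ((freeFunctor A).map f))).trans ?_)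
  change (X ◁ freeUnit A Y) ≫ (X ◁ (A ◁ f)) ≫ freeTensor A X (freeMod A Y') = _
  rw [← whiskerLeft_comp_assoc, ← freeUnit_naturality, whiskerLeft_comp, assoc]

/-- Moving the coefficient to the front: `x ⊗ (a ⊗ y) ↦ a ⊗ (x ⊗ y)`. -/
def pullScalar (X Y : C) : X ⊗ (A ⊗ Y) ⟶ A ⊗ (X ⊗ Y) :=
  (α_ X A Y).inv ≫ ((β_ X A).hom ▷ Y) ≫ (α_ A X Y).hom

theorem lin_pullScalar (X Y : C) :
    Lin (rgt X (lft μ[A] Y)) (lft μ[A] (X ⊗ Y)) (pullScalar A X Y) :=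
  ((lft_rgt_assoc _ _ _).inv (α_ _ _ _)).comp (((rgt_braiding _ _).lft_whiskerRight _).comp
    (lft_lft_assoc _ _ _))

theorem freeUnit_pullScalar (X Y : C) :
    (X ◁ freeUnit A Y) ≫ pullScalar A X Y = freeUnit A (X ⊗ Y) := by
  unfold freeUnit pullScalar
  rw [whiskerLeft_comp, assoc, associator_inv_naturality_middle_assoc,
    ← comp_whiskerRight_assoc, BraidedCategory.braiding_naturality_right, comp_whiskerRight, assoc,
    associator_naturality_left]
  simp

theorem pullScalar_rgt (X Y : C) :
    pullScalar A X Y ≫ (A ◁ (X ◁ freeUnit A Y)) ≫ rgt X (lft μ[A] Y) = 𝟙 _ := by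
  unfold pullScalar rgt
  rw [associator_inv_naturality_right_assoc, whisker_exchange_assoc,
    associator_naturality_right_assoc, ← whiskerLeft_comp, whiskerLeft_freeUnit_lft]
  simp only [assoc, Iso.hom_inv_id_assoc]
  rw [← comp_whiskerRight_assoc, SymmetricCategory.symmetry]
  simp

/-- With the next lemma: the tensor product over `A` of two free modules is free on `X ⊗ Y`. The
extension of `f` is `x ⊗ (a ⊗ y) ↦ a f(x ⊗ y)`, up to the symmetry, read through `freeTensor`. -/
theorem freeTm_desc {X Y : C} {E : Mod C A} (f : X ⊗ Y ⟶ E.X) :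
    ∃ g : (freeFunctor A).obj X ⊗ (freeFunctor A).obj Y ⟶ E, freeTm A X Y ≫ g.hom = f := by
  have hh : Lin (rgt X (lft μ[A] Y)) (act E) (pullScalar A X Y ≫ (A ◁ f) ≫ act E) :=
    (lin_pullScalar A X Y).comp ((lft_whiskerLeft _ _).comp (mul_lin_lft E))
  have hl : Lin (act (freeMod A X ⊗ freeMod A Y)) (act E)
      (inv (freeTensor A X (freeMod A Y)) ≫ pullScalar A X Y ≫ (A ◁ f) ≫ act E) :=
    (lin_freeTensor A X (freeMod A Y)).of_epi (by rw [IsIso.hom_inv_id_assoc]; exact hh)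
  refine ⟨homOfLin _ hl, ?_⟩
  unfold freeTm
  refine (assoc _ _ _).trans ?_
  refine (congrArg (_ ≫ ·) (IsIso.hom_inv_id_assoc _ _)).trans ?_
  rw [reassoc_of% freeUnit_pullScalar A X Y, ← reassoc_of% freeUnit_naturality,
    freeUnit_act, comp_id]

theorem freeTm_ext {X Y : C} {E : Mod C A}
    {f g : (freeFunctor A).obj X ⊗ (freeFunctor A).obj Y ⟶ E}
    (h : freeTm A X Y ≫ f.hom = freeTm A X Y ≫ g.hom) : f = g := by
  -- A linear map is recovered from its values at `x ⊗ (1 ⊗ y)` by pulling the scalar to the front.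
  have key (f : (freeFunctor A).obj X ⊗ (freeFunctor A).obj Y ⟶ E) :
      freeTensor A X (freeMod A Y) ≫ f.hom =
        pullScalar A X Y ≫ (A ◁ (freeTm A X Y ≫ f.hom)) ≫ act E := by
    have hf : Lin (rgt X (lft μ[A] Y)) (act E) (freeTensor A X (freeMod A Y) ≫ f.hom) :=
      (lin_freeTensor A X (freeMod A Y)).comp (lin_hom f)
    unfold Lin at hf
    have e : freeTm A X Y ≫ f.hom = (X ◁ freeUnit A Y) ≫ freeTensor A X (freeMod A Y) ≫ f.hom :=
      assoc _ _ _
    rw [e, whiskerLeft_comp, assoc, ← hf, reassoc_of% pullScalar_rgt A X Y]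
  apply Mod.hom_ext
  exact (cancel_epi (freeTensor A X (freeMod A Y))).1 ((key f).trans
    ((congrArg (fun t => pullScalar A X Y ≫ (A ◁ t) ≫ act E) h).trans (key g).symm))

end FreeTensor

/-! ### Tensor products of `D`-modules and colimits -/

section TensorColimitsD

variable {k O : Type u} [Field k] [CommRing O] [Algebra k O]

instance resO_reflectsIsomorphisms : (resO k O).ReflectsIsomorphisms where
  reflects {M N} f hf := by
    have : IsIso ((forget (ModuleCat.{u} O)).map ((resO k O).map f)) := inferInstance
    have h : Function.Bijective f := (isIso_iff_bijective _).1 this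
    exact (ConcreteCategory.isIso_iff_bijective f).2 h

variable [CharZero k] [Algebra.Smooth k O]

/-- Restriction to `O` is monoidal, preserves colimits and reflects them, and the tensor product of
`O`-modules preserves them. -/
instance tensorLeft_preservesColimitsD (M : DCat k O) : PreservesColimits (tensorLeft M) := by
  have : PreservesColimits (tensorLeft M ⋙ resO k O) :=
    preservesColimits_of_natIso (Functor.Monoidal.commTensorLeft (resO k O) M)
  have : ReflectsColimits (resO k O) := reflectsColimits_of_reflectsIsomorphisms
  exact preservesColimits_of_reflects_of_preserves (tensorLeft M) (resO k O)

end TensorColimitsD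

/-! ### Tensor products of complexes and colimits -/

section TensorColimits

open Category

universe v w

variable {C : Type w} [Category.{v} C] [Preadditive C] [MonoidalCategory C] [MonoidalPreadditive C]
  [HasFiniteCoproducts C] [HasZeroObject C] [SymmetricCategory C]

/-- The morphism out of a degree of the tensor product given by its components. -/
def cdesc {K L : ChainComplex C ℕ} {i : ℕ} {Y : C}
    (f : ∀ p q (_ : p + q = i), K.X p ⊗ L.X q ⟶ Y) : (K ⊗ L : ChainComplex C ℕ).X i ⟶ Y :=
  HomologicalComplex.mapBifunctorDesc (K₁ := K) (K₂ := L) (F := curriedTensor C) f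

theorem cι_desc {K L : ChainComplex C ℕ} {i : ℕ} {Y : C}
    (f : ∀ p q (_ : p + q = i), K.X p ⊗ L.X q ⟶ Y) (p q : ℕ) (h : p + q = i) :
    cι K L p q i h ≫ cdesc f = f p q h :=
  HomologicalComplex.ι_mapBifunctorDesc (K₁ := K) (K₂ := L) (F := curriedTensor C)
    (c := ComplexShape.down ℕ) (j := i) f p q h

theorem cι_tensorHom {K K' L L' : ChainComplex C ℕ} (f : K ⟶ K') (g : L ⟶ L') (p q i : ℕ)
    (h : p + q = i) :
    cι K L p q i h ≫ (f ⊗ₘ g : K ⊗ L ⟶ K' ⊗ L').f i = (f.f p ⊗ₘ g.f q) ≫ cι K' L' p q i h := by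
  rw [MonoidalCategory.tensorHom_def (f.f p), assoc]
  exact HomologicalComplex.ι_mapBifunctorMap f g (curriedTensor C) (ComplexShape.down ℕ) p q i h

theorem cι_whiskerLeft (K : ChainComplex C ℕ) {L L' : ChainComplex C ℕ} (g : L ⟶ L') (p q i : ℕ)
    (h : p + q = i) :
    cι K L p q i h ≫ (K ◁ g : K ⊗ L ⟶ K ⊗ L').f i = (K.X p ◁ g.f q) ≫ cι K L' p q i h := by
  rw [← id_tensorHom, cι_tensorHom, HomologicalComplex.id_f, id_tensorHom]

theorem cι_whiskerLeft_assoc (K : ChainComplex C ℕ) {L L' : ChainComplex C ℕ} (g : L ⟶ L')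
    (p q i : ℕ) (h : p + q = i) {Z : C} (t : (K ⊗ L' : ChainComplex C ℕ).X i ⟶ Z) :
    cι K L p q i h ≫ (K ◁ g : K ⊗ L ⟶ K ⊗ L').f i ≫ t =
      (K.X p ◁ g.f q) ≫ cι K L' p q i h ≫ t := by
  simpa only [assoc] using cι_whiskerLeft K g p q i h =≫ t

theorem cι_whiskerRight {K K' : ChainComplex C ℕ} (f : K ⟶ K') (L : ChainComplex C ℕ) (p q i : ℕ)
    (h : p + q = i) :
    cι K L p q i h ≫ (f ▷ L : K ⊗ L ⟶ K' ⊗ L).f i = (f.f p ▷ L.X q) ≫ cι K' L p q i h := by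
  rw [← tensorHom_id, cι_tensorHom, HomologicalComplex.id_f, tensorHom_id]

theorem cι_whiskerRight_assoc {K K' : ChainComplex C ℕ} (f : K ⟶ K') (L : ChainComplex C ℕ)
    (p q i : ℕ) (h : p + q = i) {Z : C} (t : (K' ⊗ L : ChainComplex C ℕ).X i ⟶ Z) :
    cι K L p q i h ≫ (f ▷ L : K ⊗ L ⟶ K' ⊗ L).f i ≫ t =
      (f.f p ▷ L.X q) ≫ cι K' L p q i h ≫ t := by
  simpa only [assoc] using cι_whiskerRight f L p q i h =≫ t

variable [∀ X : C, PreservesColimits (tensorLeft X)] [HasColimits C]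

/-- Colimits of complexes are computed degreewise, and degree `i` of a tensor product is the sum of
the `K_p ⊗ L_q` with `p + q = i`; each summand preserves colimits in `L`. -/
theorem tensorLeft_preservesColimits_chainComplex (K : ChainComplex C ℕ) :
    PreservesColimits (tensorLeft K) where
  preservesColimitsOfShape {J _} := {
    preservesColimit {F} := ⟨fun {c} hc => ⟨by
      refine HomologicalComplex.isColimitOfEval _ _ fun i => ?_
      let hq (p q : ℕ) : IsColimit (((HomologicalComplex.eval C (ComplexShape.down ℕ) q) ⋙
          tensorLeft (K.X p)).mapCocone c) := isColimitOfPreserves _ hc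
      let D (s : Cocone ((F ⋙ tensorLeft K) ⋙ HomologicalComplex.eval C (ComplexShape.down ℕ) i))
          (p q : ℕ) (h : p + q = i) : K.X p ⊗ c.pt.X q ⟶ s.pt :=
        (hq p q).desc ⟨s.pt, {
          app j := cι K (F.obj j) p q i h ≫ s.ι.app j
          naturality j j' φ := by
            exact ((cι_whiskerLeft_assoc K (F.map φ) p q i h (s.ι.app j')).symm.trans
              (congrArg (_ ≫ ·) (s.w φ))).trans (comp_id _).symm }⟩
      have hD s (p q : ℕ) (h : p + q = i) (j : J) :
          (K.X p ◁ (c.ι.app j).f q) ≫ D s p q h = cι K (F.obj j) p q i h ≫ s.ι.app j :=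
        (hq p q).fac _ j
      exact {
        desc s := cdesc (D s)
        fac s j := by
          apply cι_ext
          intro p q h
          exact (cι_whiskerLeft_assoc K (c.ι.app j) p q i h (cdesc (D s))).trans
            ((congrArg (_ ≫ ·) (cι_desc (D s) p q h)).trans (hD s p q h j))
        uniq s m hm := by
          apply cι_ext
          intro p q h
          rw [cι_desc]
          refine (hq p q).hom_ext fun j => ?_
          exact (cι_whiskerLeft_assoc K (c.ι.app j) p q i h m).symm.trans
            ((congrArg (_ ≫ ·) (hm j)).trans (hD s p q h j).symm) }⟩⟩ }

end TensorColimits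

section DGDMColimits

variable {k O : Type u} [Field k] [CommRing O] [Algebra k O] [CharZero k] [Algebra.Smooth k O]

instance tensorLeft_preservesColimits (K : DGDM k O) : PreservesColimits (tensorLeft K) :=
  tensorLeft_preservesColimits_chainComplex (C := DCat k O) K

end DGDMColimits

/-! ### Quasi-isomorphisms and trivial fibrations in terms of elements -/

section Elements

variable {R : Type u} [Ring R] {X Y : ChainComplex (ModuleCat.{u} R) ℕ}

/-- `z` is a cycle. -/
def IsCyc (X : ChainComplex (ModuleCat.{u} R) ℕ) (n : ℕ) (z : X.X n) : Prop := ∀ j, X.d n j z = 0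

/-- `z` is a boundary. -/
def IsBdry (X : ChainComplex (ModuleCat.{u} R) ℕ) (n : ℕ) (z : X.X n) : Prop :=
  ∃ e, X.d (n + 1) n e = z

theorem d_d_apply (X : ChainComplex (ModuleCat.{u} R) ℕ) (i j l : ℕ) (x : X.X i) :
    X.d j l (X.d i j x) = 0 := by
  rw [← ConcreteCategory.comp_apply, X.d_comp_d]; rfl

theorem f_d_apply (f : X ⟶ Y) (i j : ℕ) (x : X.X i) : f.f j (X.d i j x) = Y.d i j (f.f i x) := by
  rw [← ConcreteCategory.comp_apply, ← ConcreteCategory.comp_apply, f.comm]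

theorem f_f_apply {Z : ChainComplex (ModuleCat.{u} R) ℕ} {f : X ⟶ Y} {g : Y ⟶ Z} {h : X ⟶ Z}
    (w : f ≫ g = h) (n : ℕ) (x : X.X n) : g.f n (f.f n x) = h.f n x := by
  rw [← w]; rfl

theorem isCyc_zero (z : X.X 0) : IsCyc X 0 z := fun j => by
  rw [X.shape 0 j (by simp)]; rfl

theorem isCyc_succ {n : ℕ} {z : X.X (n + 1)} (h : X.d (n + 1) n z = 0) : IsCyc X (n + 1) z :=
  fun j => by
  by_cases hj : j = n
  · subst hj; exact h
  · rw [X.shape (n + 1) j (by simp; omega)]; rfl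

theorem isCyc_d (i j : ℕ) (x : X.X i) : IsCyc X j (X.d i j x) := fun l => d_d_apply X i j l x

theorem IsCyc.map (f : X ⟶ Y) {n : ℕ} {z : X.X n} (h : IsCyc X n z) : IsCyc Y n (f.f n z) :=
  fun j => by rw [← f_d_apply, h j, map_zero]

theorem exists_iCycles {n : ℕ} {z : X.X n} (h : IsCyc X n z) : ∃ c, X.iCycles n c = z :=
  ⟨(X.sc n).moduleCatCyclesIso.inv ⟨z, h _⟩,
    ConcreteCategory.congr_hom (X.sc n).moduleCatCyclesIso_inv_iCycles ⟨z, h _⟩⟩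

theorem isCyc_iCycles {n : ℕ} (c : X.cycles n) : IsCyc X n (X.iCycles n c) := fun j => by
  rw [← ConcreteCategory.comp_apply, X.iCycles_d]; rfl

theorem iCycles_injective (n : ℕ) : Function.Injective (X.iCycles n) :=
  (ModuleCat.mono_iff_injective _).1 inferInstance

theorem homologyπ_surjective (n : ℕ) : Function.Surjective (X.homologyπ n) :=
  (ModuleCat.epi_iff_surjective _).1 inferInstance

theorem homologyπ_eq_zero_iff {n : ℕ} (c : X.cycles n) :
    X.homologyπ n c = 0 ↔ IsBdry X n (X.iCycles n c) := by
  have hp : (ComplexShape.down ℕ).prev n = n + 1 := by simp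
  have ex : (ShortComplex.mk _ _ (X.toCycles_comp_homologyπ (n + 1) n)).Exact :=
    ShortComplex.exact_of_g_is_cokernel _ (X.homologyIsCokernel (n + 1) n hp)
  constructor
  · intro h
    obtain ⟨e, he⟩ := (ShortComplex.moduleCat_exact_iff _).1 ex c h
    refine ⟨e, ?_⟩
    rw [← X.toCycles_i (n + 1) n, ConcreteCategory.comp_apply]
    exact congrArg _ he
  · rintro ⟨e, he⟩
    have : X.toCycles (n + 1) n e = c := iCycles_injective n (by
      rw [← he, ← X.toCycles_i (n + 1) n, ConcreteCategory.comp_apply])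
    rw [← this, ← ConcreteCategory.comp_apply, X.toCycles_comp_homologyπ]; rfl

/-- The two clauses are injectivity and surjectivity on homology. All later arguments about homology
are diagram chases through this criterion. -/
theorem quasiIsoAt_iff_elements (f : X ⟶ Y) (n : ℕ) : QuasiIsoAt f n ↔
    (∀ z, IsCyc X n z → IsBdry Y n (f.f n z) → IsBdry X n z) ∧
      ∀ y, IsCyc Y n y → ∃ z, IsCyc X n z ∧ IsBdry Y n (y - f.f n z) := by
  rw [quasiIsoAt_iff_isIso_homologyMap, ConcreteCategory.isIso_iff_bijective]
  have nat (c : X.cycles n) : HomologicalComplex.homologyMap f n (X.homologyπ n c) =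
      Y.homologyπ n (HomologicalComplex.cyclesMap f n c) := by
    rw [← ConcreteCategory.comp_apply, ← ConcreteCategory.comp_apply,
      HomologicalComplex.homologyπ_naturality]
  have nati (c : X.cycles n) : Y.iCycles n (HomologicalComplex.cyclesMap f n c) =
      f.f n (X.iCycles n c) := by
    rw [← ConcreteCategory.comp_apply, ← ConcreteCategory.comp_apply,
      HomologicalComplex.cyclesMap_i]
  refine and_congr ?_ ?_
  · change Function.Injective (HomologicalComplex.homologyMap f n).hom ↔ _
    rw [injective_iff_map_eq_zero]
    constructor
    · intro h z hz hb
      obtain ⟨c, rfl⟩ := exists_iCycles hz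
      refine (homologyπ_eq_zero_iff c).1 (h _ ((nat c).trans ((homologyπ_eq_zero_iff _).2 ?_)))
      rwa [nati]
    · intro h x hx
      obtain ⟨c, rfl⟩ := homologyπ_surjective n x
      refine (homologyπ_eq_zero_iff c).2 (h _ (isCyc_iCycles c) ?_)
      rw [← nati]
      exact (homologyπ_eq_zero_iff _).1 ((nat c).symm.trans hx)
  · constructor
    · intro h y hy
      obtain ⟨c, rfl⟩ := exists_iCycles hy
      obtain ⟨x, hx⟩ := h (Y.homologyπ n c)
      obtain ⟨b, rfl⟩ := homologyπ_surjective n x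
      refine ⟨X.iCycles n b, isCyc_iCycles b, ?_⟩
      rw [← nati, ← map_sub]
      refine (homologyπ_eq_zero_iff _).1 ?_
      rw [map_sub, sub_eq_zero, ← nat]
      exact hx.symm
    · intro h y
      obtain ⟨c, rfl⟩ := homologyπ_surjective n y
      obtain ⟨z, hz, hb⟩ := h _ (isCyc_iCycles c)
      obtain ⟨b, rfl⟩ := exists_iCycles hz
      refine ⟨X.homologyπ n b, (nat b).trans ?_⟩
      rw [← nati, ← map_sub] at hb
      have := (homologyπ_eq_zero_iff _).2 hb
      rw [map_sub, sub_eq_zero] at this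
      exact this.symm

theorem exactAt_iff_elements (n : ℕ) : X.ExactAt n ↔ ∀ z, IsCyc X n z → IsBdry X n z := by
  rw [HomologicalComplex.exactAt_iff_isZero_homology]
  constructor
  · intro h z hz
    obtain ⟨c, rfl⟩ := exists_iCycles hz
    exact (homologyπ_eq_zero_iff c).1
      (@Subsingleton.elim _ (ModuleCat.subsingleton_of_isZero h) _ _)
  · intro h
    refine @ModuleCat.isZero_of_subsingleton _ _ _ ⟨fun x y => ?_⟩
    obtain ⟨c, rfl⟩ := homologyπ_surjective n x
    obtain ⟨cY, rfl⟩ := homologyπ_surjective n y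
    rw [(homologyπ_eq_zero_iff c).2 (h _ (isCyc_iCycles c)),
      (homologyπ_eq_zero_iff cY).2 (h _ (isCyc_iCycles cY))]

/-- A chain map that is surjective in positive degrees is a surjective quasi-isomorphism if and
only if it has the lifting properties against the inclusions of spheres in discs. -/
theorem surjective_quasiIso_iff (p : X ⟶ Y) :
    ((∀ n, 0 < n → Function.Surjective (p.f n)) ∧ QuasiIso p) ↔
      Function.Surjective (p.f 0) ∧ ∀ n (z : X.X n) (b : Y.X (n + 1)), IsCyc X n z →
        Y.d (n + 1) n b = p.f n z → ∃ e, X.d (n + 1) n e = z ∧ p.f (n + 1) e = b := by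
  constructor
  · rintro ⟨hs, hq⟩
    have hq' n := (quasiIsoAt_iff_elements p n).1 inferInstance
    -- Cycles lift to cycles exactly: a cycle that lifts `y` up to the boundary of `b` is corrected
    -- by the boundary of a lift of `b`. In degree 0 every element is a cycle, which gives
    -- surjectivity there.
    have hz n (y : Y.X n) (hy : IsCyc Y n y) : ∃ z, IsCyc X n z ∧ p.f n z = y := by
      obtain ⟨z, hz, b, hb⟩ := (hq' n).2 y hy
      obtain ⟨e, he⟩ := hs (n + 1) n.succ_pos b
      refine ⟨z + X.d (n + 1) n e, fun j => ?_, ?_⟩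
      · rw [map_add, hz j, d_d_apply, zero_add]
      · rw [map_add, f_d_apply, he, hb, add_sub_cancel]
    refine ⟨fun y => (hz 0 y (isCyc_zero y)).imp fun z h => h.2, fun n z b hzc hb => ?_⟩
    obtain ⟨e₀, he₀⟩ := (hq' n).1 z hzc ⟨b, hb⟩
    -- A primitive `e₀` of `z` maps to `b` up to a cycle; lifting this cycle to a cycle corrects
    -- `e₀` without changing its boundary.
    have hc : IsCyc Y (n + 1) (b - p.f (n + 1) e₀) := isCyc_succ (by
      rw [map_sub, hb, ← f_d_apply, he₀, sub_self])
    obtain ⟨w, hw, hw'⟩ := hz (n + 1) _ hc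
    exact ⟨e₀ + w, by rw [map_add, he₀, hw n, add_zero], by rw [map_add, hw', add_sub_cancel]⟩
  · rintro ⟨h0, hl⟩
    have hz n (y : Y.X n) (hy : IsCyc Y n y) : ∃ z, IsCyc X n z ∧ p.f n z = y := by
      cases n with
      | zero => obtain ⟨z, hz⟩ := h0 y; exact ⟨z, isCyc_zero z, hz⟩
      | succ n =>
        -- With zero as prescribed boundary, the lifting property yields a cycle over `y`.
        obtain ⟨e, he, he'⟩ := hl n 0 y (fun j => map_zero _) ((hy n).trans (map_zero _).symm)
        exact ⟨e, isCyc_succ he, he'⟩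
    refine ⟨fun n hn y => ?_, ⟨fun n => (quasiIsoAt_iff_elements p n).2 ⟨?_, ?_⟩⟩⟩
    · obtain ⟨n, rfl⟩ := Nat.exists_eq_succ_of_ne_zero hn.ne'
      obtain ⟨z, hz, hz'⟩ := hz n (Y.d (n + 1) n y) (isCyc_d _ _ _)
      obtain ⟨e, -, he⟩ := hl n z y hz hz'.symm
      exact ⟨e, he⟩
    · rintro z hz ⟨b, hb⟩
      obtain ⟨e, he, -⟩ := hl n z b hz hb
      exact ⟨e, he⟩
    · intro y hy
      obtain ⟨z, hz, hz'⟩ := hz n y hy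
      exact ⟨z, hz, 0, by rw [map_zero, hz', sub_self]⟩

end Elements

/-! ### Lifting against spheres and discs -/

section Generators

open HomologicalComplex ZeroObject

variable (k O : Type u) [Field k] [CommRing O] [Algebra k O]

/-- The generator of the sphere. -/
def sphereGen (n : ℕ) : (sphere k O n).X n :=
  (singleObjXSelf (ComplexShape.down ℕ) n (regD k O)).inv (1 : DRing k O)

/-- The generator of the disc. -/
def discGen (n : ℕ) : (disc k O n).X (n + 1) :=
  (doubleXIso₀ (𝟙 (regD k O))
    (show (ComplexShape.down ℕ).Rel (n + 1) n from rfl)).inv (1 : DRing k O)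

variable {k O}

theorem regD_hom_ext {M : DCat k O} {f g : regD k O ⟶ M}
    (h : f (1 : DRing k O) = g (1 : DRing k O)) : f = g := by
  ext; exact h

/-- The map from the free module of rank one given by an element. -/
def regHom {M : DCat k O} (m : M) : regD k O ⟶ M :=
  ModuleCat.ofHom (LinearMap.toSpanSingleton _ _ m)

theorem regHom_one {M : DCat k O} (m : M) : regHom m (1 : DRing k O) = m := one_smul _ m

theorem isCyc_sphereGen (n : ℕ) : IsCyc (sphere k O n) n (sphereGen k O n) := fun j => by
  have : (sphere k O n).d n j = 0 := single_obj_d ..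
  rw [this]; rfl

theorem sphere_hom_ext {X : DGDM k O} {n : ℕ} {f g : sphere k O n ⟶ X}
    (h : f.f n (sphereGen k O n) = g.f n (sphereGen k O n)) : f = g := by
  apply from_single_hom_ext
  rw [← cancel_epi (singleObjXSelf (ComplexShape.down ℕ) n (regD k O)).inv]
  exact regD_hom_ext h

/-- A map out of the free module of rank one is the choice of an element, and compatibility with the
differentials is the cycle condition. So spheres corepresent cycles, as discs corepresent elements.
-/
theorem exists_sphere_hom {X : DGDM k O} {n : ℕ} {z : X.X n} (hz : IsCyc X n z) :
    ∃ f : sphere k O n ⟶ X, f.f n (sphereGen k O n) = z := by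
  refine ⟨mkHomFromSingle (regHom z) fun j _ => regD_hom_ext ?_, ?_⟩
  · rw [ConcreteCategory.comp_apply, regHom_one]; exact hz j
  · rw [mkHomFromSingle_f]
    refine Eq.trans ?_ (regHom_one z)
    refine congrArg (regHom z) ?_
    exact ConcreteCategory.congr_hom (singleObjXSelf (ComplexShape.down ℕ) n (regD k O)).inv_hom_id
      (1 : DRing k O)

theorem disc_hom_ext {X : DGDM k O} {n : ℕ} {f g : disc k O n ⟶ X}
    (h : f.f (n + 1) (discGen k O n) = g.f (n + 1) (discGen k O n)) : f = g :=
  (evalCompCoyonedaCorepresentableByDoubleId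
    (show (ComplexShape.down ℕ).Rel (n + 1) n from rfl) (by simp) (regD k O)).homEquiv.injective
      (regD_hom_ext h)

theorem exists_disc_hom {X : DGDM k O} {n : ℕ} (x : X.X (n + 1)) :
    ∃ f : disc k O n ⟶ X, f.f (n + 1) (discGen k O n) = x := by
  obtain ⟨f, hf⟩ := (evalCompCoyonedaCorepresentableByDoubleId
    (show (ComplexShape.down ℕ).Rel (n + 1) n from rfl) (by simp) (regD k O)).homEquiv.surjective
      (regHom x : regD k O ⟶ X.X (n + 1))
  exact ⟨f, (ConcreteCategory.congr_hom hf (1 : DRing k O)).trans (regHom_one x)⟩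

theorem sphereToDisc_gen (n : ℕ) : (sphereToDisc k O n).f n (sphereGen k O n) =
    (disc k O n).d (n + 1) n (discGen k O n) := by
  have h₁ : (sphereToDisc k O n).f n = _ := mkHomFromSingle_f _ _
  have h₂ : (disc k O n).d (n + 1) n = _ := double_d _ _ (by simp)
  rw [h₁, h₂]
  simp only [sphereGen, discGen]
  rw [Category.id_comp]
  refine congrArg (doubleXIso₁ (𝟙 (regD k O))
    (show (ComplexShape.down ℕ).Rel (n + 1) n from rfl) (by simp)).inv ?_
  exact (ConcreteCategory.congr_hom (singleObjXSelf (ComplexShape.down ℕ) n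
    (regD k O)).inv_hom_id (1 : DRing k O)).trans (ConcreteCategory.congr_hom (doubleXIso₀
      (𝟙 (regD k O)) (show (ComplexShape.down ℕ).Rel (n + 1) n from rfl)).inv_hom_id
        (1 : DRing k O)).symm

theorem hasLiftingProperty_zero_disc_iff {X Y : DGDM k O} (p : X ⟶ Y) (n : ℕ) :
    HasLiftingProperty (0 : (0 : DGDM k O) ⟶ disc k O n) p ↔
      Function.Surjective (p.f (n + 1)) := by
  constructor
  · intro h y
    obtain ⟨f, hf⟩ := exists_disc_hom y
    have sq : CommSq 0 (0 : (0 : DGDM k O) ⟶ disc k O n) p f := ⟨by simp⟩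
    refine ⟨sq.lift.f (n + 1) (discGen k O n), ?_⟩
    rw [← hf]
    exact f_f_apply sq.fac_right _ _
  · intro h
    refine ⟨fun {f g} sq => ?_⟩
    obtain ⟨x, hx⟩ := h (g.f (n + 1) (discGen k O n))
    obtain ⟨l, hl⟩ := exists_disc_hom x
    exact ⟨⟨l, (isZero_zero _).eq_of_src _ _, disc_hom_ext (by rw [← hx, ← hl]; rfl)⟩⟩

theorem hasLiftingProperty_zero_sphere_iff {X Y : DGDM k O} (p : X ⟶ Y) :
    HasLiftingProperty (0 : (0 : DGDM k O) ⟶ sphere k O 0) p ↔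
      Function.Surjective (p.f 0) := by
  constructor
  · intro h y
    obtain ⟨f, hf⟩ := exists_sphere_hom (isCyc_zero y)
    have sq : CommSq 0 (0 : (0 : DGDM k O) ⟶ sphere k O 0) p f := ⟨by simp⟩
    refine ⟨sq.lift.f 0 (sphereGen k O 0), ?_⟩
    rw [← hf]
    exact f_f_apply sq.fac_right _ _
  · intro h
    refine ⟨fun {f g} sq => ?_⟩
    obtain ⟨x, hx⟩ := h (g.f 0 (sphereGen k O 0))
    obtain ⟨l, hl⟩ := exists_sphere_hom (isCyc_zero x)
    exact ⟨⟨l, (isZero_zero _).eq_of_src _ _, sphere_hom_ext (by rw [← hx, ← hl]; rfl)⟩⟩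

/-- A square is a cycle `z` with a primitive `b` of its image, and a diagonal is a primitive of `z`
over `b`. -/
theorem hasLiftingProperty_sphereToDisc_iff {X Y : DGDM k O} (p : X ⟶ Y) (n : ℕ) :
    HasLiftingProperty (sphereToDisc k O n) p ↔
      ∀ (z : X.X n) (b : Y.X (n + 1)), IsCyc X n z → Y.d (n + 1) n b = p.f n z →
        ∃ e, X.d (n + 1) n e = z ∧ p.f (n + 1) e = b := by
  constructor
  · intro h z b hz hb
    obtain ⟨f, hf⟩ := exists_sphere_hom hz
    obtain ⟨g, hg⟩ := exists_disc_hom b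
    have sq : CommSq f (sphereToDisc k O n) p g := ⟨sphere_hom_ext (by
      change p.f n (f.f n _) = g.f n ((sphereToDisc k O n).f n _)
      rw [hf, sphereToDisc_gen, f_d_apply, hg, hb])⟩
    refine ⟨sq.lift.f (n + 1) (discGen k O n), ?_, ?_⟩
    · rw [← f_d_apply, ← sphereToDisc_gen, ← hf]
      exact f_f_apply sq.fac_left _ _
    · rw [← hg]
      exact f_f_apply sq.fac_right _ _
  · intro h
    refine ⟨fun {f g} sq => ?_⟩
    have w : p.f n (f.f n (sphereGen k O n)) = g.f n ((sphereToDisc k O n).f n (sphereGen k O n)) :=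
      ConcreteCategory.congr_hom (congrArg (fun t => t.f n) sq.w) (sphereGen k O n)
    obtain ⟨e, he, he'⟩ := h (f.f n (sphereGen k O n)) (g.f (n + 1) (discGen k O n))
      ((isCyc_sphereGen n).map f) (by rw [w, sphereToDisc_gen, f_d_apply])
    obtain ⟨l, hl⟩ := exists_disc_hom e
    refine ⟨⟨l, sphere_hom_ext ?_, disc_hom_ext ?_⟩⟩
    · change l.f n ((sphereToDisc k O n).f n _) = _
      rw [sphereToDisc_gen, f_d_apply, hl, he]
    · change p.f (n + 1) (l.f (n + 1) _) = _
      rw [hl, he']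

theorem genTrivCof_rlp : (genTrivCof k O).rlp = fibD := by
  ext X Y p
  constructor
  · intro h n hn
    obtain ⟨n, rfl⟩ := Nat.exists_eq_succ_of_ne_zero hn.ne'
    exact (hasLiftingProperty_zero_disc_iff p n).1 (h _ (.mk n))
  · rintro h _ _ _ ⟨n⟩
    exact (hasLiftingProperty_zero_disc_iff p n).2 (h (n + 1) n.succ_pos)

theorem genCof_rlp : (genCof k O).rlp = fibD ⊓ weqD := by
  ext X Y p
  refine Iff.trans ?_ (surjective_quasiIso_iff p).symm
  constructor
  · intro h
    exact ⟨(hasLiftingProperty_zero_sphere_iff p).1 (h _ .zero),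
      fun n => (hasLiftingProperty_sphereToDisc_iff p n).1 (h _ (.succ n))⟩
  · rintro ⟨h0, h⟩ _ _ _ (_ | n)
    · exact (hasLiftingProperty_zero_sphere_iff p).2 h0
    · exact (hasLiftingProperty_sphereToDisc_iff p _).2 (h _)

end Generators

/-! ### Saturation of the injective quasi-isomorphisms -/

section AcyclicMono

open HomologicalComplex

variable {R : Type u} [Ring R] {X Y : ChainComplex (ModuleCat.{u} R) ℕ}

theorem f_injective (f : X ⟶ Y) [Mono f] (n : ℕ) : Function.Injective (f.f n) :=
  (ModuleCat.mono_iff_injective _).1 inferInstance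

/-- Relative cycles are, modulo the image of `f`, boundaries. -/
def RelAcyclic (f : X ⟶ Y) : Prop :=
  ∀ n (y : Y.X n), (∀ j, ∃ x, f.f j x = Y.d n j y) → ∃ x e, y = f.f n x + Y.d (n + 1) n e

/-- By the long exact sequence, an injection is a quasi-isomorphism exactly when its cokernel is
acyclic. `RelAcyclic` says this without forming the cokernel, which makes the closure properties
direct. -/
theorem quasiIso_iff_relAcyclic (f : X ⟶ Y) [Mono f] : QuasiIso f ↔ RelAcyclic f := by
  constructor
  · intro hf n y hy
    have hq n := (quasiIsoAt_iff_elements f n).1 inferInstance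
    have key (y : Y.X n) (hy : IsCyc Y n y) : ∃ x e, y = f.f n x + Y.d (n + 1) n e := by
      obtain ⟨z, -, e, he⟩ := (hq n).2 y hy
      exact ⟨z, e, by rw [he, add_sub_cancel]⟩
    cases n with
    | zero => exact key y (isCyc_zero y)
    | succ n =>
      obtain ⟨x, hx⟩ := hy n
      have hxc : IsCyc X n x := fun j => f_injective f j (by
        rw [f_d_apply, hx, d_d_apply, map_zero])
      -- The boundary of `y` comes from a cycle `x` that bounds in `Y`, hence in `X`; subtracting a
      -- primitive turns `y` into a genuine cycle.
      obtain ⟨e, he⟩ := (hq n).1 x hxc ⟨y, hx.symm⟩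
      obtain ⟨x', e', h⟩ := key (y - f.f (n + 1) e) (isCyc_succ (by
        rw [map_sub, ← hx, ← f_d_apply, he, sub_self]))
      exact ⟨x' + e, e', by rw [map_add, add_right_comm, ← h, sub_add_cancel]⟩
  · intro h
    refine ⟨fun n => (quasiIsoAt_iff_elements f n).2 ⟨?_, ?_⟩⟩
    · rintro z - ⟨b, hb⟩
      obtain ⟨x, e, hx⟩ := h (n + 1) b fun j => by
        by_cases hj : j = n
        · subst hj; exact ⟨z, hb.symm⟩
        · exact ⟨0, by rw [Y.shape (n + 1) j (by simp; omega), map_zero]; rfl⟩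
      refine ⟨x, f_injective f n ?_⟩
      rw [f_d_apply, ← hb, hx, map_add, d_d_apply, add_zero]
    · intro y hy
      obtain ⟨x, e, hx⟩ := h n y fun j => ⟨0, by rw [hy j, map_zero]⟩
      refine ⟨x, fun j => f_injective f j ?_, e, by rw [hx, add_sub_cancel_left]⟩
      have := hy j
      rw [hx, map_add, d_d_apply, add_zero] at this
      rw [f_d_apply, this, map_zero]

variable (R) in
/-- The monomorphisms that are quasi-isomorphisms. -/
def acyclicMono : MorphismProperty (ChainComplex (ModuleCat.{u} R) ℕ) :=
  MorphismProperty.monomorphisms _ ⊓ quasiIso (ModuleCat.{u} R) (ComplexShape.down ℕ)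

theorem acyclicMono_iff (f : X ⟶ Y) : acyclicMono R f ↔ Mono f ∧ RelAcyclic f := by
  constructor
  · rintro ⟨h, hq⟩
    have : Mono f := h
    exact ⟨h, (quasiIso_iff_relAcyclic f).1 hq⟩
  · rintro ⟨h, hr⟩
    exact ⟨h, (quasiIso_iff_relAcyclic f).2 hr⟩

instance : (acyclicMono R).RespectsIso :=
  inferInstanceAs (_ ⊓ _ : MorphismProperty _).RespectsIso

instance : (acyclicMono R).IsMultiplicative :=
  inferInstanceAs (_ ⊓ _ : MorphismProperty _).IsMultiplicative

instance : (acyclicMono R).IsStableUnderRetracts where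
  of_retract h hg := ⟨(MorphismProperty.monomorphisms _).of_retract h hg.1,
    (quasiIso _ _).of_retract h hg.2⟩

section Filtered

variable {J : Type u} [SmallCategory J] [IsFiltered J] {F : J ⥤ ChainComplex (ModuleCat.{u} R) ℕ}
  {c : Cocone F}

theorem exists_rep (hc : IsColimit c) {n : ℕ} (y : c.pt.X n) :
    ∃ j x, (c.ι.app j).f n x = y :=
  Concrete.isColimit_exists_rep (F ⋙ eval _ _ n) (isColimitOfPreserves (eval _ _ n) hc) y

theorem exists_of_rep_eq (hc : IsColimit c) {n : ℕ} {j : J} (x x' : (F.obj j).X n)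
    (h : (c.ι.app j).f n x = (c.ι.app j).f n x') :
    ∃ j', ∃ φ : j ⟶ j', (F.map φ).f n x = (F.map φ).f n x' := by
  obtain ⟨l, a, b, hab⟩ := Concrete.isColimit_exists_of_rep_eq (F ⋙ eval _ _ n)
    (isColimitOfPreserves (eval _ _ n) hc) (i := j) (j := j) x x' h
  have hab' : (F.map a).f n x = (F.map b).f n x' := hab
  refine ⟨IsFiltered.coeq a b, a ≫ IsFiltered.coeqHom a b, ?_⟩
  have e : a ≫ IsFiltered.coeqHom a b = b ≫ IsFiltered.coeqHom a b := IsFiltered.coeq_condition a b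
  rw [← f_f_apply (F.map_comp a _).symm, hab', f_f_apply (F.map_comp b _).symm, e]

end Filtered

/-- A relative cycle in a filtered colimit comes from some stage and, having a single relevant
boundary, is a relative cycle at a later one; the decomposition found there is pushed to the
colimit. -/
theorem RelAcyclic.of_isColimit {J : Type u} [SmallCategory J] [IsFiltered J]
    {F G : J ⥤ ChainComplex (ModuleCat.{u} R) ℕ} {c : Cocone F} {c' : Cocone G} (hc : IsColimit c)
    (hc' : IsColimit c') (f : F ⟶ G) (hf : ∀ j, RelAcyclic (f.app j)) (φ : c.pt ⟶ c'.pt)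
    (hφ : ∀ j, c.ι.app j ≫ φ = f.app j ≫ c'.ι.app j) : RelAcyclic φ := by
  have push {n : ℕ} (j : J) (x : (F.obj j).X n) :
      φ.f n ((c.ι.app j).f n x) = (c'.ι.app j).f n ((f.app j).f n x) := by
    rw [f_f_apply (hφ j), ← f_f_apply rfl]
  -- That a boundary lies in the image of `φ` is one equation in the colimit, so it holds at some
  -- stage.
  have pull {i n : ℕ} (j : J) (y : (G.obj j).X i) (z : c.pt.X n)
      (h : φ.f n z = c'.pt.d i n ((c'.ι.app j).f i y)) :
      ∃ j', ∃ a : j ⟶ j', ∃ x, (f.app j').f n x = (G.obj j').d i n ((G.map a).f i y) := by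
    obtain ⟨l, x, rfl⟩ := exists_rep hc z
    have h' : (c'.ι.app (IsFiltered.max j l)).f n ((f.app _).f n
        ((F.map (IsFiltered.rightToMax j l)).f n x)) = (c'.ι.app (IsFiltered.max j l)).f n
          ((G.obj _).d i n ((G.map (IsFiltered.leftToMax j l)).f i y)) := by
      rw [← push, f_f_apply (c.w (IsFiltered.rightToMax j l)), h, f_d_apply,
        f_f_apply (c'.w (IsFiltered.leftToMax j l))]
      rfl
    obtain ⟨m, b, hb⟩ := exists_of_rep_eq hc' _ _ h'
    refine ⟨m, IsFiltered.leftToMax j l ≫ b, (F.map b).f n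
      ((F.map (IsFiltered.rightToMax j l)).f n x), ?_⟩
    rw [f_f_apply (f.naturality b), ← f_f_apply rfl, hb, f_d_apply,
      f_f_apply (G.map_comp _ b).symm]
  intro n y hy
  obtain ⟨j, y, rfl⟩ := exists_rep hc' y
  -- One stage serves all degrees `i`, since only the differential to degree `n - 1` can be nonzero.
  obtain ⟨j', a, hj'⟩ : ∃ j', ∃ a : j ⟶ j', ∀ i, ∃ x, (f.app j').f i x =
      (G.obj j').d n i ((G.map a).f n y) := by
    cases n with
    | zero => exact ⟨j, 𝟙 j, fun i => ⟨0, by rw [isCyc_zero, map_zero]⟩⟩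
    | succ n =>
      obtain ⟨z, hz⟩ := hy n
      obtain ⟨j', a, x, hx⟩ := pull j y z hz
      refine ⟨j', a, fun i => ?_⟩
      by_cases hi : i = n
      · subst hi; exact ⟨x, hx⟩
      · exact ⟨0, by rw [(G.obj j').shape (n + 1) i (by simp; omega), map_zero]; rfl⟩
  obtain ⟨x, e, h⟩ := hf j' n _ hj'
  refine ⟨(c.ι.app j').f n x, (c'.ι.app j').f (n + 1) e, ?_⟩
  rw [push, ← f_d_apply, ← map_add, ← h, f_f_apply (c'.w a)]

/-- The source of the stability under transfinite compositions. -/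
instance : MorphismProperty.IsStableUnderFilteredColimits.{u, u} (acyclicMono R) where
  isStableUnderColimitsOfShape _ _ _ := {
    condition X₁ X₂ c₁ c₂ h₁ h₂ f hf φ hφ := (acyclicMono_iff φ).2
      ⟨MorphismProperty.IsStableUnderColimitsOfShape.condition
        (W := MorphismProperty.monomorphisms _) X₁ X₂ c₁ c₂ h₁ h₂ f (fun j => (hf j).1) φ hφ,
        RelAcyclic.of_isColimit h₁ h₂ f (fun j => ((acyclicMono_iff _).1 (hf j)).2) φ hφ⟩ }

section Pushout

theorem moduleCat_pushout_exists_add {A B C D : ModuleCat.{u} R} {f : A ⟶ B} {g : A ⟶ C}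
    {g' : B ⟶ D} {f' : C ⟶ D} (h : IsPushout f g g' f') (y : D) : ∃ b c, y = g' b + f' c := by
  obtain ⟨w, rfl⟩ := (ModuleCat.epi_iff_surjective _).1 h.epi_shortComplex_g y
  refine ⟨(biprod.fst : (B ⊞ C) ⟶ _) w, (biprod.snd : (B ⊞ C) ⟶ _) w, ?_⟩
  have e : (biprod.desc g' f' : (B ⊞ C) ⟶ _) = biprod.fst ≫ g' + biprod.snd ≫ f' := by
    apply biprod.hom_ext' <;> simp
  exact ConcreteCategory.congr_hom e w

/-- Exactness of `A ⟶ B ⊞ C ⟶ D`, whose first map carries a sign: hence the difference of `b` and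
`c` as the element to be lifted. -/
theorem moduleCat_pushout_exists_of_eq {A B C D : ModuleCat.{u} R} {f : A ⟶ B} {g : A ⟶ C}
    {g' : B ⟶ D} {f' : C ⟶ D} (h : IsPushout f g g' f') (b : B) (c : C) (hbc : g' b = f' c) :
    ∃ a, f a = b ∧ g a = c := by
  obtain ⟨a, ha⟩ : ∃ a, biprod.lift f (-g) a =
      (biprod.inl : _ ⟶ (B ⊞ C)) b - (biprod.inr : _ ⟶ (B ⊞ C)) c := by
    refine (ShortComplex.moduleCat_exact_iff _).1 h.exact_shortComplex _ ?_
    change biprod.desc g' f' ((biprod.inl : _ ⟶ (B ⊞ C)) b - (biprod.inr : _ ⟶ (B ⊞ C)) c) = 0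
    rw [map_sub, ← ConcreteCategory.comp_apply, ← ConcreteCategory.comp_apply, biprod.inl_desc,
      biprod.inr_desc, hbc, sub_self]
  refine ⟨a, ?_, ?_⟩
  · rw [← biprod.lift_fst f (-g), ConcreteCategory.comp_apply, ha, map_sub,
      ← ConcreteCategory.comp_apply, ← ConcreteCategory.comp_apply, biprod.inl_fst, biprod.inr_fst]
    exact sub_zero b
  · have e : -(biprod.lift f (-g) ≫ biprod.snd) = g := by simp
    rw [← e]
    change -((biprod.snd : (B ⊞ C) ⟶ C) (biprod.lift f (-g) a)) = c
    rw [ha, map_sub, ← ConcreteCategory.comp_apply, ← ConcreteCategory.comp_apply, biprod.inl_snd,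
      biprod.inr_snd]
    exact (neg_sub _ _).trans (sub_zero c)

variable {X' Y' : ChainComplex (ModuleCat.{u} R) ℕ} {f : X ⟶ Y} {g : X ⟶ X'} {f' : X' ⟶ Y'}
  {g' : Y ⟶ Y'}

theorem pushout_exists_add (h : IsPushout f g g' f') {n : ℕ} (y : Y'.X n) :
    ∃ a b, y = g'.f n a + f'.f n b :=
  moduleCat_pushout_exists_add (h.map (eval _ _ n)) y

theorem pushout_exists_of_eq (h : IsPushout f g g' f') {n : ℕ} (a : Y.X n) (b : X'.X n)
    (hab : g'.f n a = f'.f n b) : ∃ x, f.f n x = a ∧ g.f n x = b :=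
  moduleCat_pushout_exists_of_eq (h.map (eval _ _ n)) a b hab

/-- A pushout does not change the cokernel: modulo `X'`, every element of `Y'` comes from `Y`. -/
theorem RelAcyclic.of_isPushout (h : IsPushout f g g' f') (hf : RelAcyclic f) : RelAcyclic f' := by
  intro n y hy
  obtain ⟨a, b, rfl⟩ := pushout_exists_add h y
  obtain ⟨x, e, rfl⟩ := hf n a fun j => by
    obtain ⟨v, hv⟩ := hy j
    rw [map_add, ← f_d_apply, ← f_d_apply] at hv
    obtain ⟨x, hx, -⟩ := pushout_exists_of_eq h (Y.d n j a) (v - X'.d n j b) (by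
      rw [map_sub, hv, add_sub_cancel_right])
    exact ⟨x, hx⟩
  refine ⟨g.f n x + b, g'.f (n + 1) e, ?_⟩
  rw [map_add, map_add, f_d_apply, f_f_apply rfl, f_f_apply rfl, h.w]
  abel

end Pushout

instance : (acyclicMono R).IsStableUnderCobaseChange where
  of_isPushout {_ _ _ _ f _ _ _} sq hf := (acyclicMono_iff _).2
    ⟨MorphismProperty.IsStableUnderCobaseChange.of_isPushout
      (P := MorphismProperty.monomorphisms _) sq hf.1,
      ((acyclicMono_iff f).1 hf).2.of_isPushout sq.flip⟩

section Coproduct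

open Classical in
theorem sigma_exists_sum {J : Type u} (Y : J → ChainComplex (ModuleCat.{u} R) ℕ) {n : ℕ}
    (y : (∐ Y).X n) :
    ∃ s : Finset J, y = ∑ j ∈ s, (Sigma.ι Y j).f n ((Sigma.π Y j).f n y) := by
  have top : ⨆ j, LinearMap.range ((Sigma.ι Y j).f n).hom = ⊤ := by
    set N := ⨆ j, LinearMap.range ((Sigma.ι Y j).f n).hom
    -- The quotient by the span of the summands vanishes on each summand, hence on the coproduct.
    have h0 : ModuleCat.ofHom N.mkQ = 0 := by
      refine (isColimitOfPreserves (eval _ _ n) (coproductIsCoproduct Y)).hom_ext fun j => ?_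
      ext x
      exact (Submodule.Quotient.mk_eq_zero N).2 (Submodule.mem_iSup_of_mem j.as ⟨x, rfl⟩)
    rw [← Submodule.ker_mkQ N, LinearMap.ker_eq_top]
    exact congrArg ModuleCat.Hom.hom h0
  obtain ⟨g, hg, hy⟩ := (Submodule.mem_iSup_iff_exists_finsupp _ y).1 (top ▸ Submodule.mem_top)
  replace hy : ∑ j ∈ g.support, g j = y := hy
  choose v hv using hg
  have hv' j : (Sigma.ι Y j).f n (v j) = g j := hv j
  refine ⟨g.support, ?_⟩
  have key : ∀ j ∈ g.support, (Sigma.ι Y j).f n ((Sigma.π Y j).f n y) = g j := by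
    intro j hj
    rw [← hy, map_sum, Finset.sum_eq_single j, ← hv', f_f_apply (Sigma.ι_π_eq_id Y j)]
    · rfl
    · intro l _ hl
      rw [← hv', f_f_apply (Sigma.ι_π_of_ne Y hl)]
      rfl
    · intro h; exact (h hj).elim
  rw [Finset.sum_congr rfl key, hy]

open Classical in
-- Each component of a relative cycle is a relative cycle; the componentwise solutions are summed
-- over the finite support.
theorem RelAcyclic.sigmaMap {J : Type u} {X Y : J → ChainComplex (ModuleCat.{u} R) ℕ}
    (f : ∀ j, X j ⟶ Y j) (hf : ∀ j, RelAcyclic (f j)) : RelAcyclic (Limits.Sigma.map f) := by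
  intro n y hy
  have ex (j : J) := hf j n ((Sigma.π Y j).f n y) fun i => by
    obtain ⟨x, hx⟩ := hy i
    refine ⟨(Sigma.π X j).f i x, ?_⟩
    have w : Sigma.π X j ≫ f j = Limits.Sigma.map f ≫ Sigma.π Y j := by
      ext1 l
      by_cases h : l = j
      · subst h; simp
      · simp [Sigma.ι_π_of_ne_assoc _ h, Sigma.ι_π_of_ne _ h]
    rw [f_f_apply w, ← f_f_apply rfl, hx, f_d_apply]
  choose x e h using ex
  obtain ⟨s, hs⟩ := sigma_exists_sum Y y
  refine ⟨∑ j ∈ s, (Sigma.ι X j).f n (x j), ∑ j ∈ s, (Sigma.ι Y j).f (n + 1) (e j), ?_⟩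
  rw [map_sum, map_sum, ← Finset.sum_add_distrib]
  refine hs.trans (Finset.sum_congr rfl fun j _ => ?_)
  rw [h j, map_add, ← f_d_apply, f_f_apply (Sigma.ι_map f j), f_f_apply rfl]

end Coproduct

instance : MorphismProperty.IsStableUnderCoproducts.{u} (acyclicMono R) where
  isStableUnderCoproductsOfShape J := MorphismProperty.IsStableUnderCoproductsOfShape.mk _ J
    fun _ _ _ _ f hf => (acyclicMono_iff _).2
    ⟨MorphismProperty.colimMap (W := MorphismProperty.monomorphisms _) _ fun j => (hf j.as).1,
      RelAcyclic.sigmaMap f fun j => ((acyclicMono_iff _).1 (hf j)).2⟩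

end AcyclicMono

/-! ### Generated classes and functors preserving colimits -/

section Saturation

open MorphismProperty

universe v w w'

variable {C : Type w} [Category.{v} C] {D : Type w'} [Category.{v} D]

theorem strictMap_rlp {F : C ⥤ D} {G : D ⥤ C} (adj : F ⊣ G) (I : MorphismProperty C) :
    (I.strictMap F).rlp = I.rlp.inverseImage G := by
  ext X Y p
  exact ⟨fun h _ _ i hi => (adj.hasLiftingProperty_iff i p).1 (h _ ⟨hi⟩),
    fun h _ _ _ ⟨hi⟩ => (adj.hasLiftingProperty_iff _ p).2 (h _ hi)⟩

theorem inverseImage_isStableUnderCobaseChange (G : C ⥤ D) [PreservesFiniteColimits G]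
    (P : MorphismProperty D) [P.IsStableUnderCobaseChange] :
    (P.inverseImage G).IsStableUnderCobaseChange :=
  ⟨fun sq hg => P.of_isPushout (sq.map G) hg⟩

theorem inverseImage_isStableUnderTransfiniteComposition (G : C ⥤ D)
    [PreservesColimitsOfSize.{v, v} G] (P : MorphismProperty D)
    [IsStableUnderTransfiniteComposition.{v} P] :
    IsStableUnderTransfiniteComposition.{v} (P.inverseImage G) :=
  ⟨fun J _ _ _ _ => ⟨fun _ _ f hf =>
    have : PreservesWellOrderContinuousOfShape J G := ⟨fun _ _ => inferInstance⟩
    P.transfiniteCompositionsOfShape_le J _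
      (transfiniteCompositionsOfShape_map_of_preserves J G f hf)⟩⟩

/-- A saturated class pulled back along a functor that preserves colimits contains all relative
cell complexes as soon as it contains the cells. -/
theorem cell_le_inverseImage (I : MorphismProperty C) (G : C ⥤ D)
    [PreservesColimitsOfSize.{v, v} G] (P : MorphismProperty D)
    [P.IsStableUnderCobaseChange] [IsStableUnderTransfiniteComposition.{v} P]
    (h : I ≤ P.inverseImage G) : cell I ≤ P.inverseImage G := by
  have : PreservesFiniteColimits G := PreservesColimits.preservesFiniteColimits G
  have := inverseImage_isStableUnderCobaseChange G P
  have := inverseImage_isStableUnderTransfiniteComposition G P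
  unfold cell
  rw [transfiniteCompositions_le_iff, pushouts_le_iff]
  exact h

/-- A saturated class pulled back along a functor that preserves colimits contains all retracts
of relative cell complexes as soon as it contains the cells. -/
theorem llp_rlp_le_inverseImage (I : MorphismProperty C) [HasSmallObjectArgument.{v} I] (G : C ⥤ D)
    [PreservesColimitsOfSize.{v, v} G] (P : MorphismProperty D) [P.IsStableUnderRetracts]
    [P.IsStableUnderCobaseChange] [IsStableUnderTransfiniteComposition.{v} P]
    [IsStableUnderCoproducts.{v} P] (h : I ≤ P.inverseImage G) : I.rlp.llp ≤ P.inverseImage G := by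
  -- By the small object argument, the class consists of retracts of transfinite compositions of
  -- pushouts of coproducts of cells; the inverse image of `P` is closed under each of these
  -- operations.
  rw [llp_rlp_of_hasSmallObjectArgument]
  have : PreservesFiniteColimits G := PreservesColimits.preservesFiniteColimits G
  have : (P.inverseImage G).IsStableUnderRetracts :=
    ⟨fun r hg => P.of_retract (r.map G) hg⟩
  have := inverseImage_isStableUnderCobaseChange G P
  have hc : IsStableUnderCoproducts.{v} (P.inverseImage G) := ⟨fun J => ⟨
    fun X₁ X₂ c₁ c₂ h₁ h₂ f hf φ hφ => IsStableUnderColimitsOfShape.condition (W := P) (X₁ ⋙ G)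
      (X₂ ⋙ G) _ _ (isColimitOfPreserves G h₁) (isColimitOfPreserves G h₂)
      (Functor.whiskerRight f G) (fun j => hf j) (G.map φ) fun j => by
        have := congrArg G.map (hφ j)
        simpa using this⟩⟩
  have := inverseImage_isStableUnderTransfiniteComposition G P
  rw [retracts_le_iff, transfiniteCompositions_le_iff, pushouts_le_iff, coproducts_le_iff]
  exact h

end Saturation

/-! ### Smallness of the generators -/

section Small

open Cardinal Opposite ZeroObject

attribute [local instance] fact_isRegular_aleph0

variable {k O : Type u} [Field k] [CommRing O] [Algebra k O]

theorem isCardinalPresentable_of_lift {X : DGDM k O}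
    (hs : ∀ (J : Type u) [SmallCategory J] [IsFiltered J] (F : J ⥤ DGDM k O) (c : Cocone F),
      IsColimit c → (∀ f : X ⟶ c.pt, ∃ j g, f = g ≫ c.ι.app j) ∧
        ∀ j (f g : X ⟶ F.obj j), f ≫ c.ι.app j = g ≫ c.ι.app j →
          ∃ j', ∃ a : j ⟶ j', f ≫ F.map a = g ≫ F.map a) :
    IsCardinalPresentable X (ℵ₀ : Cardinal.{u}) where
  preservesColimitOfShape J _ _ := by
    have : IsFiltered J := (isCardinalFiltered_aleph0_iff.{u} J).1 inferInstance
    exact ⟨fun {F} => ⟨fun {c} hc => ⟨Types.FilteredColimit.isColimitOf' _ _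
      (hs J F c hc).1 (hs J F c hc).2⟩⟩⟩

/-- A cycle in a filtered colimit has a representative at some stage, and being a cycle is one
equation, valid at a later stage. -/
theorem sphere_isCardinalPresentable (n : ℕ) :
    IsCardinalPresentable (sphere k O n) (ℵ₀ : Cardinal.{u}) := by
  refine isCardinalPresentable_of_lift fun J _ _ F c hc => ⟨fun f => ?_, fun j f g h => ?_⟩
  · obtain ⟨j, x, hx⟩ := exists_rep hc (f.f n (sphereGen k O n))
    obtain ⟨j', a, ha⟩ : ∃ j', ∃ a : j ⟶ j', IsCyc (F.obj j') n ((F.map a).f n x) := by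
      cases n with
      | zero => exact ⟨j, 𝟙 j, isCyc_zero _⟩
      | succ n =>
        obtain ⟨j', a, ha⟩ := exists_of_rep_eq hc ((F.obj j).d (n + 1) n x) 0 (by
          rw [f_d_apply, hx, map_zero]
          exact (isCyc_sphereGen (n + 1)).map f n)
        exact ⟨j', a, isCyc_succ (by rw [← f_d_apply, ha, map_zero])⟩
    obtain ⟨g, hg⟩ := exists_sphere_hom ha
    refine ⟨j', g, sphere_hom_ext ?_⟩
    rw [← f_f_apply rfl, hg, f_f_apply (c.w a), hx]
  · obtain ⟨j', a, ha⟩ := exists_of_rep_eq hc (f.f n (sphereGen k O n)) (g.f n (sphereGen k O n))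
      (by rw [f_f_apply h, f_f_apply rfl])
    exact ⟨j', a, sphere_hom_ext (by rw [← f_f_apply rfl, ha, f_f_apply rfl])⟩

theorem zero_isCardinalPresentable :
    IsCardinalPresentable (0 : DGDM k O) (ℵ₀ : Cardinal.{u}) :=
  isCardinalPresentable_of_lift fun J _ _ _ _ _ =>
    ⟨fun _ => ⟨(IsFiltered.nonempty : Nonempty J).some, 0, (isZero_zero _).eq_of_src _ _⟩,
      fun j _ _ _ => ⟨j, 𝟙 j, (isZero_zero _).eq_of_src _ _⟩⟩

theorem genCof_isCardinalPresentable {X Y : DGDM k O} {i : X ⟶ Y} (h : genCof k O i) :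
    IsCardinalPresentable X (ℵ₀ : Cardinal.{u}) := by
  obtain _ | n := h
  · exact zero_isCardinalPresentable
  · exact sphere_isCardinalPresentable _

theorem genTrivCof_isCardinalPresentable {X Y : DGDM k O} {i : X ⟶ Y} (h : genTrivCof k O i) :
    IsCardinalPresentable X (ℵ₀ : Cardinal.{u}) := by
  obtain ⟨n⟩ := h
  exact zero_isCardinalPresentable

instance genCof_isSmall : MorphismProperty.IsSmall.{u} (genCof k O) where
  small_toSet := by
    refine small_of_surjective (f := fun o : Option ℕ => (match o with
      | none => ⟨Arrow.mk _, genCof.zero⟩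
      | some n => ⟨Arrow.mk _, genCof.succ n⟩ : (genCof k O).toSet)) ?_
    rintro ⟨⟨_, _, _⟩, (_ | n)⟩
    · exact ⟨none, rfl⟩
    · exact ⟨some n, rfl⟩

instance genTrivCof_isSmall : MorphismProperty.IsSmall.{u} (genTrivCof k O) where
  small_toSet := by
    refine small_of_surjective
      (f := fun n : ℕ => (⟨Arrow.mk _, genTrivCof.mk n⟩ : (genTrivCof k O).toSet)) ?_
    rintro ⟨⟨_, _, _⟩, ⟨n⟩⟩
    exact ⟨n, rfl⟩

instance strictMap_isSmall {C D : Type*} [Category* C] [Category* D] (F : C ⥤ D)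
    (W : MorphismProperty C) [MorphismProperty.IsSmall.{u} W] :
    MorphismProperty.IsSmall.{u} (W.strictMap F) where
  small_toSet := by
    refine small_of_surjective
      (f := fun f : W.toSet => (⟨Arrow.mk (F.map f.1.hom), ⟨f.2⟩⟩ : (W.strictMap F).toSet)) ?_
    rintro ⟨⟨_, _, _⟩, ⟨hf⟩⟩
    exact ⟨⟨Arrow.mk _, hf⟩, rfl⟩

variable [CharZero k] [Algebra.Smooth k O] (A : DGDA k O)

/-- The right adjoint preserves filtered colimits, so the left adjoint preserves finite
presentability. -/
theorem free_isCardinalPresentable (X : DGDM k O)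
    [IsCardinalPresentable X (ℵ₀ : Cardinal.{u})] :
    IsCardinalPresentable ((freeFunctor A.X).obj X) (ℵ₀ : Cardinal.{u}) := by
  have : PreservesColimits (Mod.forget (D := DGDM k O) A.X) := forget_preservesColimits A.X
  exact (freeAdj A.X).isCardinalPresentable_leftAdjoint_obj _ X

variable {A} in
-- With finitely presentable domains, `ℵ₀` works for every sequence, whatever its successor maps
-- are.
theorem permitsSmallObjectArgument (I : MorphismProperty (ModA A))
    (h : ∀ {X Y : ModA A} (i : X ⟶ Y), I i → IsCardinalPresentable X (ℵ₀ : Cardinal.{u})) :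
    PermitsSmallObjectArgument I := by
  refine fun X Y i hi => ⟨ℵ₀, inferInstance, fun J _ _ _ _ _ _ F _ _ => ?_⟩
  have := h i hi
  have := preservesColimitsOfShape_of_isCardinalPresentable X (ℵ₀ : Cardinal.{u}) J
  infer_instance

variable {A} in
theorem hasSmallObjectArgument (I : MorphismProperty (ModA A)) [MorphismProperty.IsSmall.{u} I]
    (h : ∀ {X Y : ModA A} (i : X ⟶ Y), I i → IsCardinalPresentable X (ℵ₀ : Cardinal.{u})) :
    MorphismProperty.HasSmallObjectArgument.{u} I := by
  refine ⟨⟨ℵ₀, inferInstance, WellFoundedLT.toOrderBot _, ?_⟩⟩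
  let _ := WellFoundedLT.toOrderBot (ℵ₀ : Cardinal.{u}).ord.ToType
  exact {
    preservesColimit {X _ _ _} i hi f hf := by
      have := h i hi
      have := preservesColimitsOfShape_of_isCardinalPresentable X (ℵ₀ : Cardinal.{u})
        (ℵ₀ : Cardinal.{u}).ord.ToType
      infer_instance }

/-- The generating cofibrations of the category of modules. -/
abbrev modCof : MorphismProperty (ModA A) := (genCof k O).strictMap (freeFunctor A.X)

/-- The generating trivial cofibrations of the category of modules. -/
abbrev modTrivCof : MorphismProperty (ModA A) := (genTrivCof k O).strictMap (freeFunctor A.X)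

theorem modCof_isCardinalPresentable {X Y : ModA A} (i : X ⟶ Y) (hi : modCof A i) :
    IsCardinalPresentable X (ℵ₀ : Cardinal.{u}) := by
  obtain ⟨hi⟩ := hi
  have := genCof_isCardinalPresentable hi
  exact free_isCardinalPresentable A _

theorem modTrivCof_isCardinalPresentable {X Y : ModA A} (i : X ⟶ Y) (hi : modTrivCof A i) :
    IsCardinalPresentable X (ℵ₀ : Cardinal.{u}) := by
  obtain ⟨hi⟩ := hi
  have := genTrivCof_isCardinalPresentable hi
  exact free_isCardinalPresentable A _

instance modCof_hasSmallObjectArgument :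
    MorphismProperty.HasSmallObjectArgument.{u} (modCof A) :=
  hasSmallObjectArgument _ (modCof_isCardinalPresentable A)

instance modTrivCof_hasSmallObjectArgument :
    MorphismProperty.HasSmallObjectArgument.{u} (modTrivCof A) :=
  hasSmallObjectArgument _ (modTrivCof_isCardinalPresentable A)

theorem modCof_rlp : (modCof A).rlp = (fibD ⊓ weqD).inverseImage (Mod.forget A.X) := by
  rw [strictMap_rlp (freeAdj A.X), genCof_rlp]

theorem modTrivCof_rlp : (modTrivCof A).rlp = fibD.inverseImage (Mod.forget A.X) := by
  rw [strictMap_rlp (freeAdj A.X), genTrivCof_rlp]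

end Small

/-! ### Contractibility of discs -/

section Contractible

open HomologicalComplex ZeroObject

variable (k O : Type u) [Field k] [CommRing O] [Algebra k O]

open Classical in
/-- Discs are contractible. -/
def discContraction (n : ℕ) : Homotopy (𝟙 (disc k O n)) 0 := by
  -- The only nonzero component goes from degree `n` to degree `n + 1` and inverts the differential.
  let h (i j : ℕ) (_ : (ComplexShape.down ℕ).Rel j i) : (disc k O n).X i ⟶ (disc k O n).X j :=
    if e : i = n ∧ j = n + 1 then (XIsoOfEq _ e.1).hom ≫ (doubleXIso₁ (𝟙 (regD k O))
      (show (ComplexShape.down ℕ).Rel (n + 1) n from rfl) (by simp)).hom ≫ (doubleXIso₀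
        (𝟙 (regD k O)) (show (ComplexShape.down ℕ).Rel (n + 1) n from rfl)).inv ≫
          (XIsoOfEq _ e.2).inv
    else 0
  -- Maps out of the disc are determined by the generator in degree `n + 1`, so the homotopy
  -- identity is checked there only.
  refine (Homotopy.ofEq (disc_hom_ext ?_)).trans (Homotopy.nullHomotopy' h)
  have e : (Homotopy.nullHomotopicMap' h).f (n + 1) = 𝟙 _ := by
    rw [Homotopy.nullHomotopicMap'_f (k₂ := n + 2) (k₀ := n) rfl rfl]
    have h₁ : h (n + 1) (n + 2) rfl = 0 := dif_neg (by omega)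
    have h₂ : h n (n + 1) rfl = _ := dif_pos ⟨rfl, rfl⟩
    have h₃ : (disc k O n).d (n + 1) n = _ := double_d _ _ (by simp)
    rw [h₁, h₂, h₃]
    simp
    have key {P Q S : DCat k O} (a : P ≅ Q) (b : S ≅ Q) :
      (a.hom ≫ b.inv) ≫ b.hom ≫ a.inv ≫ 𝟙 _ = 𝟙 _ := by simp
    exact key _ _
  rw [e]
  rfl

variable {k O}

variable [CharZero k] [Algebra.Smooth k O]

/-- The tensor product carries homotopies to homotopies, so the identity of `K ⊗ L` is zero on
homology, for any `L`. -/
theorem acyclic_tensor_of_contractible {K : DGDM k O} (h : Homotopy (𝟙 K) 0) (L : DGDM k O) :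
    (K ⊗ L : DGDM k O).Acyclic := by
  have H : Homotopy ((𝟙 K) ▷ L) ((0 : K ⟶ K) ▷ L) :=
    mapBifunctorMapHomotopy₁ h (𝟙 L) (curriedTensor (DCat k O)) (ComplexShape.down ℕ)
  intro n
  rw [exactAt_iff_isZero_homology, IsZero.iff_id_eq_zero, ← homologyMap_id]
  have := H.homologyMap_eq n
  rw [id_whiskerRight] at this
  refine this.trans ?_
  have e : (0 : K ⟶ K) ▷ L = 0 := by
    refine HomologicalComplex.hom_ext _ _ fun i => cι_ext ?_
    intro p q hpq
    rw [cι_whiskerRight]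
    simp
  rw [e, homologyMap_zero]

theorem disc_tensor_acyclic (n : ℕ) (L : DGDM k O) : (disc k O n ⊗ L : DGDM k O).Acyclic :=
  acyclic_tensor_of_contractible (discContraction k O n) L

theorem acyclic_of_iso {R : Type u} [Ring R] {X Y : ChainComplex (ModuleCat.{u} R) ℕ} (e : X ≅ Y)
    (h : X.Acyclic) : Y.Acyclic := fun n => by
  have := h n
  rw [exactAt_iff_isZero_homology] at this ⊢
  exact this.of_iso ((homologyFunctor _ _ n).mapIso e.symm)

theorem tensor_disc_acyclic (n : ℕ) (L : DGDM k O) : (L ⊗ disc k O n : DGDM k O).Acyclic :=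
  acyclic_of_iso (β_ _ _) (disc_tensor_acyclic n L)

theorem acyclicMono_of_isZero {R : Type u} [Ring R] {X Y : ChainComplex (ModuleCat.{u} R) ℕ}
    (f : X ⟶ Y) (hX : IsZero X) (hY : Y.Acyclic) : acyclicMono R f := by
  rw [acyclicMono_iff]
  refine ⟨⟨fun _ _ _ => hX.eq_of_tgt _ _⟩, fun n y hy => ?_⟩
  have h0 (j : ℕ) (x : X.X j) : f.f j x = 0 := by
    rw [hX.eq_of_src f 0]; rfl
  obtain ⟨e, he⟩ := (exactAt_iff_elements n).1 (hY n) y fun j => by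
    obtain ⟨x, hx⟩ := hy j
    rw [← hx, h0]
  exact ⟨0, e, by rw [map_zero, zero_add, he]⟩

end Contractible

/-! ### The model structure on modules -/

section ModelStructure

open MorphismProperty

variable {k O : Type u} [Field k] [CommRing O] [Algebra k O] [CharZero k] [Algebra.Smooth k O]
  (A : DGDA k O)

instance forget_preservesColimits_dgdm : PreservesColimits (Mod.forget (D := DGDM k O) A.X) :=
  forget_preservesColimits A.X

/-- The generators are `A ⊗ 0 ⟶ A ⊗ Dⁿ`: the source is zero and the target is contractible. -/
theorem modTrivCof_le_acyclicMono :
    modTrivCof A ≤ (acyclicMono (DRing k O)).inverseImage (Mod.forget A.X) := by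
  rintro _ _ _ ⟨⟨n⟩⟩
  exact acyclicMono_of_isZero _ ((tensorLeft A.X).map_isZero (isZero_zero _))
    (tensor_disc_acyclic n A.X)

theorem modTrivCof_llp_rlp_le :
    (modTrivCof A).rlp.llp ≤ (acyclicMono (DRing k O)).inverseImage (Mod.forget A.X) :=
  llp_rlp_le_inverseImage _ (Mod.forget A.X) _ (modTrivCof_le_acyclicMono A)

scoped instance : CategoryWithWeakEquivalences (ModA A) := ⟨weqD.inverseImage (Mod.forget A.X)⟩

scoped instance : CategoryWithFibrations (ModA A) := ⟨fibD.inverseImage (Mod.forget A.X)⟩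

scoped instance : CategoryWithCofibrations (ModA A) := ⟨(modCof A).rlp.llp⟩

theorem fibrations_eq_rlp : fibrations (ModA A) = (modTrivCof A).rlp := (modTrivCof_rlp A).symm

theorem trivialFibrations_eq_rlp : trivialFibrations (ModA A) = (modCof A).rlp :=
  (modCof_rlp A).symm

theorem cofibrations_eq_llp : cofibrations (ModA A) = (modCof A).rlp.llp := rfl

instance : (weakEquivalences (ModA A)).HasTwoOutOfThreeProperty := by
  have : (weqD (k := k) (O := O)).HasTwoOutOfThreeProperty :=
    inferInstanceAs (HomologicalComplex.quasiIso _ _).HasTwoOutOfThreeProperty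
  exact inferInstanceAs (weqD.inverseImage (Mod.forget A.X)).HasTwoOutOfThreeProperty

/-- The retract argument: a trivial cofibration is factored into a map generated by `Σ(J)` and a
fibration. The first is a weak equivalence, so the second is trivial, and the given map is a retract
of the first. -/
theorem trivialCofibrations_eq_llp : trivialCofibrations (ModA A) = (modTrivCof A).rlp.llp := by
  apply le_antisymm
  · intro X Y f hf
    let d := factorizationData (modTrivCof A).rlp.llp (modTrivCof A).rlp f
    have hi : weakEquivalences (ModA A) d.i := (modTrivCof_llp_rlp_le A _ d.hi).2
    have hp : trivialFibrations (ModA A) d.p := by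
      refine ⟨?_, ?_⟩
      · rw [fibrations_eq_rlp]; exact d.hp
      · exact (weakEquivalences (ModA A)).of_precomp d.i d.p hi (by rw [d.fac]; exact hf.2)
    rw [trivialFibrations_eq_rlp] at hp
    have : HasLiftingProperty f d.p := hf.1 _ hp
    exact of_retract (RetractArrow.ofLeftLiftingProperty d.fac) d.hi
  · intro X Y f hf
    refine ⟨?_, (modTrivCof_llp_rlp_le A _ hf).2⟩
    refine antitone_llp ?_ _ hf
    rw [← trivialFibrations_eq_rlp, ← fibrations_eq_rlp]
    exact inf_le_left

instance : HasFunctorialFactorization (cofibrations (ModA A)) (trivialFibrations (ModA A)) := by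
  rw [trivialFibrations_eq_rlp, cofibrations_eq_llp]
  infer_instance

instance : HasFunctorialFactorization (trivialCofibrations (ModA A)) (fibrations (ModA A)) := by
  rw [fibrations_eq_rlp, trivialCofibrations_eq_llp]
  infer_instance

instance : IsWeakFactorizationSystem (cofibrations (ModA A)) (trivialFibrations (ModA A)) where
  rlp := by
    rw [trivialFibrations_eq_rlp, cofibrations_eq_llp, rlp_llp_rlp]
  llp := by
    rw [trivialFibrations_eq_rlp, cofibrations_eq_llp]

instance : IsWeakFactorizationSystem (trivialCofibrations (ModA A)) (fibrations (ModA A)) where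
  rlp := by
    rw [fibrations_eq_rlp, trivialCofibrations_eq_llp, rlp_llp_rlp]
  llp := by
    rw [fibrations_eq_rlp, trivialCofibrations_eq_llp]

/-- The model structure on the category of modules. -/
scoped instance modModelCategory : ModelCategory (ModA A) := ModelCategory.mk' (ModA A)

theorem mod_isCompleteFunctorialModel : IsCompleteFunctorialModel (ModA A) where
  hasLimits := inferInstance
  hasColimits := inferInstance
  cof_trivFib := inferInstance
  trivCof_fib := inferInstance

theorem mod_isCofibrantlyGeneratedBy :
    IsCofibrantlyGeneratedBy (ModA A) (modCof A) (modTrivCof A) where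
  small_cof := permitsSmallObjectArgument _ (modCof_isCardinalPresentable A)
  small_trivCof := permitsSmallObjectArgument _ (modTrivCof_isCardinalPresentable A)
  fibrations_eq := fibrations_eq_rlp A
  trivialFibrations_eq := trivialFibrations_eq_rlp A

end ModelStructure

/-! ### The monoid axiom and the trivial part of the pushout-product axiom -/

section MonoidAxiom

variable {k O : Type u} [Field k] [CommRing O] [Algebra k O] [CharZero k] [Algebra.Smooth k O]
  (A : DGDA k O)

/-- The functor that sends a module to the complex underlying its tensor product with `Z`. -/
abbrev tensorForget (Z : ModA A) : ModA A ⥤ DGDM k O := tensorRight Z ⋙ Mod.forget A.X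

instance (Z : ModA A) : PreservesColimits (tensorForget A Z) := by
  have := mod_tensorRight_preservesColimits A.X Z
  infer_instance

/-- The underlying complex of the tensor product of a free module and a module. -/
def freeTensorArrowIso {X Y : DGDM k O} (f : X ⟶ Y) (Z : ModA A) :
    Arrow.mk (f ▷ Z.X) ≅ Arrow.mk ((tensorForget A Z).map ((freeFunctor A.X).map f)) :=
  Arrow.isoMk (@asIso _ _ _ _ _ (isIso_freeTensor A.X X Z))
    (@asIso _ _ _ _ _ (isIso_freeTensor A.X Y Z)) (freeTensor_whiskerRight A.X f Z)

/-- On generators the tensor product over `A` with `Z` is `0 ⊗ Z ⟶ Dⁿ ⊗ Z`, with acyclic target; the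
functor preserves colimits, so saturation does the rest. -/
theorem trivialCofibrations_le_tensorForget (Z : ModA A) :
    trivialCofibrations (ModA A) ≤
      (acyclicMono (DRing k O)).inverseImage (tensorForget A Z) := by
  rw [trivialCofibrations_eq_llp]
  refine llp_rlp_le_inverseImage _ _ _ ?_
  rintro _ _ _ ⟨⟨n⟩⟩
  refine ((acyclicMono (DRing k O)).arrow_mk_iso_iff (freeTensorArrowIso A _ Z)).1 ?_
  exact acyclicMono_of_isZero _ ((tensorRight Z.X).map_isZero (isZero_zero _))
    (disc_tensor_acyclic n Z.X)

theorem trivialCofibrations_le_tensorLeft_forget (Z : ModA A) :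
    trivialCofibrations (ModA A) ≤
      (acyclicMono (DRing k O)).inverseImage (tensorLeft Z ⋙ Mod.forget A.X) := by
  intro X Y f hf
  have e : Arrow.mk (Z ◁ f) ≅ Arrow.mk (f ▷ Z) :=
    Arrow.isoMk (β_ Z X) (β_ Z Y) (BraidedCategory.braiding_naturality_right Z f).symm
  exact ((acyclicMono (DRing k O)).arrow_mk_iso_iff ((Mod.forget A.X).mapArrow.mapIso e)).2
    (trivialCofibrations_le_tensorForget A Z f hf)

theorem mod_monoidAxiom : MonoidAxiom (ModA A) := by
  refine (cell_le_inverseImage _ (Mod.forget A.X) (acyclicMono (DRing k O)) ?_).trans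
    fun _ _ _ h => h.2
  refine iSup_le fun Z => ?_
  rw [MorphismProperty.map_le_iff]
  exact trivialCofibrations_le_tensorForget A Z

/-- If `f` is trivial, `f ⊗ X'` and `f ⊗ Y'` are acyclic monomorphisms. The pushout of the first,
followed by the pushout-product, is the second; conclude by two out of three. The other case is
symmetric. -/
theorem weakEquivalence_pushoutProduct {X Y X' Y' : ModA A} (f : X ⟶ Y) (g : X' ⟶ Y')
    [Cofibration f] [Cofibration g] (sq : (curriedTensor (ModA A)).PushoutObjObj f g)
    (h : WeakEquivalence f ∨ WeakEquivalence g) : WeakEquivalence sq.ι := by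
  have : PreservesFiniteColimits (Mod.forget (D := DGDM k O) A.X) :=
    PreservesColimits.preservesFiniteColimits _
  have hs := inverseImage_isStableUnderCobaseChange (Mod.forget A.X) (acyclicMono (DRing k O))
  rw [weakEquivalence_iff]
  rcases h with h | h
  · have hf : trivialCofibrations (ModA A) f := mem_trivialCofibrations f
    have h₁ : (acyclicMono (DRing k O)).inverseImage (Mod.forget A.X) sq.inr :=
      hs.of_isPushout sq.isPushout.flip (trivialCofibrations_le_tensorForget A X' f hf)
    have h₂ : weakEquivalences (ModA A) sq.inr := h₁.2
    refine (weakEquivalences (ModA A)).of_precomp sq.inr sq.ι h₂ ?_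
    rw [sq.inr_ι]
    exact (trivialCofibrations_le_tensorForget A Y' f hf).2
  · have hg : trivialCofibrations (ModA A) g := mem_trivialCofibrations g
    have h₁ : (acyclicMono (DRing k O)).inverseImage (Mod.forget A.X) sq.inl :=
      hs.of_isPushout sq.isPushout (trivialCofibrations_le_tensorLeft_forget A X g hg)
    have h₂ : weakEquivalences (ModA A) sq.inl := h₁.2
    refine (weakEquivalences (ModA A)).of_precomp sq.inl sq.ι h₂ ?_
    rw [sq.inl_ι]
    exact (trivialCofibrations_le_tensorLeft_forget A Y g hg).2

end MonoidAxiom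

/-! ### Projectivity of `D` over `O` -/

section Projective

variable {k O : Type u} [Field k] [CommRing O] [Algebra k O]

/-- The commutator with a function, on operators of order `< n + 1`. -/
def commOrd (n : ℕ) (x : O) : ordLTO k O (n + 1) →ₗ[O] ordLTO k O n where
  toFun P := ⟨P.1 * Algebra.lmul k O x - Algebra.lmul k O x * P.1, P.2 x⟩
  map_add' P Q := Subtype.ext (by
    change (P.1 + Q.1) * _ - _ * (P.1 + Q.1) = (_ - _) + (_ - _)
    rw [add_mul, mul_add]; abel)
  map_smul' f P := Subtype.ext (by
    ext y
    change f * P.1 (x * y) - x * (f * P.1 y) = f * (P.1 (x * y) - x * P.1 y)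
    ring)

/-- Composition with a vector field, on operators of order `< n`. -/
def mulOrd (n : ℕ) (θ : Derivation k O O) : ordLTO k O n →ₗ[O] ordLTO k O (n + 1) where
  toFun P := ⟨P.1 * (θ : O →ₗ[k] O), mul_mem_ordLT _ n 2 rfl P.2 (derivation_mem_ordLT k O θ)⟩
  map_add' _ _ := Subtype.ext (add_mul _ _ _)
  map_smul' _ _ := rfl

/-- The inclusion of operators of order `< n` in operators of order `< n + 1`. -/
abbrev inclOrd (k O : Type u) [Field k] [CommRing O] [Algebra k O] (n : ℕ) :
    ordLTO k O n →ₗ[O] ordLTO k O (n + 1) := Submodule.inclusion (ordLT_le_succ n)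

variable {T : Finset O} {t : O → Derivation k O O}

/-- The defect of the Euler formula. -/
def eulerDefect (h : IsDual k O T t) (n : ℕ) : ordLTO k O (n + 1) →ₗ[O] ordLTO k O n :=
  LinearMap.codRestrict _
    (∑ x ∈ T, (ordLTO k O (n + 1)).subtype ∘ₗ mulOrd n (t x) ∘ₗ commOrd n x -
      (n : O) • (ordLTO k O (n + 1)).subtype) (fun P => by
    have := euler_mem h n P.2
    rw [LinearMap.sub_apply, LinearMap.sum_apply]
    rw [← map_natCast (Algebra.lmul k O) n] at this
    exact this)

/-- Euler's formula: `n P` is the sum of the `[P, x] t_x` up to an operator of lower order. For `n >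
0` it expresses `P`, linearly over `O`, through operators of lower order. -/
theorem eulerDefect_add (h : IsDual k O T t) (n : ℕ) (P : ordLTO k O (n + 1)) :
    inclOrd k O n (eulerDefect h n P) + (n : O) • P =
      ∑ x ∈ T, mulOrd n (t x) (commOrd n x P) := by
  apply Subtype.ext
  have e : (eulerDefect h n P).1 = (∑ x ∈ T, mulOrd n (t x) (commOrd n x P)).1 - (n : O) • P.1 := by
    rw [AddSubmonoidClass.coe_finsetSum]
    exact (LinearMap.sub_apply _ _ _).trans (congrArg (· - _) (LinearMap.sum_apply _ _ _))
  exact (congrArg (· + (n : O) • P.1) e).trans (sub_add_cancel _ _)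

/-- A lift on operators of order `< n` extends to order `< n + 1`. Euler's formula, divided by `n`,
prescribes it on `P` from lifts of `Q ↦ φ (Q t_x)` on the commutators `[P, x]`, which have smaller
order, and from `ψ` on the defect. -/
theorem exists_lift_extension [CharZero k] (h : IsDual k O T t) {N N' : Type u} [AddCommGroup N]
    [Module O N] [AddCommGroup N'] [Module O N'] (p : N →ₗ[O] N') (hp : Function.Surjective p) :
    ∀ (n : ℕ) (φ : ordLTO k O (n + 1) →ₗ[O] N') (ψ : ordLTO k O n →ₗ[O] N),
      p ∘ₗ ψ = φ ∘ₗ inclOrd k O n →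
      ∃ ψ' : ordLTO k O (n + 1) →ₗ[O] N, p ∘ₗ ψ' = φ ∧ ψ' ∘ₗ inclOrd k O n = ψ := by
  intro n
  induction n with
  | zero =>
    intro φ ψ _
    -- Operators of order `< 1` are multiplications by functions: a free module on the identity,
    -- while `ψ` lives on the zero module.
    let e : ordLTO k O 1 := ⟨1, by
      have := lmul_mem_ordLT (k := k) (1 : O); rwa [map_one] at this⟩
    obtain ⟨y, hy⟩ := hp (φ e)
    refine ⟨⟨⟨fun P => P.1 1 • y, fun P Q => add_smul _ _ _⟩, fun f P => mul_smul _ _ _⟩, ?_, ?_⟩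
    · ext P
      have hP : P = P.1 1 • e := by
        apply Subtype.ext
        ext x
        have h1 : P.1 * Algebra.lmul k O x - Algebra.lmul k O x * P.1 = 0 := P.2 x
        have h2 : P.1 (x * 1) - x * P.1 1 = 0 := LinearMap.congr_fun h1 1
        rw [mul_one, sub_eq_zero] at h2
        rw [h2, mul_comm]; rfl
      change p (P.1 1 • y) = φ P
      rw [map_smul, hy, ← map_smul, ← hP]
    · ext P
      have hP : P = 0 := Subtype.ext P.2
      rw [hP, map_zero, map_zero]
  | succ n ih =>
    intro φ ψ hψ
    have hψ' (P) : p (ψ P) = φ (inclOrd k O (n + 1) P) := LinearMap.congr_fun hψ P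
    -- The induction hypothesis lifts `Q ↦ φ (Q t_x)`, compatibly with `ψ` on lower order; this
    -- compatibility makes the new lift extend `ψ`.
    choose l hl hl' using fun x => ih (φ ∘ₗ mulOrd (n + 1) (t x)) (ψ ∘ₗ mulOrd n (t x)) (by
      ext P; exact hψ' _)
    obtain ⟨c, hc⟩ := exists_cast_inv k (O := O) n
    refine ⟨c • (∑ x ∈ T, l x ∘ₗ commOrd (n + 1) x - ψ ∘ₗ eulerDefect h (n + 1)), ?_, ?_⟩
    · ext P
      have e := congrArg φ (eulerDefect_add h (n + 1) P)
      rw [map_add, ← hψ', map_smul, map_sum] at e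
      have hl₁ (x Q) : p (l x Q) = φ (mulOrd (n + 1) (t x) Q) := LinearMap.congr_fun (hl x) Q
      simp only [LinearMap.comp_apply, LinearMap.smul_apply, LinearMap.sub_apply,
        LinearMap.sum_apply, map_smul, map_sub, map_sum, hl₁]
      rw [← e, add_sub_cancel_left, smul_smul, hc, one_smul]
    · ext P
      have e := congrArg ψ (eulerDefect_add h n P)
      -- An operator of order `< n + 1` has a defect for the factor `n` and one for `n + 1`; they
      -- differ by the operator itself.
      have e₁ : eulerDefect h (n + 1) (inclOrd k O (n + 1) P) + P =
          inclOrd k O n (eulerDefect h n P) := by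
        have e₂ := eulerDefect_add h (n + 1) (inclOrd k O (n + 1) P)
        have e₃ := eulerDefect_add h n P
        have i : Function.Injective (inclOrd k O (n + 1)) := Submodule.inclusion_injective _
        apply i
        rw [map_add]
        have e₄ := congrArg (inclOrd k O (n + 1)) e₃
        rw [map_add, map_smul, map_sum] at e₄
        push_cast at e₂
        rw [add_smul, one_smul] at e₂
        have e₅ : ∑ x ∈ T, mulOrd (n + 1) (t x) (commOrd (n + 1) x (inclOrd k O (n + 1) P)) =
          ∑ x ∈ T, inclOrd k O (n + 1) (mulOrd n (t x) (commOrd n x P)) := rfl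
        rw [e₅, ← e₄] at e₂
        refine add_right_cancel (b := (n : O) • inclOrd k O (n + 1) P) ?_
        rw [← e₂]; abel
      have hl₁ (x) (Q : ordLTO k O n) : l x (inclOrd k O n Q) = ψ (mulOrd n (t x) Q) :=
        LinearMap.congr_fun (hl' x) Q
      have hl₂ (x) : l x (commOrd (n + 1) x (inclOrd k O (n + 1) P)) =
        ψ (mulOrd n (t x) (commOrd n x P)) := hl₁ x (commOrd n x P)
      rw [map_add, map_smul, map_sum] at e
      simp only [LinearMap.comp_apply, LinearMap.smul_apply, LinearMap.sub_apply,
        LinearMap.sum_apply, hl₂, ← e, ← e₁, map_add]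
      have : ψ (eulerDefect h (n + 1) (inclOrd k O (n + 1) P)) + ψ P + (n : O) • ψ P -
          ψ (eulerDefect h (n + 1) (inclOrd k O (n + 1) P)) = ((n + 1 : ℕ) : O) • ψ P := by
        push_cast
        rw [add_smul, one_smul]; abel
      rw [this, smul_smul, hc, one_smul]

variable (k O) in
/-- All differential operators, as a left module over functions. -/
def allOrd : Submodule O (Module.End k O) where
  carrier := {P | ∃ n, P ∈ ordLT k O n}
  add_mem' := (diffOp k O).add_mem
  zero_mem' := (diffOp k O).zero_mem
  smul_mem' f _ hP := (diffOp k O).mul_mem (funOp k O f).2 hP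

variable (k O) in
theorem ordLTO_le_allOrd (n : ℕ) : ordLTO k O n ≤ allOrd k O := fun _ h => ⟨n, h⟩

/-- Starting from zero on order `< 0`, each lift is extended to the next order, and the increasing
chain of partial lifts is glued. -/
theorem exists_lift_allOrd [CharZero k] (h : IsDual k O T t) {N N' : Type u} [AddCommGroup N]
    [Module O N] [AddCommGroup N'] [Module O N'] (p : N →ₗ[O] N') (hp : Function.Surjective p)
    (φ : allOrd k O →ₗ[O] N') : ∃ ψ : allOrd k O →ₗ[O] N, p ∘ₗ ψ = φ := by
  let S (n : ℕ) := {ψ : ordLTO k O n →ₗ[O] N //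
    p ∘ₗ ψ = φ ∘ₗ Submodule.inclusion (ordLTO_le_allOrd k O n)}
  have hs (n : ℕ) (ψ : S n) : ∃ ψ' : S (n + 1), ψ'.1 ∘ₗ inclOrd k O n = ψ.1 := by
    obtain ⟨ψ', h₁, h₂⟩ := exists_lift_extension h p hp n
      (φ ∘ₗ Submodule.inclusion (ordLTO_le_allOrd k O (n + 1))) ψ.1 ψ.2
    exact ⟨⟨ψ', h₁⟩, h₂⟩
  choose s hs using hs
  let ψ₀ : S 0 := ⟨0, by
    ext P
    have : P = 0 := Subtype.ext P.2
    rw [this, map_zero, map_zero]⟩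
  let q : ∀ n, S n := fun n => Nat.rec ψ₀ s n
  let c (n : ℕ) : Module.End k O →ₗ.[O] N := ⟨ordLTO k O n, (q n).1⟩
  have hc : Monotone c := monotone_nat_of_le_succ fun n => ⟨ordLT_le_succ n, fun x y e => by
    obtain rfl : inclOrd k O n x = y := Subtype.ext e
    exact (LinearMap.congr_fun (hs n (q n)) x).symm⟩
  have hd : DirectedOn (· ≤ ·) (Set.range c) := directedOn_range.2 hc.directed_le
  have hle : allOrd k O ≤ (LinearPMap.sSup _ hd).domain := fun P ⟨n, hP⟩ =>
    (LinearPMap.le_sSup hd ⟨n, rfl⟩).1 hP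
  refine ⟨(LinearPMap.sSup _ hd).toFun ∘ₗ Submodule.inclusion hle, ?_⟩
  ext ⟨P, n, hP⟩
  exact (congrArg p (LinearPMap.sSup_apply hd ⟨n, rfl⟩ ⟨P, hP⟩)).trans
    (LinearMap.congr_fun (q n).2 ⟨P, hP⟩)

/-- The `O`-module of differential operators. -/
def undRegDEquiv : und (regD k O) ≃ₗ[O] allOrd k O where
  toFun P := ⟨Subtype.val (p := (· ∈ diffOp k O)) P, Subtype.prop (p := (· ∈ diffOp k O)) P⟩
  invFun P := (⟨P.1, P.2⟩ : diffOp k O)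
  map_add' _ _ := rfl
  map_smul' _ _ := rfl
  left_inv _ := rfl
  right_inv _ := rfl

instance projective_und_regD [CharZero k] [Algebra.Smooth k O] :
    Module.Projective O (und (regD k O)) := by
  obtain ⟨T, t, h⟩ := exists_isDual k O
  have : Module.Projective O (allOrd k O) :=
    Module.Projective.of_lifting_property'' fun p hp =>
      exists_lift_allOrd h (N := allOrd k O →₀ O) (N' := allOrd k O) p hp LinearMap.id
  exact Module.Projective.of_equiv undRegDEquiv.symm

end Projective

/-! ### `D ⊗ M` as an induced module -/

section Induction

variable {k O : Type u} [Field k] [CommRing O] [Algebra k O] [CharZero k] [Algebra.Smooth k O]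

/-- The action of a vector field on `O`-linear maps. -/
def derHom (M N : DCat k O) (θ : Derivation k O O) :
    (und M →ₗ[O] und N) →+ (und M →ₗ[O] und N) where
  toFun h :=
    { toFun := fun m => derD k O θ • h m - h (derD k O θ • m)
      map_add' := fun x y => by simp only [map_add, smul_add]; abel
      map_smul' := fun f m => by
        simp only [RingHom.id_apply, map_smul, derD_smul, map_add, smul_sub]; abel }
  map_zero' := by ext; simp
  map_add' h h' := by
    ext m
    simp only [LinearMap.add_apply, LinearMap.coe_mk, AddHom.coe_mk, smul_add]; abel

theorem derHom_apply (M N : DCat k O) (θ : Derivation k O O) (h : und M →ₗ[O] und N) (m : und M) :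
    derHom M N θ h m = derD k O θ • h m - h (derD k O θ • m) := rfl

/-- The action of differential operators on `O`-linear maps between `D`-modules. -/
def homAct (M N : DCat k O) : DRing k O →+* AddMonoid.End (und M →ₗ[O] und N) :=
  opLift (Module.toAddMonoidEnd O (und M →ₗ[O] und N))
    { toFun := derHom M N
      map_zero' := by
        ext h m
        have : derD k O 0 = 0 := rfl
        change derHom M N 0 h m = 0
        simp [derHom_apply, this]
      map_add' := fun θ η => by
        ext h m
        have : derD k O (θ + η) = derD k O θ + derD k O η := rfl
        change derHom M N (θ + η) h m = derHom M N θ h m + derHom M N η h m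
        simp only [derHom_apply, this, add_smul, map_add]
        abel }
    (fun f θ => by
      ext h m
      have : derD k O (f • θ) = funD k O f * derD k O θ := rfl
      change derHom M N (f • θ) h m = f • derHom M N θ h m
      simp only [derHom_apply, this, mul_smul, funD_smul, map_smul, smul_sub])
    (fun θ η => by
      ext h m
      change derHom M N ⁅θ, η⁆ h m =
        derHom M N θ (derHom M N η h) m - derHom M N η (derHom M N θ h) m
      simp only [derHom_apply, lie_smul, map_sub, smul_sub]
      abel)
    (fun θ f => by
      ext h m
      change derHom M N θ (f • h) m = f • derHom M N θ h m + θ f • h m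
      simp only [derHom_apply, LinearMap.smul_apply, derD_smul, smul_sub]
      abel)

theorem homAct_funD (M N : DCat k O) (f : O) (h : und M →ₗ[O] und N) :
    homAct M N (funD k O f) h = f • h := DFunLike.congr_fun (opLift_funD ..) h

theorem homAct_derD (M N : DCat k O) (θ : Derivation k O O) (h : und M →ₗ[O] und N) :
    homAct M N (derD k O θ) h = derHom M N θ h := DFunLike.congr_fun (opLift_derD ..) h

open scoped TensorProduct

/-- The `O`-linear map `P ↦ P φ` from differential operators to `O`-linear maps. -/
def orbitMap {M N : DCat k O} (φ : und M →ₗ[O] und N) :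
    und (regD k O) →ₗ[O] (und M →ₗ[O] und N) where
  toFun P := homAct M N P φ
  map_add' P Q := DFunLike.congr_fun (map_add (homAct M N) P Q) φ
  map_smul' f P := (DFunLike.congr_fun (map_mul (homAct M N) (funD k O f) P) φ).trans
    (homAct_funD M N f _)

theorem orbitMap_derD {M N : DCat k O} (φ : und M →ₗ[O] und N) (θ : Derivation k O O)
    (P : und (regD k O)) (m : und M) : orbitMap φ (derD k O θ • P) m =
      derD k O θ • orbitMap φ P m - orbitMap φ P (derD k O θ • m) :=
  LinearMap.congr_fun ((DFunLike.congr_fun (map_mul (homAct M N) (derD k O θ) P) φ).trans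
    (homAct_derD M N θ _)) m

/-- The `O`-linear map `P ⊗ m ↦ (P φ) m`. -/
def orbitDesc {M N : DCat k O} (φ : und M →ₗ[O] und N) : und (regD k O) ⊗ und M ⟶ und N :=
  ModuleCat.ofHom (Y := und N) (TensorProduct.lift (orbitMap φ))

/-- The morphism `D ⊗ M ⟶ N` that extends an `O`-linear map `M ⟶ N`. -/
def inducedHom {M N : DCat k O} (φ : und M →ₗ[O] und N) : tensorD (regD k O) M ⟶ N :=
  homOfRes ((tensorDIso (regD k O) M).inv ≫ orbitDesc φ)
    fun θ => derD_tensor_desc _ θ fun P m =>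
      (congrArg (· + _) (orbitMap_derD φ θ P m)).trans (sub_add_cancel _ _)

/-- The element `P ⊗ m` of `D ⊗ M`. -/
abbrev opTmul (M : DCat k O) (P : und (regD k O)) (m : und M) : und (tensorD (regD k O) M) :=
  (tensorDIso (regD k O) M).hom.hom (P ⊗ₜ m)

/-- The morphisms out of `D ⊗ M` are determined by their values on the elements `1 ⊗ m`. -/
theorem induced_hom_ext {M N : DCat k O} {g g' : tensorD (regD k O) M ⟶ N}
    (h : ∀ m : und M, g.hom (opTmul M (1 : DRing k O) m) = g'.hom (opTmul M (1 : DRing k O) m)) :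
    g = g' := by
  suffices H : ∀ (P : DRing k O) (m : und M), g.hom (opTmul M P m) = g'.hom (opTmul M P m) by
    apply (resO k O).map_injective
    rw [← cancel_epi (tensorDIso (regD k O) M).hom]
    exact ModuleCat.hom_ext (TensorProduct.ext' H)
  intro P
  obtain ⟨u, rfl⟩ := (envEquivD k O).surjective P
  change ∀ m, g.hom (opTmul M (envD k O u) m) = g'.hom (opTmul M (envD k O u) m)
  induction u using env_induction with
  | one => rw [map_one]; exact h
  | add u v hu hv =>
    intro m
    have e : opTmul M (envD k O (u + v)) m = opTmul M (envD k O u) m + opTmul M (envD k O v) m := by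
      rw [map_add]
      exact (congrArg _ (TensorProduct.add_tmul _ _ _)).trans (map_add _ _ _)
    rw [e]
    exact (map_add g.hom _ _).trans
      ((congrArg₂ (· + ·) (hu m) (hv m)).trans (map_add g'.hom _ _).symm)
  | neg u hu =>
    intro m
    have e : opTmul M (envD k O (-u)) m = -opTmul M (envD k O u) m := by
      rw [map_neg]
      exact (congrArg _ (TensorProduct.neg_tmul _ _)).trans (map_neg _ _)
    rw [e]
    exact (map_neg g.hom _).trans ((congrArg (- ·) (hu m)).trans (map_neg g'.hom _).symm)
  | hf f u hu =>
    intro m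
    have e : opTmul M (envD k O (ef f * u)) m = funD k O f • opTmul M (envD k O u) m := by
      rw [map_mul, envD_ef]
      exact (funD_tensorDEquiv (regD k O) M f (envD k O u ⊗ₜ m)).symm
    rw [e]
    exact (g.hom.map_smul _ _).trans ((congrArg _ (hu m)).trans (g'.hom.map_smul _ _).symm)
  | hd θ u hu =>
    intro m
    -- Leibniz rule: `θ u ⊗ m = θ (u ⊗ m) - u ⊗ θ m`. The induction on words must therefore keep `m`
    -- arbitrary.
    have e : opTmul M (envD k O (ed θ * u)) m + opTmul M (envD k O u) (derD k O θ • m) =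
        derD k O θ • opTmul M (envD k O u) m := by
      rw [map_mul, envD_ed]
      exact (derD_tensorDIso (regD k O) M θ _ _).symm
    have e' := fun l : tensorD (regD k O) M ⟶ N =>
      (map_add l.hom _ _).symm.trans ((congrArg l.hom e).trans (l.hom.map_smul _ _))
    have e₁ := (e' g).trans ((congrArg (derD k O θ • ·) (hu m)).trans (e' g').symm)
    rw [hu] at e₁
    exact add_right_cancel e₁

/-- `D`-linear maps `D ⊗ M ⟶ N` correspond to `O`-linear maps `M ⟶ N` by restriction to `1 ⊗ M`, so
lifting problems are solved over `O`. -/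
instance projective_regD_tensor (M : DCat k O) [Module.Projective O (und M)] :
    Projective (regD k O ⊗ M) where
  factors {E X} f e he := by
    have hs : Function.Surjective e := (ModuleCat.epi_iff_surjective e).1 he
    let φ : und M →ₗ[O] und X := ((resO k O).map f).hom ∘ₗ (tensorDIso (regD k O) M).hom.hom ∘ₗ
      TensorProduct.mk O (und (regD k O)) (und M) (1 : DRing k O)
    obtain ⟨ψ, hψ⟩ := Module.projective_lifting_property ((resO k O).map e).hom φ hs
    refine ⟨inducedHom ψ, induced_hom_ext (g := inducedHom ψ ≫ e) fun m => ?_⟩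
    have : orbitMap ψ (1 : DRing k O) m = ψ m :=
      LinearMap.congr_fun (DFunLike.congr_fun (map_one (homAct M E)) ψ) m
    exact (congrArg e.hom this).trans (LinearMap.congr_fun hψ m)

end Induction

/-! ### Pushout-products of maps attaching one cell -/

section CellMaps

open Category

universe v w

/-- A morphism of complexes that attaches one cell, of dimension `n`, and nothing else. -/
structure IsCell {C : Type w} [Category.{v} C] [Preadditive C] {X Y : ChainComplex C ℕ}
    (i : X ⟶ Y) (n : ℕ) : Prop where
  isIso (q : ℕ) : q ≠ n → IsIso (i.f q)
  isZero_left : IsZero (X.X n)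
  isZero_right (q : ℕ) : q ≠ n → q + 1 ≠ n → IsZero (Y.X q)

theorem IsCell.isZero_left_of_ne {C : Type w} [Category.{v} C] [Preadditive C]
    {X Y : ChainComplex C ℕ} {i : X ⟶ Y} {n : ℕ} (h : IsCell i n) (q : ℕ) (hq : q + 1 ≠ n) :
    IsZero (X.X q) := by
  by_cases hn : q = n
  · rw [hn]; exact h.isZero_left
  · have := h.isIso q hn
    exact (h.isZero_right q hn hq).of_iso (asIso (i.f q))

variable {C : Type w} [Category.{v} C] [Preadditive C] [MonoidalCategory C] [MonoidalPreadditive C]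
  [HasFiniteCoproducts C] [HasZeroObject C] [SymmetricCategory C]

theorem isZero_tensor_of_left {X : C} (Y : C) (h : IsZero X) : IsZero (X ⊗ Y) :=
  (tensorRight Y).map_isZero h

theorem isZero_tensor_of_right (X : C) {Y : C} (h : IsZero Y) : IsZero (X ⊗ Y) :=
  (tensorLeft X).map_isZero h

theorem isZero_tensor_X {K L : ChainComplex C ℕ} {i : ℕ}
    (h : ∀ p q, p + q = i → IsZero (K.X p ⊗ L.X q)) : IsZero ((K ⊗ L : ChainComplex C ℕ).X i) := by
  rw [IsZero.iff_id_eq_zero]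
  exact cι_ext fun p q hpq => (h p q hpq).eq_of_src _ _

theorem isIso_cι {K L : ChainComplex C ℕ} {p q i : ℕ} (h : p + q = i)
    (hz : ∀ p' q', p' + q' = i → p' ≠ p → IsZero (K.X p' ⊗ L.X q')) : IsIso (cι K L p q i h) := by
  let r : (K ⊗ L : ChainComplex C ℕ).X i ⟶ K.X p ⊗ L.X q := cdesc fun p' q' h' =>
    if e : p' = p then eqToHom (by obtain rfl : q' = q := by omega
                                   rw [e]) else 0
  have hr : cι K L p q i h ≫ r = 𝟙 _ := by rw [cι_desc, dif_pos rfl]; rfl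
  refine ⟨r, hr, cι_ext fun p' q' h' => ?_⟩
  by_cases e : p' = p
  · subst e
    obtain rfl : q' = q := by omega
    rw [reassoc_of% hr, comp_id]
  · exact (hz p' q' h' e).eq_of_src _ _

section PushoutProduct

variable {X Y X' Y' P : ChainComplex C ℕ} {i : X ⟶ Y} {j : X' ⟶ Y'} {a b : ℕ}
  {inl : Y ⊗ X' ⟶ P} {inr : X ⊗ Y' ⟶ P} {ι : P ⟶ Y ⊗ Y'}

/-- `Y` lives in degrees `a` and `a - 1`, and `Y'` in degrees `b` and `b - 1`, so a single summand
reaches degree `a + b`. -/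
theorem isIso_cι_top (hi : IsCell i a) (hj : IsCell j b) :
    IsIso (cι Y Y' a b (a + b) rfl) := by
  refine isIso_cι rfl fun p q hpq hp => ?_
  by_cases hp' : p + 1 = a
  · exact isZero_tensor_of_right _ (hj.isZero_right q (by omega) (by omega))
  · exact isZero_tensor_of_left _ (hi.isZero_right p hp hp')

theorem isPushout_eval [HasColimits C] (sq : IsPushout (i ▷ X') (X ◁ j) inl inr) (m : ℕ) :
    IsPushout ((i ▷ X').f m) ((X ◁ j).f m) (inl.f m) (inr.f m) :=
  sq.map (HomologicalComplex.eval C (ComplexShape.down ℕ) m)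

/-- `X` lives only in degree `a - 1` and `X'` only in degree `b - 1`, so both pieces of the pushout
vanish in degree `a + b`. -/
theorem isZero_pushout_X [HasColimits C] (hi : IsCell i a) (hj : IsCell j b)
    (sq : IsPushout (i ▷ X') (X ◁ j) inl inr) : IsZero (P.X (a + b)) := by
  rw [IsZero.iff_id_eq_zero]
  refine (isPushout_eval sq (a + b)).hom_ext ?_ ?_
  · refine IsZero.eq_of_src (isZero_tensor_X fun p q hpq => ?_) _ _
    by_cases hp : p = a ∨ p + 1 = a
    · exact isZero_tensor_of_right _ (hj.isZero_left_of_ne q (by omega))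
    · exact isZero_tensor_of_left _ (hi.isZero_right p (by omega) (by omega))
  · refine IsZero.eq_of_src (isZero_tensor_X fun p q hpq => ?_) _ _
    by_cases hp : p + 1 = a
    · exact isZero_tensor_of_right _ (hj.isZero_right q (by omega) (by omega))
    · exact isZero_tensor_of_left _ (hi.isZero_left_of_ne p hp)

/-- For `p + q ≠ a + b`, either `i` is invertible in degree `p` or `j` is invertible in degree `q`,
so the summand `Y_p ⊗ Y'_q` already lies in one of the two pieces glued in `P`. -/
theorem isIso_pushoutProduct_f [HasColimits C] (hi : IsCell i a) (hj : IsCell j b)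
    (sq : IsPushout (i ▷ X') (X ◁ j) inl inr) (hl : inl ≫ ι = Y ◁ j) (hr : inr ≫ ι = i ▷ Y')
    (m : ℕ) (hm : m ≠ a + b) : IsIso (ι.f m) := by
  have hj' (q) (hq : q ≠ b) := hj.isIso q hq
  have hi' (p) (hp : p ≠ a) := hi.isIso p hp
  have hl' : inl.f m ≫ ι.f m = (Y ◁ j : Y ⊗ X' ⟶ Y ⊗ Y').f m := by rw [← hl]; rfl
  have hr' : inr.f m ≫ ι.f m = (i ▷ Y' : X ⊗ Y' ⟶ Y ⊗ Y').f m := by rw [← hr]; rfl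
  -- If `q = b` then `p ≠ a`, and the summand is pulled back to `X ⊗ Y'`; otherwise to `Y ⊗ X'`.
  let c (p q : ℕ) (h : p + q = m) : Y.X p ⊗ Y'.X q ⟶ P.X m :=
    if hq : q = b then
      have := hi' p (by omega)
      (inv (i.f p) ▷ Y'.X q) ≫ cι X Y' p q m h ≫ inr.f m
    else
      have := hj' q hq
      (Y.X p ◁ inv (j.f q)) ≫ cι Y X' p q m h ≫ inl.f m
  refine ⟨cdesc c, (isPushout_eval sq m).hom_ext ?_ ?_, cι_ext fun p q h => ?_⟩
  · rw [reassoc_of% hl']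
    refine (cι_ext fun p q h => ?_)
    rw [cι_whiskerLeft_assoc, cι_desc, comp_id]
    by_cases hq : q = b
    · exact (isZero_tensor_of_right _ (hq ▸ hj.isZero_left)).eq_of_src _ _
    · have := hj' q hq
      simp only [c]
      rw [dif_neg hq, ← whiskerLeft_comp_assoc, IsIso.hom_inv_id, whiskerLeft_id, id_comp]
  · rw [reassoc_of% hr']
    refine (cι_ext fun p q h => ?_)
    rw [cι_whiskerRight_assoc, cι_desc, comp_id]
    by_cases hq : q = b
    · have := hi' p (by omega)
      simp only [c]
      rw [dif_pos hq, ← comp_whiskerRight_assoc, IsIso.hom_inv_id, id_whiskerRight, id_comp]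
    · have := hj' q hq
      simp only [c]
      -- For a summand of `X ⊗ Y'` sent through `Y ⊗ X'`, the relation defining the pushout
      -- identifies the two routes.
      have e : (i ▷ X' : X ⊗ X' ⟶ Y ⊗ X').f m ≫ inl.f m = (X ◁ j : X ⊗ X' ⟶ X ⊗ Y').f m ≫ inr.f m :=
        (isPushout_eval sq m).w
      rw [dif_neg hq, ← whisker_exchange_assoc, ← cι_whiskerRight_assoc, e,
        cι_whiskerLeft_assoc, ← whiskerLeft_comp_assoc, IsIso.inv_hom_id, whiskerLeft_id, id_comp]
  · rw [← assoc, cι_desc, comp_id]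
    by_cases hq : q = b
    · have := hi' p (by omega)
      simp only [c]
      rw [dif_pos hq, assoc, assoc, hr', cι_whiskerRight, ← comp_whiskerRight_assoc,
        IsIso.inv_hom_id, id_whiskerRight, id_comp]
    · have := hj' q hq
      simp only [c]
      rw [dif_neg hq, assoc, assoc, hl', cι_whiskerLeft, ← whiskerLeft_comp_assoc,
        IsIso.inv_hom_id, whiskerLeft_id, id_comp]

end PushoutProduct

end CellMaps

/-! ### Lifting a projective cell against a trivial fibration -/

section CellLifting

variable {R : Type u} [Ring R] {K L M M' : ChainComplex (ModuleCat.{u} R) ℕ}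

/-- Elementwise, any compatible pair of boundary and image is realized, since `p` is a trivial
fibration. Hence the pair `(z, v)` maps `P` into the range of `(d, p)`, and projectivity lifts it.
-/
theorem exists_cell_lift {p : M ⟶ M'} (hp : ∀ n, 0 < n → Function.Surjective (p.f n))
    (hq : QuasiIso p) {P : ModuleCat.{u} R} [Module.Projective R P] {n : ℕ} (v : P ⟶ M'.X n)
    (z : ∀ j, P ⟶ M.X j) (hz : ∀ j l, z j ≫ M.d j l = 0) (h : ∀ j, z j ≫ p.f j = v ≫ M'.d n j)
    (h0 : ∀ j, j + 1 ≠ n → z j = 0) :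
    ∃ w : P ⟶ M.X n, w ≫ p.f n = v ∧ ∀ j, w ≫ M.d n j = z j := by
  obtain ⟨hs₀, hs⟩ := (surjective_quasiIso_iff p).1 ⟨hp, hq⟩
  obtain _ | n := n
  · obtain ⟨w, hw⟩ := Module.projective_lifting_property (p.f 0).hom v.hom hs₀
    refine ⟨ModuleCat.ofHom w, ModuleCat.hom_ext hw, fun j => ?_⟩
    rw [M.shape _ _ (by simp), comp_zero, h0 j (by omega)]
  · let Φ := (M.d (n + 1) n).hom.prod (p.f (n + 1)).hom
    let Ψ := (z n).hom.prod v.hom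
    have hr (x : P) : Ψ x ∈ LinearMap.range Φ := by
      obtain ⟨e, he, he'⟩ := hs n (z n x) (v x)
        (fun l => congrArg (fun f => f.hom x) (hz n l))
        (congrArg (fun f => f.hom x) (h n)).symm
      exact ⟨e, Prod.ext he he'⟩
    obtain ⟨w, hw⟩ := Module.projective_lifting_property Φ.rangeRestrict (Ψ.codRestrict _ hr)
      Φ.surjective_rangeRestrict
    have hw' (x) : Φ (w x) = Ψ x := congrArg Subtype.val (LinearMap.congr_fun hw x)
    refine ⟨ModuleCat.ofHom w, ?_, fun j => ?_⟩
    · ext x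
      exact congrArg Prod.snd (hw' x)
    · by_cases hj : j = n
      · subst hj
        ext x
        exact congrArg Prod.fst (hw' x)
      · rw [M.shape _ _ (by simp; omega), comp_zero, h0 j (by omega)]

/-- Away from degree `n` the lift is forced by the inverse of `ι`; in degree `n` the projective cell
is lifted with its boundary prescribed by `u`. -/
theorem hasLiftingProperty_of_cell {ι : K ⟶ L} {n : ℕ} (hι : ∀ m, m ≠ n → IsIso (ι.f m))
    (hK : IsZero (K.X n)) [Module.Projective R (L.X n)] {p : M ⟶ M'}
    (hp : ∀ n, 0 < n → Function.Surjective (p.f n)) (hq : QuasiIso p) :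
    HasLiftingProperty ι p where
  sq_hasLift {u v} sq := by
    have hr (m : ℕ) : ∃ r : L.X m ⟶ K.X m, m ≠ n → ι.f m ≫ r = 𝟙 _ ∧ r ≫ ι.f m = 𝟙 _ := by
      by_cases hm : m = n
      · exact ⟨0, fun h => (h hm).elim⟩
      · have := hι m hm
        exact ⟨inv (ι.f m), fun _ => by simp⟩
    choose r hr using hr
    have hw (m : ℕ) : u.f m ≫ p.f m = ι.f m ≫ v.f m :=
      congrArg (fun f => HomologicalComplex.Hom.f f m) sq.w
    have hd (m l : ℕ) (hm : m ≠ n) : L.d m l = r m ≫ K.d m l ≫ ι.f l := by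
      rw [← ι.comm, ← Category.assoc, (hr m hm).2, Category.id_comp]
    have hne {j : ℕ} (hj : ¬ L.d n j = 0) : j ≠ n := by
      rintro rfl
      exact hj (L.shape _ _ (by simp))
    obtain ⟨w, hw₁, hw₂⟩ := exists_cell_lift hp hq (v.f n) (fun j => L.d n j ≫ r j ≫ u.f j)
      (fun j l => by
        by_cases hj : L.d n j = 0
        · simp [hj]
        have e : (L.d n j ≫ r j ≫ K.d j l) ≫ u.f l = 0 := by
          by_cases hl : l = n
          · subst hl; rw [hK.eq_of_src (u.f l) 0, comp_zero]
          have : L.d n j ≫ r j ≫ K.d j l ≫ ι.f l ≫ r l = 0 := by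
            have h₁ := L.d_comp_d n j l
            rw [hd j l (hne hj)] at h₁
            have h₂ := congrArg (· ≫ r l) h₁
            simpa using h₂
          rw [(hr l hl).1, Category.comp_id] at this
          rw [this, zero_comp]
        simpa using e)
      (fun j => by
        by_cases hj : L.d n j = 0
        · rw [v.comm]; simp [hj]
        · simp only [Category.assoc]
          rw [hw, ← Category.assoc (r j), (hr j (hne hj)).2, Category.id_comp, v.comm])
      (fun j hj => by rw [L.shape _ _ (by simpa using hj), zero_comp])
    let g : ∀ m, L.X m ⟶ M.X m := Function.update (fun m => r m ≫ u.f m) n w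
    have hgn : g n = w := Function.update_self ..
    have hg (m : ℕ) (hm : m ≠ n) : g m = r m ≫ u.f m := Function.update_of_ne hm ..
    refine ⟨⟨⟨⟨g, fun i j hij => ?_⟩, ?_, ?_⟩⟩⟩
    · have hij' : j + 1 = i := hij
      by_cases hi : i = n
      · subst hi
        rw [hgn, hw₂, hg j (by omega)]
      · rw [hg i hi, Category.assoc, u.comm, hd i j hi, Category.assoc, Category.assoc]
        by_cases hj : j = n
        · subst hj
          rw [hK.eq_of_tgt (K.d i j) 0]
          simp
        · rw [hg j hj, ← Category.assoc (ι.f j), (hr j hj).1, Category.id_comp]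
    · ext1 m
      change ι.f m ≫ g m = u.f m
      by_cases hm : m = n
      · subst hm
        exact hK.eq_of_src _ _
      · rw [hg m hm, ← Category.assoc, (hr m hm).1, Category.id_comp]
    · ext1 m
      change g m ≫ p.f m = v.f m
      by_cases hm : m = n
      · subst hm
        rw [hgn, hw₁]
      · rw [hg m hm, Category.assoc, hw, ← Category.assoc, (hr m hm).2, Category.id_comp]

end CellLifting

/-! ### The generating cofibrations as cell attachments -/

section CellGenerators

open ZeroObject

variable {k O : Type u} [Field k] [CommRing O] [Algebra k O]

theorem isCell_zero_sphere : IsCell (0 : (0 : DGDM k O) ⟶ sphere k O 0) 0 where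
  isIso q hq := by
    have h₁ : IsZero ((0 : DGDM k O).X q) :=
      (HomologicalComplex.eval _ _ q).map_isZero (isZero_zero _)
    have h₂ : IsZero ((sphere k O 0).X q) := HomologicalComplex.isZero_single_obj_X _ _ _ _ hq
    exact ⟨0, h₁.eq_of_src _ _, h₂.eq_of_src _ _⟩
  isZero_left := (HomologicalComplex.eval _ _ 0).map_isZero (isZero_zero _)
  isZero_right q hq _ := HomologicalComplex.isZero_single_obj_X _ _ _ _ hq

theorem isCell_sphereToDisc (n : ℕ) : IsCell (sphereToDisc k O n) (n + 1) where
  isIso q hq := by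
    by_cases h : q = n
    · subst h
      have : (sphereToDisc k O q).f q = (HomologicalComplex.singleObjXSelf _ q _).hom ≫ _ :=
        HomologicalComplex.mkHomFromSingle_f _ _
      rw [this]
      exact (HomologicalComplex.singleObjXSelf _ q _ ≪≫
        (HomologicalComplex.doubleXIso₁ (𝟙 (regD k O)) _ (by simp)).symm).isIso_hom
    · have h₁ : IsZero ((sphere k O n).X q) := HomologicalComplex.isZero_single_obj_X _ _ _ _ h
      have h₂ : IsZero ((disc k O n).X q) := HomologicalComplex.isZero_double_X _ _ _ hq h
      exact ⟨0, h₁.eq_of_src _ _, h₂.eq_of_src _ _⟩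
  isZero_left := HomologicalComplex.isZero_single_obj_X _ _ _ _ (by omega)
  isZero_right q hq hq' := HomologicalComplex.isZero_double_X _ _ _ hq (by omega)

theorem genCof_isCell {X Y : DGDM k O} {i : X ⟶ Y} (hi : genCof k O i) :
    ∃ n, IsCell i n ∧ Nonempty (Y.X n ≅ regD k O) := by
  obtain _ | n := hi
  · exact ⟨0, isCell_zero_sphere, ⟨HomologicalComplex.singleObjXSelf _ 0 _⟩⟩
  · exact ⟨n + 1, isCell_sphereToDisc n, ⟨HomologicalComplex.doubleXIso₀ _ _⟩⟩

end CellGenerators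

/-! ### The pushout-product of cofibrations -/

section PushoutProductAxiom

open scoped MonoidalCategory.Arrow

variable {k O : Type u} [Field k] [CommRing O] [Algebra k O] [CharZero k] [Algebra.Smooth k O]

/-- The pushout-product attaches one cell, isomorphic to `D ⊗ D`; it is projective over `D` because
`D` is projective over `O`. -/
theorem genCof_pushoutProduct_lifting {X Y X' Y' P : DGDM k O} {i : X ⟶ Y} {j : X' ⟶ Y'}
    (hi : genCof k O i) (hj : genCof k O j) {inl : Y ⊗ X' ⟶ P} {inr : X ⊗ Y' ⟶ P}
    (sq : IsPushout (i ▷ X') (X ◁ j) inl inr) {ι : P ⟶ Y ⊗ Y'} (hl : inl ≫ ι = Y ◁ j)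
    (hr : inr ≫ ι = i ▷ Y') {M M' : DGDM k O} {p : M ⟶ M'} (hp : fibD p) (hq : weqD p) :
    HasLiftingProperty ι p := by
  obtain ⟨a, ha, ⟨e⟩⟩ := genCof_isCell hi
  obtain ⟨b, hb, ⟨e'⟩⟩ := genCof_isCell hj
  have := isIso_cι_top ha hb
  have : Projective (Y.X a ⊗ Y'.X b) := Projective.of_iso (e ⊗ᵢ e').symm inferInstance
  have : Projective ((Y ⊗ Y' : DGDM k O).X (a + b)) :=
    Projective.of_iso (asIso (cι Y Y' a b (a + b) rfl)) inferInstance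
  have : Module.Projective (DRing k O) ((Y ⊗ Y' : DGDM k O).X (a + b)) :=
    (IsProjective.iff_projective _).2 this
  exact hasLiftingProperty_of_cell (isIso_pushoutProduct_f ha hb sq hl hr)
    (isZero_pushout_X ha hb sq) hp hq

variable (A : DGDA k O)

/-- Free modules turn the lifting problem into one in `DGDM` for the pushout-product of the
underlying generators: restrict along `freeTm`, lift there, and extend the lift by freeness. -/
theorem modCof_pushoutProduct_lifting {X Y X' Y' : ModA A} {i : X ⟶ Y} {j : X' ⟶ Y'}
    (hi : modCof A i) (hj : modCof A j) (sq : (curriedTensor (ModA A)).PushoutObjObj i j)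
    {M M' : ModA A} {p : M ⟶ M'} (hp : (modCof A).rlp p) : HasLiftingProperty sq.ι p := by
  cases hi with | @map X Y i hi =>
  cases hj with | @map X' Y' j hj =>
  rw [modCof_rlp] at hp
  refine ⟨fun {u v} w => ?_⟩
  let a : Y ⊗ X' ⟶ M.X := freeTm A.X Y X' ≫ (sq.inl ≫ u).hom
  let b : X ⊗ Y' ⟶ M.X := freeTm A.X X Y' ≫ (sq.inr ≫ u).hom
  have hab : (i ▷ X') ≫ a = (X ◁ j) ≫ b := by
    have e₁ : (i ▷ X') ≫ a = freeTm A.X X X' ≫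
        (((freeFunctor A.X).map i ▷ (freeFunctor A.X).obj X') ≫ sq.inl ≫ u).hom :=
      (Category.assoc _ _ _).symm.trans
        ((congrArg (· ≫ (sq.inl ≫ u).hom) (freeTm_whiskerRight A.X i X').symm).trans
          (Category.assoc _ _ _))
    have e₂ : (X ◁ j) ≫ b = freeTm A.X X X' ≫
        (((freeFunctor A.X).obj X ◁ (freeFunctor A.X).map j) ≫ sq.inr ≫ u).hom :=
      (Category.assoc _ _ _).symm.trans
        ((congrArg (· ≫ (sq.inr ≫ u).hom) (freeTm_whiskerLeft A.X X j).symm).trans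
          (Category.assoc _ _ _))
    rw [e₁, e₂]
    congr 2
    exact sq.isPushout.w_assoc u
  have hι : (i ▷ X') ≫ (Y ◁ j) = (X ◁ j) ≫ (i ▷ Y') := (whisker_exchange i j).symm
  have hv₁ : a ≫ p.hom = (Y ◁ j) ≫ freeTm A.X Y Y' ≫ v.hom := by
    have e : sq.inl ≫ u ≫ p = ((freeFunctor A.X).obj Y ◁ (freeFunctor A.X).map j) ≫ v := by
      rw [w.w]
      exact sq.inl_ι_assoc v
    exact (Category.assoc _ _ _).trans
      ((congrArg (fun f => freeTm A.X Y X' ≫ Mod.Hom.hom f) e).trans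
      ((Category.assoc _ _ _).symm.trans
        ((congrArg (· ≫ v.hom) (freeTm_whiskerLeft A.X Y j)).trans (Category.assoc _ _ _))))
  have hv₂ : b ≫ p.hom = (i ▷ Y') ≫ freeTm A.X Y Y' ≫ v.hom := by
    have e : sq.inr ≫ u ≫ p = ((freeFunctor A.X).map i ▷ (freeFunctor A.X).obj Y') ≫ v := by
      rw [w.w]
      exact sq.inr_ι_assoc v
    exact (Category.assoc _ _ _).trans
      ((congrArg (fun f => freeTm A.X X Y' ≫ Mod.Hom.hom f) e).trans
      ((Category.assoc _ _ _).symm.trans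
        ((congrArg (· ≫ v.hom) (freeTm_whiskerRight A.X i Y')).trans (Category.assoc _ _ _))))
  have hlift := genCof_pushoutProduct_lifting hi hj (IsPushout.of_hasPushout (i ▷ X') (X ◁ j))
    (pushout.inl_desc _ _ hι) (pushout.inr_desc _ _ hι) hp.1 hp.2
  have w' : CommSq (pushout.desc a b hab) (pushout.desc _ _ hι) p.hom
      (freeTm A.X Y Y' ≫ v.hom) := ⟨by
    apply pushout.hom_ext
    · rw [pushout.inl_desc_assoc, pushout.inl_desc_assoc, hv₁]
    · rw [pushout.inr_desc_assoc, pushout.inr_desc_assoc, hv₂]⟩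
  have : w'.HasLift := hlift.sq_hasLift w'
  obtain ⟨l, hl⟩ := freeTm_desc A.X w'.lift
  have hl₁ : (Y ◁ j) ≫ w'.lift = a := by
    have e := congrArg (pushout.inl _ _ ≫ ·) w'.fac_left
    simpa only [pushout.inl_desc_assoc, pushout.inl_desc] using e
  have hl₂ : (i ▷ Y') ≫ w'.lift = b := by
    have e := congrArg (pushout.inr _ _ ≫ ·) w'.fac_left
    simpa only [pushout.inr_desc_assoc, pushout.inr_desc] using e
  refine ⟨⟨⟨l, sq.hom_ext ?_ ?_, freeTm_ext A.X ?_⟩⟩⟩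
  · refine (sq.inl_ι_assoc l).trans (freeTm_ext A.X ?_)
    exact (Category.assoc _ _ _).symm.trans
        ((congrArg (· ≫ l.hom) (freeTm_whiskerLeft A.X Y j)).trans
          ((Category.assoc _ _ _).trans ((congrArg (_ ≫ ·) hl).trans hl₁)))
  · refine (sq.inr_ι_assoc l).trans (freeTm_ext A.X ?_)
    exact (Category.assoc _ _ _).symm.trans
        ((congrArg (· ≫ l.hom) (freeTm_whiskerRight A.X i Y')).trans
          ((Category.assoc _ _ _).trans ((congrArg (_ ≫ ·) hl).trans hl₂)))
  · exact (Category.assoc _ _ _).symm.trans ((congrArg (· ≫ p.hom) hl).trans w'.fac_right)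

/-- Lifting `f □ g` against `p` amounts to lifting either variable against a pullback-hom. The case
of two generators is first extended to arbitrary `f`, then to arbitrary `g`. -/
theorem cofibrations_pushoutProduct {X Y X' Y' : ModA A} (f : X ⟶ Y) (g : X' ⟶ Y')
    [hf : Cofibration f] [hg : Cofibration g]
    (sq : (curriedTensor (ModA A)).PushoutObjObj f g) : Cofibration sq.ι := by
  have hf' : (modCof A).rlp.llp f := (cofibration_iff f).1 hf
  have hg' : (modCof A).rlp.llp g := (cofibration_iff g).1 hg
  have key {X Y M M' : ModA A} (j : X ⟶ Y) (hj : modCof A j) (p : M ⟶ M')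
      (hp : (modCof A).rlp p) :
      (modCof A).rlp ((Opposite.op (Arrow.mk j)) ⋔ (Arrow.mk p)).hom :=
    fun _ _ i hi => Arrow.PushoutProduct.hasLiftingProperty_mk_iff'.1
      (modCof_pushoutProduct_lifting A hi hj _ hp)
  refine (cofibration_iff _).2 fun M M' p hp => ?_
  refine (ParametrizedAdjunction.hasLiftingProperty_iff MonoidalClosed.internalHomAdjunction₂ sq
    (Functor.PullbackObjObj.ofHasPullback ..)).2 (hg' _ fun _ _ j hj => ?_)
  exact Arrow.PushoutProduct.hasLiftingProperty_mk_iff.1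
    (Arrow.PushoutProduct.hasLiftingProperty_mk_iff'.2 (hf' _ (key j hj p hp)))

end PushoutProductAxiom

/-! ### Pushouts and acyclic complexes -/

section AcyclicPushout

open HomologicalComplex

variable {R : Type u} [Ring R] {X Y X' Y' : ChainComplex (ModuleCat.{u} R) ℕ} {f : X ⟶ Y}
  {g : X ⟶ X'} {g' : Y ⟶ Y'} {f' : X' ⟶ Y'}

theorem IsCyc.add {n : ℕ} {z w : X.X n} (h : IsCyc X n z) (h' : IsCyc X n w) :
    IsCyc X n (z + w) := fun j => by rw [map_add, h j, h' j, add_zero]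

theorem acyclic_iff_elements : X.Acyclic ↔ ∀ n z, IsCyc X n z → IsBdry X n z :=
  forall_congr' fun n => exactAt_iff_elements n

theorem acyclicMono_of_acyclic (f : X ⟶ Y) [Mono f] (hX : X.Acyclic) (hY : Y.Acyclic) :
    acyclicMono R f :=
  ⟨‹Mono f›, ⟨fun n => (quasiIsoAt_iff_exactAt f n (hX n)).2 (hY n)⟩⟩

/-- Mayer–Vietoris for `X ⟶ Y ⊞ X' ⟶ Y'`, left exact because `f` is injective. The next theorem but
one direction away uses the same sequence to recover information about `g`. -/
theorem acyclic_of_isPushout (h : IsPushout f g g' f') [Mono f] (hY : Y.Acyclic)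
    (hg : QuasiIso g) : Y'.Acyclic := by
  rw [acyclic_iff_elements] at hY ⊢
  have hq n := (quasiIsoAt_iff_elements g n).1 inferInstance
  intro n y hy
  obtain ⟨a, b, rfl⟩ := pushout_exists_add h y
  -- The two components of a cycle become cycles after a common correction by an element of `X`; in
  -- degree 0 there is nothing to correct.
  obtain ⟨x, hx, hx'⟩ : ∃ x, IsCyc Y n (a + f.f n x) ∧ IsCyc X' n (b - g.f n x) := by
    obtain _ | n := n
    · exact ⟨0, isCyc_zero _, isCyc_zero _⟩
    · have e := hy n
      rw [map_add, ← f_d_apply, ← f_d_apply] at e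
      obtain ⟨x, hx, hx'⟩ := pushout_exists_of_eq h (-Y.d (n + 1) n a) (X'.d (n + 1) n b) (by
        rw [map_neg, neg_eq_iff_add_eq_zero, e])
      obtain ⟨x, rfl⟩ := (hq n).1 x (fun l => f_injective f l (by
        rw [f_d_apply, hx, map_neg, d_d_apply, neg_zero, map_zero])) ⟨b, hx'.symm⟩
      refine ⟨x, isCyc_succ ?_, isCyc_succ ?_⟩
      · rw [map_add, ← f_d_apply, hx, add_neg_cancel]
      · rw [map_sub, ← f_d_apply, hx', sub_self]
  obtain ⟨z, hz, e, he⟩ := (hq n).2 _ hx'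
  obtain ⟨c, hc⟩ := hY n _ (hx.add (hz.map f))
  refine ⟨g'.f (n + 1) c + f'.f (n + 1) e, ?_⟩
  rw [map_add, ← f_d_apply, ← f_d_apply, hc, he, map_add, map_add, map_sub, map_sub,
    f_f_apply h.w, f_f_apply h.w, f_f_apply rfl, f_f_apply rfl]
  abel

/-- The same Mayer–Vietoris sequence, read for `g` once both other corners are acyclic. -/
theorem quasiIso_of_isPushout (h : IsPushout f g g' f') [Mono f] (hY : Y.Acyclic)
    (hY' : Y'.Acyclic) : QuasiIso g := by
  rw [acyclic_iff_elements] at hY hY'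
  refine ⟨fun n => (quasiIsoAt_iff_elements g n).2 ⟨fun x hx ⟨a, ha⟩ => ?_, fun a ha => ?_⟩⟩
  · obtain ⟨c, hc⟩ := hY n _ (hx.map f)
    obtain ⟨p, hp⟩ := hY' (n + 1) (g'.f _ c - f'.f _ a) (isCyc_succ (by
      rw [map_sub, ← f_d_apply, ← f_d_apply, ha, hc, f_f_apply h.w, f_f_apply rfl, sub_self]))
    obtain ⟨c₁, a₁, rfl⟩ := pushout_exists_add h p
    rw [map_add, ← f_d_apply, ← f_d_apply] at hp
    obtain ⟨y, hy, -⟩ := pushout_exists_of_eq h (c - Y.d _ _ c₁) (a + X'.d _ _ a₁) (by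
      rw [map_sub, map_add, sub_eq_iff_eq_add, add_assoc, add_comm (f'.f _ (X'.d _ _ a₁)), hp]
      abel)
    refine ⟨y, f_injective f n ?_⟩
    rw [f_d_apply, hy, map_sub, d_d_apply, sub_zero, hc]
  · obtain ⟨p, hp⟩ := hY' n _ (ha.map f')
    obtain ⟨c₁, a₁, rfl⟩ := pushout_exists_add h p
    rw [map_add, ← f_d_apply, ← f_d_apply] at hp
    obtain ⟨y, hy, hy'⟩ := pushout_exists_of_eq h (Y.d _ _ c₁) (a - X'.d _ _ a₁) (by
      rw [map_sub, ← hp, add_sub_cancel_right])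
    refine ⟨y, fun l => f_injective f l ?_, a₁, ?_⟩
    · rw [f_d_apply, hy, d_d_apply, map_zero]
    · rw [hy', sub_sub_cancel]

end AcyclicPushout

/-! ### Spheres tensored with acyclic complexes -/

section Flatness

variable {k O : Type u} [Field k] [CommRing O] [Algebra k O] [CharZero k] [Algebra.Smooth k O]

/-- The tensor product with a flat module preserves exactness. -/
theorem exact_whiskerLeft (M : DCat k O) [Module.Flat O (und M)] {N P Q : DCat k O} (f : N ⟶ P)
    (g : P ⟶ Q) (h : Function.Exact f g) : Function.Exact (M ◁ f) (M ◁ g) :=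
  Module.Flat.lTensor_exact (und M) (f := ((resO k O).map f).hom)
    (g := ((resO k O).map g).hom) h

/-- For `q = 0` the truncated `q - 1` is again 0 and the outgoing map is zero, so the statement
covers surjectivity onto degree 0. -/
theorem exact_d_of_acyclic {L : DGDM k O} (hL : L.Acyclic) (q : ℕ) :
    Function.Exact (L.d (q + 1) q) (L.d q (q - 1)) := by
  rw [acyclic_iff_elements] at hL
  intro z
  constructor
  · intro hz
    refine hL q z ?_
    obtain _ | q := q
    · exact isCyc_zero z
    · exact isCyc_succ hz
  · rintro ⟨e, rfl⟩
    exact d_d_apply L _ _ _ e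

instance flat_sphere_X (n : ℕ) : Module.Flat O (und ((sphere k O n).X n)) :=
  Module.Flat.of_linearEquiv
    ((resO k O).mapIso (HomologicalComplex.singleObjXSelf (ComplexShape.down ℕ) n
      (regD k O))).toLinearEquiv

theorem isIso_cι_sphere (n : ℕ) (L : DGDM k O) (q : ℕ) :
    IsIso (cι (sphere k O n) L n q (n + q) rfl) :=
  isIso_cι rfl fun _ _ _ hp => isZero_tensor_of_left _
    (HomologicalComplex.isZero_single_obj_X _ _ _ _ hp)

theorem cι_sphere_d (n : ℕ) (L : DGDM k O) (q : ℕ) :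
    cι (sphere k O n) L n (q + 1) (n + (q + 1)) rfl ≫
      (sphere k O n ⊗ L : DGDM k O).d (n + (q + 1)) (n + q) =
    (-1 : ℤ) ^ n •
      (((sphere k O n).X n ◁ L.d (q + 1) q) ≫ cι (sphere k O n) L n q (n + q) rfl) := by
  rw [cι_d, cd₂_succ _ _ _ _ _ rfl]
  have : cd₁ (sphere k O n) L n (q + 1) (n + q) = 0 := by
    obtain _ | n := n
    · exact cd₁_zero ..
    · rw [cd₁_succ _ _ _ _ _ (by omega)]
      have hd : (sphere k O (n + 1)).d (n + 1) n = 0 := HomologicalComplex.single_obj_d ..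
      rw [hd]
      simp
  rw [this, zero_add]

/-- Up to a shift and signs, the complex is `L` tensored degreewise with `D`, which is projective
and hence flat over `O`. -/
theorem sphere_tensor_acyclic (n : ℕ) {L : DGDM k O} (hL : L.Acyclic) :
    (sphere k O n ⊗ L : DGDM k O).Acyclic := by
  rw [acyclic_iff_elements]
  intro m z hz
  by_cases hm : m < n
  · have h0 : IsZero ((sphere k O n ⊗ L : DGDM k O).X m) := isZero_tensor_X fun p q h =>
      isZero_tensor_of_left _ (HomologicalComplex.isZero_single_obj_X _ _ _ _ (by omega))
    have := ModuleCat.subsingleton_of_isZero h0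
    exact ⟨0, Subsingleton.elim _ _⟩
  obtain ⟨q, rfl⟩ : ∃ q, m = n + q := ⟨m - n, by omega⟩
  have hι (q : ℕ) : Function.Bijective (cι (sphere k O n) L n q (n + q) rfl) := by
    have := isIso_cι_sphere n L q
    exact ConcreteCategory.bijective_of_isIso _
  have hd (q : ℕ) (y) : (sphere k O n ⊗ L : DGDM k O).d (n + (q + 1)) (n + q)
      (cι (sphere k O n) L n (q + 1) (n + (q + 1)) rfl y) =
      (-1 : ℤ) ^ n • cι (sphere k O n) L n q (n + q) rfl
        (((sphere k O n).X n ◁ L.d (q + 1) q) y) :=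
    congrArg (fun f => f.hom y) (cι_sphere_d n L q)
  have hs (M : Type u) [AddCommGroup M] (x : M) : (-1 : ℤ) ^ n • (-1 : ℤ) ^ n • x = x := by
    rw [smul_smul, ← mul_pow]; simp
  obtain ⟨y, rfl⟩ := (hι q).2 z
  have hy : ((sphere k O n).X n ◁ L.d q (q - 1)) y = 0 := by
    obtain _ | q := q
    · rw [L.shape _ _ (by simp)]
      simp
    · have h₁ := hz (n + q)
      rw [hd] at h₁
      apply (hι q).1
      rw [map_zero, ← hs _ (cι (sphere k O n) L n q (n + q) rfl _)]
      exact (congrArg ((-1 : ℤ) ^ n • ·) h₁).trans (smul_zero _)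
  obtain ⟨e, rfl⟩ := (exact_whiskerLeft _ _ _ (exact_d_of_acyclic hL q) y).1 hy
  refine ⟨(-1 : ℤ) ^ n • cι (sphere k O n) L n (q + 1) (n + (q + 1)) rfl e, ?_⟩
  exact (map_zsmul _ _ _).trans ((congrArg ((-1 : ℤ) ^ n • ·) (hd q e)).trans (hs _ _))

end Flatness

/-! ### Degreewise split monomorphisms -/

section SplitMono

open Category

theorem genCof_f_split {k O : Type u} [Field k] [CommRing O] [Algebra k O] {X Y : DGDM k O}
    {i : X ⟶ Y} (hi : genCof k O i) (q : ℕ) : ∃ r : Y.X q ⟶ X.X q, i.f q ≫ r = 𝟙 _ := by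
  obtain ⟨n, hn, -⟩ := genCof_isCell hi
  by_cases hq : q = n
  · subst hq
    exact ⟨0, hn.isZero_left.eq_of_src _ _⟩
  · have := hn.isIso q hq
    exact ⟨inv (i.f q), by simp⟩

variable {k O : Type u} [Field k] [CommRing O] [Algebra k O] [CharZero k] [Algebra.Smooth k O]

/-- The retractions need not commute with the differentials: injectivity is a degreewise matter, and
degreewise splittings survive the tensor product. -/
theorem mono_whiskerRight_of_split {X Y : DGDM k O} (i : X ⟶ Y)
    (hi : ∀ q, ∃ r : Y.X q ⟶ X.X q, i.f q ≫ r = 𝟙 _) (L : DGDM k O) : Mono (i ▷ L) := by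
  choose r hr using hi
  have (m : ℕ) : Mono ((i ▷ L : X ⊗ L ⟶ Y ⊗ L).f m) := by
    have e : (i ▷ L : X ⊗ L ⟶ Y ⊗ L).f m ≫
        cdesc (fun p q h => (r p ▷ L.X q) ≫ cι X L p q m h) = 𝟙 _ := cι_ext fun p q h => by
      rw [cι_whiskerRight_assoc, cι_desc, ← comp_whiskerRight_assoc, hr, id_whiskerRight, id_comp,
        comp_id]
    exact mono_of_mono_fac e
  exact HomologicalComplex.mono_of_mono_f _ this

end SplitMono

/-! ### The unit axiom -/

section UnitAxiom

open ZeroObject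

variable {k O : Type u} [Field k] [CommRing O] [Algebra k O] [CharZero k] [Algebra.Smooth k O]
  (A : DGDA k O)

theorem cofibrations_le_mono (Z : ModA A) : cofibrations (ModA A) ≤
    (MorphismProperty.monomorphisms (DGDM k O)).inverseImage (tensorForget A Z) := by
  rw [cofibrations_eq_llp]
  refine llp_rlp_le_inverseImage _ _ _ ?_
  rintro _ _ _ ⟨hi⟩
  refine ((MorphismProperty.monomorphisms (DGDM k O)).arrow_mk_iso_iff
    (freeTensorArrowIso A _ Z)).1 ?_
  exact mono_whiskerRight_of_split _ (genCof_f_split hi) Z.X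

/-- On generators, source and target are acyclic after tensoring with `Z`: spheres by flatness,
discs by contractibility. -/
theorem cofibrations_le_acyclicMono {Z : ModA A} (hZ : Z.X.Acyclic) : cofibrations (ModA A) ≤
    (acyclicMono (DRing k O)).inverseImage (tensorForget A Z) := by
  rw [cofibrations_eq_llp]
  refine llp_rlp_le_inverseImage _ _ _ ?_
  rintro _ _ _ ⟨hi⟩
  refine ((acyclicMono (DRing k O)).arrow_mk_iso_iff (freeTensorArrowIso A _ Z)).1 ?_
  obtain _ | n := hi
  · exact acyclicMono_of_isZero _ ((tensorRight Z.X).map_isZero (isZero_zero _))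
      (sphere_tensor_acyclic 0 hZ)
  · have := mono_whiskerRight_of_split _ (genCof_f_split (genCof.succ (k := k) (O := O) n)) Z.X
    exact acyclicMono_of_acyclic _ (sphere_tensor_acyclic n hZ) (disc_tensor_acyclic n Z.X)

theorem acyclic_of_isZero {R : Type u} [Ring R] {X : ChainComplex (ModuleCat.{u} R) ℕ}
    (h : IsZero X) : X.Acyclic := by
  rw [acyclic_iff_elements]
  intro n z _
  have h₀ : IsZero (X.X n) :=
    (HomologicalComplex.eval (ModuleCat.{u} R) (ComplexShape.down ℕ) n).map_isZero h
  have := ModuleCat.subsingleton_of_isZero h₀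
  exact ⟨0, Subsingleton.elim _ _⟩

/-- Tensoring the cofibration from the initial module to `Z` with the acyclic `L` gives a
quasi-isomorphism with zero source. -/
theorem acyclic_tensor_of_isCofibrant {L : ModA A} (hL : L.X.Acyclic) (Z : ModA A)
    [IsCofibrant Z] : (L ⊗ Z : ModA A).X.Acyclic := by
  have h₁ := cofibrations_le_acyclicMono A hL (initial.to Z) (mem_cofibrations _)
  have h₀ : IsZero ((tensorForget A L).obj (⊥_ (ModA A))) :=
    (initialIsInitial.isInitialObj (tensorForget A L) _).isZero
  have hq : QuasiIso ((tensorForget A L).map (initial.to Z)) := h₁.2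
  have h₂ : HomologicalComplex.Acyclic ((tensorForget A L).obj Z) := fun n =>
    (quasiIsoAt_iff_exactAt _ n (acyclic_of_isZero h₀ n)).1 (hq.quasiIsoAt n)
  exact acyclic_of_iso ((Mod.forget A.X).mapIso (β_ Z L)) h₂

theorem acyclic_of_weakEquivalence_terminal {L T : ModA A} (hT : IsTerminal T) (p : L ⟶ T)
    [hp : WeakEquivalence p] : L.X.Acyclic := by
  have : PreservesLimits (Mod.forget (D := DGDM k O) A.X) :=
    (freeAdj A.X).rightAdjoint_preservesLimits
  have h₀ : IsZero ((Mod.forget (D := DGDM k O) A.X).obj T) :=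
    (hT.isTerminalObj (Mod.forget A.X) _).isZero
  have hq : QuasiIso ((Mod.forget (D := DGDM k O) A.X).map p) := (weakEquivalence_iff p).1 hp
  exact fun n => (quasiIsoAt_iff_exactAt' _ n (acyclic_of_isZero h₀ n)).1 (hq.quasiIsoAt n)

theorem mono_hom_of_cofibration {X Y : ModA A} (f : X ⟶ Y) [Cofibration f] :
    Mono ((Mod.forget (D := DGDM k O) A.X).map f) := by
  have e : Arrow.mk (f ▷ 𝟙_ (ModA A)) ≅ Arrow.mk f :=
    Arrow.isoMk (ρ_ X) (ρ_ Y) (rightUnitor_naturality f).symm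
  exact ((MorphismProperty.monomorphisms (DGDM k O)).arrow_mk_iso_iff
    ((Mod.forget A.X).mapArrow.mapIso e)).1 (cofibrations_le_mono A _ f (mem_cofibrations f))

theorem mod_unitAxiom {Q : ModA A} (q : Q ⟶ 𝟙_ (ModA A)) [IsCofibrant Q] [Fibration q]
    [hq : WeakEquivalence q] (Z : ModA A) [IsCofibrant Z] : WeakEquivalence (q ▷ Z) := by
  -- Factoring the map to the terminal module makes `C` an acyclic cone for `Q`.
  obtain ⟨C, j, p, -, hj, hp⟩ :=
    MorphismProperty.factorizationData (cofibrations (ModA A)) (trivialFibrations (ModA A))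
      (terminal.from Q)
  have : Cofibration j := (cofibration_iff j).2 hj
  have : WeakEquivalence p := (weakEquivalence_iff p).2 hp.2
  have : PreservesFiniteColimits (Mod.forget (D := DGDM k O) A.X) :=
    PreservesColimits.preservesFiniteColimits _
  have : PreservesFiniteColimits (tensorForget A Z) :=
    PreservesColimits.preservesFiniteColimits _
  have hC := acyclic_of_weakEquivalence_terminal A terminalIsTerminal p
  have sq := IsPushout.of_hasPushout j q
  have := mono_hom_of_cofibration A j
  have hP := acyclic_of_isPushout (sq.map (Mod.forget A.X)) hC ((weakEquivalence_iff q).1 hq)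
  have : Mono ((tensorForget A Z).map j) := cofibrations_le_mono A Z j hj
  -- The square is tensored with `Z`: it remains a pushout with injective `j ⊗ Z`, and its two
  -- corners other than source and target of `q ⊗ Z` are acyclic.
  exact (weakEquivalence_iff _).2 (quasiIso_of_isPushout (sq.map (tensorForget A Z))
    (acyclic_tensor_of_isCofibrant A hC Z) (acyclic_tensor_of_isCofibrant A hP Z))

theorem mod_isMonoidalModel : IsMonoidalModel (ModA A) where
  pushoutProduct f g _ _ sq := cofibrations_pushoutProduct A f g sq
  pushoutProduct_trivial f g _ _ sq h := weakEquivalence_pushoutProduct A f g sq h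
  unit q _ _ _ Z _ := mod_unitAxiom A q Z

end UnitAxiom

end DMod.ModuleModel

end

theorem theoremP (k O : Type u) [Field k] [IsAlgClosed k] [CharZero k] [CommRing O] [Algebra k O]
    [Algebra.Smooth k O] (A : DGDA k O) :
    (∃ _ : ModelCategory (ModA A),
      IsCompleteFunctorialModel (ModA A) ∧
      weakEquivalences (ModA A) = weqD.inverseImage (Mod.forget A.X) ∧
      fibrations (ModA A) = fibD.inverseImage (Mod.forget A.X) ∧
      cofibrations (ModA A) = (trivialFibrations (ModA A)).llp ∧
      IsCofibrantlyGeneratedBy (ModA A) ((genCof k O).strictMap (freeFunctor A.X))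
        ((genTrivCof k O).strictMap (freeFunctor A.X)) ∧
      ∃ (_ : MonoidalCategory (ModA A)) (_ : SymmetricCategory (ModA A))
        (_ : MonoidalClosed (ModA A)) (_ : (Mod.forget (D := DGDM k O) A.X).LaxBraided),
        IsRelativeTensor A.X ∧ IsMonoidalModel (ModA A) ∧ MonoidAxiom (ModA A)) ∧
    (Monad.comparison (freeAdj A.X)).IsEquivalence :=
  ⟨⟨ModuleModel.modModelCategory A, ModuleModel.mod_isCompleteFunctorialModel A, rfl, rfl,
    (ModuleModel.cofibrations_eq_llp A).trans
      (congrArg _ (ModuleModel.trivialFibrations_eq_rlp A).symm),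
    ModuleModel.mod_isCofibrantlyGeneratedBy A, ModuleModel.relMonoidal,
    ModuleModel.relSymmetric, ModuleModel.mod_closed A.X, ModuleModel.forgetLaxBraided,
    ModuleModel.isRelativeTensor, ModuleModel.mod_isMonoidalModel A,
    ModuleModel.mod_monoidAxiom A⟩, ModuleModel.comparison_isEquivalence A.X⟩
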